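/- Let $n,N\ge 1$ and let $\Omega\subset\mathbb{R}^n$ be a bounded strictly convex domain (nonempty, open, convex, with no non-trivial line segment contained in $\partial\Omega$). Let $\mathbf{A}=(\mathbf{A}_{\alpha i\beta j})$, $1\le\alpha,\beta\le N$, $1\le i,j\le n$, be real constants with $\mathbf{A}_{\alpha i\beta j}=\mathbf{A}_{\beta j\alpha i}$ and $\sum_{\alpha,i,\beta,j}\mathbf{A}_{\alpha i\beta j}Q_{\alpha i}Q_{\beta j}\ge 0$ for all $Q\in\mathbb{R}^{Nn}$. Let $\Pi\subseteq\mathbb{R}^{Nn}$ be the orthogonal complement of the nullspace of the linear map $Q\mapsto\big(\sum_{\beta,j}\mathbf{A}_{\alpha i\beta j}Q_{\beta j}\big)_{\alpha i}$, and let $\Sigma\subseteq\mathbb{R}^N$ be the linear span of all $\eta\in\mathbb{R}^N$ such that $\eta\otimes a\in\Pi$ for some $a\in\mathbb{R}^n\setminus\{0\}$; the orthogonal projections onto these subspaces are denoted by the same letters. Assume that $\Pi$ is spanned by the matrices of the form $\eta\otimes a$ that it contains. Write $L^2(\Omega,\Sigma)$ for the space of square integrable maps $\Omega\to\mathbb{R}^N$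 with values a.e. in $\Sigma$. Partial trace. Let $U\subseteq\mathbb{R}^n$ be a bounded strictly convex domain, $u\in L^2(U,\Sigma)$, and $g:\partial U\to\mathbb{R}^N$ an $\mathcal{H}^{n-1}$-measurable map. We say that $g$ is the partial trace of $u$ on $\partial U$ if there are $C^1$ maps $\varphi_k:\mathbb{R}^n\to\mathbb{R}^N$, a map $G\in L^2(U,\mathbb{R}^{Nn})$ and a closed set $E\subseteq\partial U$ with $\mathcal{H}^{n-1}(E)=0$ such that $\Sigma\varphi_k\to u$ and $\Pi D\varphi_k\to G$ in $L^2(U)$, and $\Sigma\varphi_k\to g$ in $L^2(\Gamma,\mathcal{H}^{n-1})$ for every compact $\Gamma\subseteq\partial U\setminus E$. Then for every $f\in L^2(\Omega,\Sigma)$ there is a map $u:\overline\Omega\to\mathbb{R}^N$ with the following properties. (i) Existence. $u\in L^2(\Omega,\Sigma)$ and $u$ solves the Dirichlet problem $\sum_{\beta,i,j}\mathbf{A}_{\alpha i\beta j}D^2_{ij}u_\beta=f_\alpha$ in $\Omega$ ($\alpha=1,\dots,N$), $u=0$ on $\partial\Omega$, in this sense: for all $\phi\in C_c^\infty(\Omega,\Sigma)$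 $$\int_\Omega\sum_{\alpha,\beta,i,j}\mathbf{A}_{\alpha i\beta j}\,u_\beta\,D^2_{ij}\phi_\alpha=\int_\Omega\sum_\alpha f_\alpha\phi_\alpha ,$$ the restriction $u|_{\partial\Omega}$ is the partial trace of $u$ on $\partial\Omega$, and $u=0$ $\mathcal{H}^{n-1}$-a.e. on $\partial\Omega$. (ii) Uniqueness. Any map in $L^2(\Omega,\Sigma)$ that solves the Dirichlet problem in the sense of (i) equals $u$ a.e. in $\Omega$. (iii) For every strictly convex subdomain $U\subseteq\Omega$, the restriction $u|_{\partial U}$ is $\mathcal{H}^{n-1}$-measurable and is the partial trace of $u$ on $\partial U$. (iv) Partial regularity. For every $\eta\in\mathbb{R}^N$ and $a\in\mathbb{R}^n$ with $\eta\otimes a\in\Pi$, the weak directional derivative $D_a(\eta\cdot u)$ exists in $L^2(\Omega)$. -/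

import Mathlib

open MeasureTheory Filter Topology
open scoped ContDiff

noncomputable section

namespace DegenerateSystem

/-- `ℝᵈ` with its Euclidean norm. -/
abbrev Vec (d : ℕ) : Type := EuclideanSpace ℝ (Fin d)

/-- The matrix space `ℝ^{Nn}` with its Euclidean (Frobenius) inner product. -/
abbrev Mat (N n : ℕ) : Type := EuclideanSpace ℝ (Fin N × Fin n)

/-- The rank-one matrix `η ⊗ a`. -/
def tensor {N n : ℕ} (η : Vec N) (a : Vec n) : Mat N n :=
  WithLp.toLp 2 fun p => η p.1 * a p.2

/-- The linear map `Q ↦ (∑_{β,j} A_{αiβj} Q_{βj})_{αi}` induced by the four-tensor `A`. -/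
def tensorMap {N n : ℕ} (A : Fin N → Fin n → Fin N → Fin n → ℝ) : Mat N n →ₗ[ℝ] Mat N n where
  toFun Q := WithLp.toLp 2 fun p => ∑ β, ∑ j, A p.1 p.2 β j * Q (β, j)
  map_add' P Q := by
    ext p
    simp [mul_add, Finset.sum_add_distrib]
  map_smul' c Q := by
    ext p
    simp [Finset.mul_sum, mul_left_comm]

/-- `A` is a symmetric convex (that is, nonnegative) quadratic form on `ℝ^{Nn}`. -/
def IsSymmConvexForm {N n : ℕ} (A : Fin N → Fin n → Fin N → Fin n → ℝ) : Prop :=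
  (∀ α i β j, A α i β j = A β j α i) ∧
    ∀ Q : Mat N n, 0 ≤ ∑ α, ∑ i, ∑ β, ∑ j, A α i β j * Q (α, i) * Q (β, j)

/-- The subspace `Π`: the orthogonal complement of the nullspace of `A`. -/
def rangeSpace {N n : ℕ} (A : Fin N → Fin n → Fin N → Fin n → ℝ) : Submodule ℝ (Mat N n) :=
  (LinearMap.ker (tensorMap A))ᗮ

/-- The subspace `Σ ⊆ ℝᴺ`: the span of the `η` with `η ⊗ a ∈ Π` for some direction `a ≠ 0`. -/
def sigmaSpace {N n : ℕ} (A : Fin N → Fin n → Fin N → Fin n → ℝ) : Submodule ℝ (Vec N) :=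
  Submodule.span ℝ {η | ∃ a : Vec n, a ≠ 0 ∧ tensor η a ∈ rangeSpace A}

/-- `Π` is spanned by the rank-one matrices it contains. -/
def SpannedByRankOne {N n : ℕ} (P : Submodule ℝ (Mat N n)) : Prop :=
  Submodule.span ℝ {Q : Mat N n | Q ∈ P ∧ ∃ (η : Vec N) (a : Vec n), Q = tensor η a} = P

/-- Bounded strictly convex domains. The boundary contains no segment; this is strict convexity of
the closure, since every open convex set is `StrictConvex` in the sense of Mathlib. -/
structure IsStrictlyConvexDomain {n : ℕ} (U : Set (Vec n)) : Prop where
  isOpen : IsOpen U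
  nonempty : U.Nonempty
  bounded : Bornology.IsBounded U
  convex : Convex ℝ U
  strictConvex_closure : StrictConvex ℝ (closure U)

/-- The partial derivative `D_i g` of a scalar function. -/
def partialD {n : ℕ} (i : Fin n) (g : Vec n → ℝ) (x : Vec n) : ℝ :=
  fderiv ℝ g x (EuclideanSpace.single i 1)

/-- The gradient matrix `(D_i φ_α)_{αi}`. -/
def gradMat {N n : ℕ} (φ : Vec n → Vec N) (x : Vec n) : Mat N n :=
  WithLp.toLp 2 fun p => partialD p.2 (fun y => φ y p.1) x

/-- The space `L²(Ω, S)` of square integrable maps with values a.e. in the subspace `S`. -/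
def MemL2 {N n : ℕ} (Ω : Set (Vec n)) (S : Submodule ℝ (Vec N)) (u : Vec n → Vec N) : Prop :=
  MemLp u 2 (volume.restrict Ω) ∧ ∀ᵐ x ∂(volume.restrict Ω), u x ∈ S

/-- The test maps `C_c^∞(Ω, S)`. -/
structure IsTestMap {N n : ℕ} (Ω : Set (Vec n)) (S : Submodule ℝ (Vec N))
    (φ : Vec n → Vec N) : Prop where
  smooth : ContDiff ℝ ∞ φ
  compact : HasCompactSupport φ
  support : tsupport φ ⊆ Ω
  mem : ∀ x, φ x ∈ S

/-- Distributional solutions in `𝒟'(Ω, Σ)` of `∑ A_{αiβj} D²_{ij} u_β = f_α`. -/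
def IsDistribSolution {N n : ℕ} (A : Fin N → Fin n → Fin N → Fin n → ℝ) (Ω : Set (Vec n))
    (f u : Vec n → Vec N) : Prop :=
  LocallyIntegrableOn u Ω ∧
    ∀ φ : Vec n → Vec N, IsTestMap Ω (sigmaSpace A) φ →
      ∫ x in Ω, ∑ α, ∑ β, ∑ i, ∑ j,
          A α i β j * u x β * partialD i (partialD j fun y => φ y α) x
        = ∫ x in Ω, ∑ α, f x α * φ x α

/-- The Hausdorff measure `ℋ^{n-1}` on `ℝⁿ`, restricted to the set `S`. -/
def surfaceMeasure {n : ℕ} (S : Set (Vec n)) : Measure (Vec n) :=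
  (Measure.hausdorffMeasure ((n : ℝ) - 1)).restrict S

/-- `g` is the partial trace on `∂U` of `u ∈ L²(U, Σ)`. The partial trace operator is the extension
of restriction to the boundary, `φ ↦ (Σφ)|_{∂U}` for `φ` of class `C¹` up to the boundary, by
continuity from the norm `‖Σφ‖_{L²(U)} + ‖ΠDφ‖_{L²(U)}` to `L²(Γ, ℋ^{n-1})` for all compact subsets
`Γ` of `∂U` off a closed `ℋ^{n-1}`-null set `E`. In particular `u` belongs to the closure of the
`C¹` maps in that norm, the limit `G` of `ΠDφ_k` being `ΠDu`. -/
def HasPartialTrace {N n : ℕ} (A : Fin N → Fin n → Fin N → Fin n → ℝ) (U : Set (Vec n))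
    (u g : Vec n → Vec N) : Prop :=
  MemL2 U (sigmaSpace A) u ∧
  AEMeasurable g (surfaceMeasure (frontier U)) ∧
  ∃ (G : Vec n → Mat N n) (E : Set (Vec n)) (φ : ℕ → Vec n → Vec N),
    MemLp G 2 (volume.restrict U) ∧
    E ⊆ frontier U ∧ IsClosed E ∧ surfaceMeasure (frontier U) E = 0 ∧
    (∀ k, ContDiff ℝ 1 (φ k)) ∧
    Tendsto (fun k => eLpNorm (fun x => (sigmaSpace A).starProjection (φ k x) - u x) 2
      (volume.restrict U)) atTop (𝓝 0) ∧
    Tendsto (fun k => eLpNorm (fun x => (rangeSpace A).starProjection (gradMat (φ k) x) - G x) 2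
      (volume.restrict U)) atTop (𝓝 0) ∧
    ∀ Γ : Set (Vec n), IsCompact Γ → Γ ⊆ frontier U \ E →
      Tendsto (fun k => eLpNorm (fun x => (sigmaSpace A).starProjection (φ k x) - g x) 2
        (surfaceMeasure Γ)) atTop (𝓝 0)

/-- `u`, a map on the closure of `Ω`, is a distributional solution in `L²(Ω, Σ)` of the Dirichlet
problem: its values on `∂Ω` are its partial trace, and they vanish `ℋ^{n-1}`-a.e. -/
structure IsDirichletSolution {N n : ℕ} (A : Fin N → Fin n → Fin N → Fin n → ℝ)
    (Ω : Set (Vec n)) (f u : Vec n → Vec N) : Prop where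
  memL2 : MemL2 Ω (sigmaSpace A) u
  equation : IsDistribSolution A Ω f u
  trace : HasPartialTrace A Ω u u
  boundary : ∀ᵐ x ∂(surfaceMeasure (frontier Ω)), u x = 0

/-- `g` is the weak directional derivative `D_a w` of the scalar function `w` in `Ω`. -/
def IsWeakDirDeriv {n : ℕ} (Ω : Set (Vec n)) (a : Vec n) (w g : Vec n → ℝ) : Prop :=
  LocallyIntegrableOn w Ω ∧ LocallyIntegrableOn g Ω ∧
    ∀ ψ : Vec n → ℝ, ContDiff ℝ ∞ ψ → HasCompactSupport ψ → tsupport ψ ⊆ Ω →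
      ∫ x in Ω, w x * fderiv ℝ ψ x a = -∫ x in Ω, g x * ψ x

end DegenerateSystem

end

/-! The form `A` is degenerate, but it is coercive on Π (`exists_coercive`), so it controls `ΠDφ`.
If `η ⊗ a` lies in Π, then `⟨η ⊗ a, ΠDφ⟩ = D_a(η·φ)`, so one genuine directional derivative of each
such component is controlled. Finitely many of these `η` span Σ (`exists_frame`). Hence every
estimate for Σ-valued maps reduces to one-dimensional calculus along lines parallel to a fixed `a ≠
0`.

Existence. Integration along `a` gives a Poincaré inequality (`exists_poincare`). Lax–Milgram on the
`L²` closure of the pairs `(φ, ΠDφ)`, `φ` a test map, then yields a weak solution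
(`exists_weak_solution`). Integration by parts on the approximating maps turns the weak equation
into the distributional one.

Traces. Along `a` a function is controlled at boundary points whose line in direction `a` enters the
domain. The remaining points form the shadow of `a`, which strict convexity makes `ℋ^{n-1}`-null
(`hausdorffMeasure_shadow`). Near any other boundary point the boundary is a Lipschitz graph in a
direction parallel to `a`, and Fubini gives `exists_trace_estimate`. To have one map that is the
trace on every `∂U` at once, a rapidly converging sequence of test maps is chosen and `u` is its
pointwise limit. This limit does not depend on any measure, yet it is the `L²` limit in every
measure dominated by the energy (`IsEnergyLimit.exists_representative`). Since test maps vanish off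
`Ω`, so does `u`, in particular on `∂Ω`.

Uniqueness. A map with vanishing partial trace, extended by zero, keeps its weak derivatives across
`∂Ω` (`integral_eq_zero_of_zero_trace`). Contracting towards an interior point and mollifying makes
it a limit of test maps (`exists_isEnergyLimit_of_partialTrace`); there the spanning of Π by
rank-one matrices is needed to recover `ΠDφ` from the directional derivatives. Two solutions thus
differ by an energy limit with zero right-hand side, which coercivity and Poincaré force to vanish
(`IsEnergyLimit.ae_eq_zero`). -/

namespace DegenerateSystem

/-! ### Linear algebra of Π, Σ and rank-one matrices -/

section LinearAlgebra

variable {N n : ℕ}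

theorem inner_vec {d : ℕ} (x y : Vec d) : inner ℝ x y = ∑ i, x i * y i := by
  simp [PiLp.inner_apply, mul_comm]

theorem inner_mat (P Q : Mat N n) : inner ℝ P Q = ∑ α, ∑ i, P (α, i) * Q (α, i) := by
  simp [PiLp.inner_apply, Fintype.sum_prod_type, mul_comm]

theorem inner_tensor (η : Vec N) (a : Vec n) (Q : Mat N n) :
    inner ℝ (tensor η a) Q = ∑ α, η α * ∑ i, a i * Q (α, i) := by
  simp [inner_mat, tensor, Finset.mul_sum, mul_assoc]

theorem fderiv_coord {φ : Vec n → Vec N} {x : Vec n} (h : DifferentiableAt ℝ φ x) (a : Vec n)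
    (α : Fin N) : fderiv ℝ (fun y => φ y α) x a = fderiv ℝ φ x a α := by
  have h1 : HasFDerivAt (fun y => φ y α)
      ((EuclideanSpace.proj (𝕜 := ℝ) α).comp (fderiv ℝ φ x)) x :=
    (EuclideanSpace.proj (𝕜 := ℝ) α).hasFDerivAt.comp x h.hasFDerivAt
  rw [h1.fderiv]
  rfl

theorem sum_partialD (g : Vec n → ℝ) (x a : Vec n) :
    ∑ i, a i * partialD i g x = fderiv ℝ g x a := by
  conv_rhs => rw [← (EuclideanSpace.basisFun (Fin n) ℝ).sum_repr a]
  simp [partialD, map_sum]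

theorem fderiv_inner_left {φ : Vec n → Vec N} {x : Vec n} (h : DifferentiableAt ℝ φ x)
    (η : Vec N) (a : Vec n) :
    fderiv ℝ (fun y => inner ℝ η (φ y)) x a = inner ℝ η (fderiv ℝ φ x a) := by
  have h1 : HasFDerivAt (fun y => inner ℝ η (φ y)) ((innerSL ℝ η).comp (fderiv ℝ φ x)) x :=
    (innerSL ℝ η).hasFDerivAt.comp x h.hasFDerivAt
  rw [h1.fderiv]
  rfl

theorem inner_tensor_gradMat {φ : Vec n → Vec N} {x : Vec n} (h : DifferentiableAt ℝ φ x)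
    (η : Vec N) (a : Vec n) :
    inner ℝ (tensor η a) (gradMat φ x) = fderiv ℝ (fun y => inner ℝ η (φ y)) x a := by
  rw [inner_tensor, fderiv_inner_left h, inner_vec]
  refine Finset.sum_congr rfl fun α _ => ?_
  rw [← fderiv_coord h, ← sum_partialD]
  rfl

/-- A finite family of directions controlling the norm on `Σ`. -/
theorem exists_frame (A : Fin N → Fin n → Fin N → Fin n → ℝ) :
    ∃ (T : Finset (Vec N × Vec n)) (C : ℝ), 0 ≤ C ∧
      (∀ p ∈ T, p.2 ≠ 0 ∧ tensor p.1 p.2 ∈ rangeSpace A) ∧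
      ∀ ξ ∈ sigmaSpace A, ‖ξ‖ ≤ C * ∑ p ∈ T, ‖inner ℝ p.1 ξ‖ := by
  classical
  obtain ⟨S, hS, hspan⟩ := (Submodule.fg_span_iff_fg_span_finset_subset
    {η : Vec N | ∃ a : Vec n, a ≠ 0 ∧ tensor η a ∈ rangeSpace A}).1
      (IsNoetherian.noetherian (R := ℝ) (M := Vec N) _)
  have hS' : ∀ η ∈ S, ∃ a : Vec n, a ≠ 0 ∧ tensor η a ∈ rangeSpace A := fun η hη => hS hη
  choose! dir hdir0 hdir using hS'
  -- The pairings with a spanning family separate the points of Σ; an injective linear map in finite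
  -- dimension is bounded below, which gives `C`.
  set f : sigmaSpace A →ₗ[ℝ] (S → ℝ) :=
    LinearMap.pi fun η => ((innerSL ℝ (η : Vec N)) : Vec N →ₗ[ℝ] ℝ).comp (sigmaSpace A).subtype
    with hf
  have hker : LinearMap.ker f = ⊥ := by
    rw [LinearMap.ker_eq_bot']
    intro ξ hξ
    have h1 : ∀ η ∈ sigmaSpace A, inner ℝ η (ξ : Vec N) = 0 := by
      intro η hη
      rw [sigmaSpace, hspan] at hη
      induction hη using Submodule.span_induction with
      | mem x hx => exact congrFun hξ ⟨x, hx⟩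
      | zero => simp
      | add x y _ _ hx hy => rw [inner_add_left, hx, hy, add_zero]
      | smul c x _ hx => rw [inner_smul_left, hx, mul_zero]
    have := h1 ξ ξ.2
    rw [inner_self_eq_zero] at this
    exact Subtype.ext this
  obtain ⟨K, _, hK⟩ := f.exists_antilipschitzWith hker
  refine ⟨S.image fun η => (η, dir η), K, K.2, ?_, ?_⟩
  · intro p hp
    obtain ⟨η, hη, rfl⟩ := Finset.mem_image.1 hp
    exact ⟨hdir0 η hη, hdir η hη⟩
  · intro ξ hξ
    have h1 : ‖ξ‖ ≤ K * ‖f ⟨ξ, hξ⟩‖ := by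
      simpa using hK.le_mul_dist ⟨ξ, hξ⟩ 0
    refine h1.trans (mul_le_mul_of_nonneg_left ?_ K.2)
    rw [Finset.sum_image (by intro x _ y _ h; exact (Prod.mk.inj h).1)]
    refine (pi_norm_le_iff_of_nonneg (Finset.sum_nonneg fun _ _ => norm_nonneg _)).2 fun η => ?_
    exact Finset.single_le_sum (f := fun η : Vec N => ‖(inner ℝ η ξ : ℝ)‖)
      (fun _ _ => norm_nonneg _) η.2

theorem mem_sigmaSpace {A : Fin N → Fin n → Fin N → Fin n → ℝ} {η : Vec N} {a : Vec n}
    (ha : a ≠ 0) (h : tensor η a ∈ rangeSpace A) : η ∈ sigmaSpace A :=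
  Submodule.subset_span ⟨a, ha, h⟩

theorem tensor_zero_right (η : Vec N) : tensor η (0 : Vec n) = 0 := by
  ext p; simp [tensor]

/-- Elements of `Π` are determined by their inner products with the rank-one elements of `Π`. -/
theorem eq_of_inner_tensor_eq {A : Fin N → Fin n → Fin N → Fin n → ℝ}
    (hspan : SpannedByRankOne (rangeSpace A)) {P Q : Mat N n} (hP : P ∈ rangeSpace A)
    (hQ : Q ∈ rangeSpace A)
    (h : ∀ (η : Vec N) (a : Vec n), a ≠ 0 → tensor η a ∈ rangeSpace A →
      inner ℝ (tensor η a) P = inner ℝ (tensor η a) Q) : P = Q := by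
  have h1 : ∀ R ∈ rangeSpace A, inner ℝ R (P - Q) = 0 := by
    intro R hR
    rw [← hspan] at hR
    induction hR using Submodule.span_induction with
    | mem x hx =>
      obtain ⟨hx, η, a, rfl⟩ := hx
      by_cases ha : a = 0
      · simp [ha, tensor_zero_right]
      · rw [inner_sub_right, h η a ha hx, sub_self]
    | zero => simp
    | add x y _ _ hx hy => rw [inner_add_left, hx, hy, add_zero]
    | smul c x _ hx => rw [inner_smul_left, hx, mul_zero]
  have := h1 _ ((rangeSpace A).sub_mem hP hQ)
  rw [inner_self_eq_zero] at this
  exact sub_eq_zero.1 this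

theorem inner_starProjection_of_mem {E : Type*} [NormedAddCommGroup E] [InnerProductSpace ℝ E]
    (K : Submodule ℝ E) [K.HasOrthogonalProjection] {v : E} (hv : v ∈ K) (w : E) :
    inner ℝ v (K.starProjection w) = inner ℝ v w := by
  rw [← Submodule.inner_starProjection_left_eq_right, Submodule.starProjection_eq_self_iff.2 hv]

variable {A : Fin N → Fin n → Fin N → Fin n → ℝ}

theorem inner_tensorMap (P Q : Mat N n) :
    inner ℝ (tensorMap A P) Q = ∑ α, ∑ i, ∑ β, ∑ j, A α i β j * P (β, j) * Q (α, i) := by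
  simp [inner_mat, tensorMap, Finset.sum_mul]

theorem inner_tensorMap_comm (hA : IsSymmConvexForm A) (P Q : Mat N n) :
    inner ℝ (tensorMap A P) Q = inner ℝ P (tensorMap A Q) := by
  have h : ∀ F : Fin N → Fin n → Fin N → Fin n → ℝ, ∑ α, ∑ i, ∑ β, ∑ j, F α i β j =
      ∑ p : Fin N × Fin n, ∑ q : Fin N × Fin n, F p.1 p.2 q.1 q.2 := by
    intro F
    simp [Fintype.sum_prod_type]
  rw [real_inner_comm (tensorMap A Q) P, inner_tensorMap, inner_tensorMap, h, h, Finset.sum_comm]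
  refine Finset.sum_congr rfl fun p _ => Finset.sum_congr rfl fun q _ => ?_
  rw [hA.1]
  ring

theorem inner_tensorMap_self_nonneg (hA : IsSymmConvexForm A) (Q : Mat N n) :
    0 ≤ inner ℝ (tensorMap A Q) Q := by
  rw [inner_tensorMap]
  refine (hA.2 Q).trans (le_of_eq ?_)
  refine Finset.sum_congr rfl fun α _ => Finset.sum_congr rfl fun i _ =>
    Finset.sum_congr rfl fun β _ => Finset.sum_congr rfl fun j _ => by ring

/-- The part removed by the projection lies in the double orthogonal complement of the nullspace,
that is, in the nullspace. Hence only `ΠDφ` ever enters the form. -/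
theorem tensorMap_starProjection (Q : Mat N n) :
    tensorMap A ((rangeSpace A).starProjection Q) = tensorMap A Q := by
  have h : Q - (rangeSpace A).starProjection Q ∈ LinearMap.ker (tensorMap A) := by
    have := (rangeSpace A).sub_starProjection_mem_orthogonal Q
    rwa [rangeSpace, Submodule.orthogonal_orthogonal] at this
  rw [LinearMap.mem_ker, map_sub, sub_eq_zero] at h
  exact h.symm

theorem tensorMap_mem_rangeSpace (hA : IsSymmConvexForm A) (Q : Mat N n) :
    tensorMap A Q ∈ rangeSpace A := by
  rw [rangeSpace, Submodule.mem_orthogonal']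
  intro R hR
  rw [inner_tensorMap_comm hA, LinearMap.mem_ker.1 hR, inner_zero_right]

/-- A null vector of a nonnegative form minimises it, so the first variation vanishes. The variation
is taken in the direction `R = AQ` itself. -/
theorem tensorMap_eq_zero_of_inner_self (hA : IsSymmConvexForm A) {Q : Mat N n}
    (h : inner ℝ (tensorMap A Q) Q = 0) : tensorMap A Q = 0 := by
  set R := tensorMap A Q with hR
  by_contra hne
  have hR0 : 0 < inner ℝ R R := by
    rw [real_inner_self_eq_norm_sq]
    have := norm_pos_iff.2 hne
    positivity
  have key : ∀ t : ℝ, 0 ≤ 2 * t * inner ℝ R R + t ^ 2 * inner ℝ (tensorMap A R) R := by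
    intro t
    have h1 := inner_tensorMap_self_nonneg hA (Q + t • R)
    have h2 : inner ℝ (tensorMap A R) Q = inner ℝ R R := by
      rw [inner_tensorMap_comm hA]
    rw [map_add, map_smul, inner_add_left, inner_add_right, inner_add_right, inner_smul_left,
      inner_smul_left, inner_smul_right, inner_smul_right, h, h2, ← hR] at h1
    simp only [conj_trivial] at h1
    linarith
  have hB := inner_tensorMap_self_nonneg hA R
  set b := inner ℝ (tensorMap A R) R
  set r := inner ℝ R R
  -- A small negative `t` makes the linear term win; `b + 1` replaces `b` because `b` may be zero.
  have := key (-(r / (b + 1)))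
  have hb1 : 0 < b + 1 := by linarith
  have e : 2 * -(r / (b + 1)) * r + (-(r / (b + 1))) ^ 2 * b
      = -(r ^ 2 * (b + 2)) / (b + 1) ^ 2 := by
    field_simp; ring
  rw [e] at this
  have : -(r ^ 2 * (b + 2)) / (b + 1) ^ 2 < 0 := by
    apply div_neg_of_neg_of_pos <;> nlinarith [sq_pos_of_pos hR0, sq_pos_of_pos hb1]
  linarith

/-- The form `A` is coercive on `Π`. -/
theorem exists_coercive (hA : IsSymmConvexForm A) :
    ∃ c : ℝ, 0 < c ∧ ∀ Q ∈ rangeSpace A, c * ‖Q‖ ^ 2 ≤ inner ℝ (tensorMap A Q) Q := by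
  have hcont : Continuous fun Q : Mat N n => inner ℝ (tensorMap A Q) Q :=
    (LinearMap.continuous_of_finiteDimensional (tensorMap A)).inner continuous_id
  set S := Metric.sphere (0 : Mat N n) 1 ∩ (rangeSpace A : Set (Mat N n))
  have hS : IsCompact S :=
    (isCompact_sphere _ _).inter_right (rangeSpace A).closed_of_finiteDimensional
  -- A null vector of the form that lies in Π is in the nullspace and orthogonal to it. Compactness
  -- of the unit sphere of Π then gives a positive minimum, unless Π is trivial and the sphere is
  -- empty.
  have hpos : ∀ Q ∈ S, 0 < inner ℝ (tensorMap A Q) Q := by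
    rintro Q ⟨h1, h2⟩
    refine lt_of_le_of_ne (inner_tensorMap_self_nonneg hA Q) fun h => ?_
    have h3 := tensorMap_eq_zero_of_inner_self hA h.symm
    have h4 : inner ℝ Q Q = 0 := h2 Q h3
    rw [inner_self_eq_zero] at h4
    simp [h4] at h1
  have : ∃ c : ℝ, 0 < c ∧ ∀ Q ∈ S, c ≤ inner ℝ (tensorMap A Q) Q := by
    rcases S.eq_empty_or_nonempty with h | h
    · exact ⟨1, one_pos, by simp [h]⟩
    · obtain ⟨Q, hQ, hmin⟩ := hS.exists_isMinOn h hcont.continuousOn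
      exact ⟨_, hpos Q hQ, fun R hR => hmin hR⟩
  obtain ⟨c, hc, h⟩ := this
  refine ⟨c, hc, fun Q hQ => ?_⟩
  by_cases h0 : Q = 0
  · simp [h0]
  have hn := norm_pos_iff.2 h0
  have := h (‖Q‖⁻¹ • Q) ⟨by simp [norm_smul, hn.ne'], (rangeSpace A).smul_mem _ hQ⟩
  rw [map_smul, inner_smul_left, inner_smul_right] at this
  simp only [conj_trivial] at this
  have h5 : ‖Q‖⁻¹ * (‖Q‖⁻¹ * inner ℝ (tensorMap A Q) Q) * ‖Q‖ ^ 2 =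
      inner ℝ (tensorMap A Q) Q := by field_simp
  rw [← h5]
  exact mul_le_mul_of_nonneg_right this (by positivity)

end LinearAlgebra

/-! ### Fubini along lines parallel to a vector -/

section Hyperplane

open scoped NNReal ENNReal

variable {n : ℕ}

/-- The hyperplane orthogonal to `b`. -/
noncomputable abbrev hyperplane (b : Vec n) : Submodule ℝ (Vec n) := (Submodule.span ℝ {b})ᗮ

/-- The orthogonal projection onto the hyperplane orthogonal to `b`. -/
noncomputable abbrev hyperProj (b : Vec n) : Vec n →L[ℝ] hyperplane b :=
  (hyperplane b).orthogonalProjectionOnto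

/-- The surface measure of the hyperplane orthogonal to `b`. -/
noncomputable abbrev hyperMeasure (b : Vec n) : Measure (hyperplane b) :=
  Measure.hausdorffMeasure ((n : ℝ) - 1)

theorem hyperProj_self (b : Vec n) : hyperProj b b = 0 :=
  Submodule.orthogonalProjectionOnto_apply_of_mem_orthogonal
    (Submodule.le_orthogonal_orthogonal _ (Submodule.mem_span_singleton_self b))

theorem hyperProj_decomp (b x : Vec n) :
    x = (hyperProj b x : Vec n) + (inner ℝ b x / ‖b‖ ^ 2) • b := by
  have h1 := Submodule.starProjection_add_starProjection_orthogonal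
    (K := Submodule.span ℝ {b}) x
  rw [Submodule.starProjection_singleton] at h1
  conv_lhs => rw [← h1]
  rw [add_comm]
  rfl

theorem hyperProj_coe_add {b : Vec n} (y : hyperplane b) (s : ℝ) :
    hyperProj b ((y : Vec n) + s • b) = y := by
  rw [map_add, map_smul, hyperProj_self, smul_zero, add_zero,
    Submodule.orthogonalProjectionOnto_mem_subspace_eq_self]

theorem inner_coe_add {b : Vec n} (hb : b ≠ 0) (y : hyperplane b) (s : ℝ) :
    inner ℝ b ((y : Vec n) + s • b) / ‖b‖ ^ 2 = s := by
  have h := Submodule.mem_orthogonal_singleton_iff_inner_right.1 y.2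
  have hn := norm_ne_zero_iff.2 hb
  rw [inner_add_right, h, inner_smul_right, real_inner_self_eq_norm_sq]
  field_simp
  ring

theorem finrank_hyperplane {b : Vec n} (hb : b ≠ 0) :
    (Module.finrank ℝ (hyperplane b) : ℝ) = (n : ℝ) - 1 := by
  have h := Submodule.finrank_add_finrank_orthogonal (Submodule.span ℝ {b})
  rw [finrank_span_singleton hb, finrank_euclideanSpace_fin] at h
  rw [eq_sub_iff_add_eq, add_comm]
  exact_mod_cast h

theorem isAddHaarMeasure_hyperMeasure {b : Vec n} (hb : b ≠ 0) :
    (hyperMeasure b).IsAddHaarMeasure := by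
  unfold hyperMeasure
  rw [← finrank_hyperplane hb]
  infer_instance

theorem one_le_of_ne_zero {b : Vec n} (hb : b ≠ 0) : (0 : ℝ) ≤ (n : ℝ) - 1 := by
  rw [← finrank_hyperplane hb]; positivity

/-- Orthogonal projection is 1-Lipschitz. The nonzero `b` forces `n ≥ 1`, so the exponent `n - 1` is
nonnegative. -/
theorem hyperMeasure_image_le {b : Vec n} (hb : b ≠ 0) (S : Set (Vec n)) :
    hyperMeasure b (hyperProj b '' S) ≤ Measure.hausdorffMeasure ((n : ℝ) - 1) S := by
  have hL : LipschitzWith 1 (hyperProj b) := by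
    refine (hyperProj b).lipschitz.weaken ?_
    exact Submodule.orthogonalProjectionOnto_norm_le _
  simpa using hL.hausdorffMeasure_image_le (one_le_of_ne_zero hb) S

/-- Coordinates along `b` and on the hyperplane orthogonal to `b`. -/
noncomputable def lineEquiv {b : Vec n} (hb : b ≠ 0) : (hyperplane b × ℝ) ≃L[ℝ] Vec n :=
  LinearEquiv.toContinuousLinearEquiv
    { toFun := fun p => (p.1 : Vec n) + p.2 • b
      map_add' := fun p q => by simp [add_smul]; abel
      map_smul' := fun c p => by simp [smul_smul]
      invFun := fun x => (hyperProj b x, inner ℝ b x / ‖b‖ ^ 2)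
      left_inv := fun p => Prod.ext (hyperProj_coe_add p.1 p.2) (inner_coe_add hb p.1 p.2)
      right_inv := fun x => (hyperProj_decomp b x).symm }

@[simp] theorem lineEquiv_apply {b : Vec n} (hb : b ≠ 0) (p : hyperplane b × ℝ) :
    lineEquiv hb p = (p.1 : Vec n) + p.2 • b := rfl

theorem sigmaFinite_hyperMeasure {b : Vec n} (hb : b ≠ 0) : SigmaFinite (hyperMeasure b) := by
  have := isAddHaarMeasure_hyperMeasure hb
  infer_instance

/-- Both sides are Haar measures, since `ℋ^{n-1}` is one on an `(n-1)`-dimensional space. The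
constant is never computed: it serves only in estimates and for null sets. -/
theorem exists_volume_eq_smul_map {b : Vec n} (hb : b ≠ 0) :
    ∃ c : ℝ≥0, c ≠ 0 ∧ (volume : Measure (Vec n)) =
      c • Measure.map (lineEquiv hb) ((hyperMeasure b).prod volume) := by
  have := isAddHaarMeasure_hyperMeasure hb
  have := sigmaFinite_hyperMeasure hb
  have h2 : ((hyperMeasure b).prod (volume : Measure ℝ)).IsAddHaarMeasure := inferInstance
  have h3 := (lineEquiv hb).isAddHaarMeasure_map ((hyperMeasure b).prod volume)
  exact ⟨_, (Measure.addHaarScalarFactor_pos_of_isAddHaarMeasure _ _).ne',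
    Measure.isAddLeftInvariant_eq_smul _ _⟩

theorem measurableEmbedding_lineEquiv {b : Vec n} (hb : b ≠ 0) :
    MeasurableEmbedding (lineEquiv hb) :=
  (lineEquiv hb).toHomeomorph.measurableEmbedding

/-- Integration along the lines parallel to `b`. -/
theorem exists_lintegral_eq_lines {b : Vec n} (hb : b ≠ 0) :
    ∃ c : ℝ≥0, c ≠ 0 ∧ ∀ F : Vec n → ℝ≥0∞, Measurable F →
      ∫⁻ x, F x = c * ∫⁻ y, (∫⁻ s : ℝ, F ((y : Vec n) + s • b)) ∂(hyperMeasure b) := by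
  obtain ⟨c, hc, h⟩ := exists_volume_eq_smul_map hb
  have := sigmaFinite_hyperMeasure hb
  refine ⟨c, hc, fun F hF => ?_⟩
  rw [h, lintegral_smul_measure, (measurableEmbedding_lineEquiv hb).lintegral_map,
    lintegral_prod (fun p => F (lineEquiv hb p))
      (hF.comp (lineEquiv hb).continuous.measurable).aemeasurable]
  rfl

end Hyperplane

/-! ### Boundaries of convex domains as Lipschitz graphs, and the null shadow -/

section ConvexGeometry

open scoped NNReal ENNReal

variable {n : ℕ} {U : Set (Vec n)}

theorem notMem_of_mem_frontier (hU : IsOpen U) {x : Vec n} (hx : x ∈ frontier U) : x ∉ U := by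
  rw [hU.frontier_eq] at hx
  exact hx.2

/-- A point between a point of the closure and a point of an open convex set lies in the set. -/
theorem mem_of_between (hUo : IsOpen U) (hU : Convex ℝ U) {x y z : Vec n} (hx : x ∈ closure U)
    (hz : z ∈ U) {s t : ℝ} (hs : 0 ≤ s) (ht : 0 < t) (h : (s + t) • y = s • x + t • z) :
    y ∈ U := by
  have hst : 0 < s + t := by linarith
  have hy : y = (s / (s + t)) • x + (t / (s + t)) • z := by
    rw [div_eq_inv_mul, div_eq_inv_mul, mul_smul, mul_smul, ← smul_add, ← h, smul_smul,
      inv_mul_cancel₀ hst.ne', one_smul]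
  have := hU.combo_closure_interior_mem_interior hx (by rwa [hUo.interior_eq])
    (a := s / (s + t)) (b := t / (s + t)) (by positivity) (by positivity) (by field_simp)
  rw [hUo.interior_eq] at this
  rwa [hy]

/-- The boundary is a Lipschitz graph over the hyperplane orthogonal to `b`. Write `x' - x = p + t •
b` with `t > 0`. If `‖p‖ < t * r`, then `x - b - t⁻¹ • p` lies in the ball inside `U`, and `x` lies
between it and `x'`, hence in `U`, which is absurd. -/
theorem dist_le_of_chart (hUo : IsOpen U) (hU : Convex ℝ U) {x₀ b : Vec n} {r : ℝ} (hr : 0 < r)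
    (hball : Metric.ball (x₀ - b) (2 * r) ⊆ U) {x x' : Vec n}
    (hx : x ∈ frontier U ∩ Metric.ball x₀ r) (hx' : x' ∈ frontier U ∩ Metric.ball x₀ r) :
    dist x x' ≤ (1 + ‖b‖ / r) * dist (hyperProj b x) (hyperProj b x') := by
  have main : ∀ x x' : Vec n, x ∈ frontier U ∩ Metric.ball x₀ r →
      x' ∈ frontier U ∩ Metric.ball x₀ r → ∀ (p : Vec n) (t : ℝ), x' - x = p + t • b → 0 < t →
      t * r ≤ ‖p‖ := by
    intro x x' hx hx' p t hpt ht
    by_contra! hlt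
    have hz : x - b - t⁻¹ • p ∈ U := by
      apply hball
      rw [Metric.mem_ball, dist_eq_norm]
      have h1 : ‖x - x₀‖ < r := by simpa [dist_eq_norm] using hx.2
      have h2 : ‖t⁻¹ • p‖ < r := by
        rw [norm_smul, norm_inv, Real.norm_of_nonneg ht.le, inv_mul_lt_iff₀ ht]
        exact hlt
      calc ‖x - b - t⁻¹ • p - (x₀ - b)‖ = ‖(x - x₀) - t⁻¹ • p‖ := by congr 1; abel
        _ ≤ ‖x - x₀‖ + ‖t⁻¹ • p‖ := norm_sub_le _ _
        _ < 2 * r := by linarith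
    refine notMem_of_mem_frontier hUo hx.1
      (mem_of_between hUo hU (frontier_subset_closure hx'.1) hz zero_le_one ht ?_)
    have : x' = x + (p + t • b) := by rw [← hpt]; abel
    rw [this, smul_sub, smul_sub, smul_smul, mul_inv_cancel₀ ht.ne']
    module
  set p : Vec n := (hyperProj b (x' - x) : Vec n) with hp
  set t : ℝ := inner ℝ b (x' - x) / ‖b‖ ^ 2
  have hd : x' - x = p + t • b := hyperProj_decomp b (x' - x)
  have hpn : dist (hyperProj b x) (hyperProj b x') = ‖p‖ := by
    rw [dist_comm, dist_eq_norm, ← map_sub]; rfl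
  have ht : |t| * r ≤ ‖p‖ := by
    rcases lt_trichotomy t 0 with h | h | h
    · have := main x' x hx' hx (-p) (-t) (by rw [← neg_sub, hd, neg_smul]; abel) (by linarith)
      rwa [abs_of_neg h, ← norm_neg p]
    · rw [h]; simp
    · rw [abs_of_pos h]
      exact main x x' hx hx' p t hd h
  rw [hpn, dist_comm, dist_eq_norm, hd]
  have h3 : |t| ≤ ‖p‖ / r := by rwa [le_div_iff₀ hr]
  calc ‖p + t • b‖ ≤ ‖p‖ + |t| * ‖b‖ := by
        refine (norm_add_le _ _).trans ?_
        rw [norm_smul, Real.norm_eq_abs]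
    _ ≤ ‖p‖ + ‖p‖ / r * ‖b‖ := by gcongr
    _ = _ := by ring

theorem exists_chart (hUo : IsOpen U) (hU : Convex ℝ U) {x₀ b : Vec n} (hx : x₀ - b ∈ U) :
    ∃ r > 0, ∃ C : ℝ≥0, (∀ x ∈ Metric.ball x₀ r, x - b ∈ U) ∧
      ∀ x ∈ frontier U ∩ Metric.ball x₀ r, ∀ x' ∈ frontier U ∩ Metric.ball x₀ r,
        dist x x' ≤ C * dist (hyperProj b x) (hyperProj b x') := by
  obtain ⟨ε, hε, hball⟩ := Metric.isOpen_iff.1 hUo _ hx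
  have hb2 : Metric.ball (x₀ - b) (2 * (ε / 2)) ⊆ U := by rwa [mul_div_cancel₀ _ two_ne_zero]
  refine ⟨ε / 2, by positivity, ⟨1 + ‖b‖ / (ε / 2), by positivity⟩, ?_, ?_⟩
  · intro x hx
    apply hball
    rw [Metric.mem_ball, dist_sub_right]
    exact (Metric.mem_ball.1 hx).trans (by linarith)
  · intro x hx x' hx'
    exact dist_le_of_chart hUo hU (by positivity) hb2 hx hx'

theorem hausdorffMeasure_le_of_dist_le {X Y : Type*} [MetricSpace X] [MeasurableSpace X]
    [BorelSpace X] [MetricSpace Y] [MeasurableSpace Y] [BorelSpace Y] {f : X → Y} {S : Set X}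
    {C : ℝ≥0} (h : ∀ x ∈ S, ∀ x' ∈ S, dist x x' ≤ C * dist (f x) (f x')) {d : ℝ} (hd : 0 ≤ d) :
    Measure.hausdorffMeasure d S ≤ (C : ℝ≥0∞) ^ d * Measure.hausdorffMeasure d (f '' S) := by
  have hA : AntilipschitzWith C (S.domRestrict f) :=
    AntilipschitzWith.of_le_mul_dist fun x y => h x x.2 y y.2
  have h1 := hA.le_hausdorffMeasure_image hd Set.univ
  rw [Set.image_univ, Set.range_domRestrict, ← isometry_subtype_coe.hausdorffMeasure_image (Or.inl hd),
    Set.image_univ, Subtype.range_coe] at h1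
  exact h1

/-- A compact set meeting every line parallel to `v` at most once is null. -/
theorem addHaar_eq_zero_of_lines {E : Type*} [NormedAddCommGroup E] [NormedSpace ℝ E]
    [MeasurableSpace E] [BorelSpace E] [FiniteDimensional ℝ E] (μ : Measure E)
    [μ.IsAddHaarMeasure] {Z : Set E} (hZ : IsCompact Z) {v : E}
    (h : ∀ x ∈ Z, ∀ t : ℝ, x + t • v ∈ Z → t = 0) : μ Z = 0 := by
  have hinj : ∀ s t : ℝ, s ≠ t → Disjoint ((fun x => s • v + x) '' Z) ((fun x => t • v + x) '' Z) := by
    intro s t hst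
    rw [Set.disjoint_left]
    rintro _ ⟨x, hx, rfl⟩ ⟨y, hy, hxy⟩
    have hxy : t • v + y = s • v + x := hxy
    refine hst (sub_eq_zero.1 (h x hx (s - t) ?_))
    have : x + (s - t) • v = y := by
      rw [sub_smul, ← add_right_inj (t • v), hxy]; abel
    rwa [this]
  -- The translates of `Z` by `v / (k + 1)` are pairwise disjoint, have equal measure and stay in
  -- one compact set, so infinitely many copies of `μ Z` have a finite sum.
  set f : ℕ → ℝ := fun k => 1 / ((k : ℝ) + 1) with hf
  have hfinj : ∀ j k, j ≠ k → f j ≠ f k := by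
    intro j k hjk h
    apply hjk
    simp only [hf, one_div, inv_inj] at h
    exact_mod_cast (add_right_cancel h)
  have hcpt : IsCompact ((fun p : ℝ × E => p.1 • v + p.2) '' (Set.Icc 0 1 ×ˢ Z)) :=
    (isCompact_Icc.prod hZ).image (by fun_prop)
  have hsub : ⋃ k, (fun x => f k • v + x) '' Z ⊆
      (fun p : ℝ × E => p.1 • v + p.2) '' (Set.Icc 0 1 ×ˢ Z) := by
    rw [Set.iUnion_subset_iff]
    rintro k _ ⟨x, hx, rfl⟩
    refine ⟨(f k, x), ⟨⟨by positivity, ?_⟩, hx⟩, rfl⟩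
    rw [hf, div_le_one (by positivity)]
    linarith [(Nat.cast_nonneg k : (0 : ℝ) ≤ k)]
  have hsum : ∑' _ : ℕ, μ Z < ⊤ := by
    calc ∑' _ : ℕ, μ Z = ∑' k : ℕ, μ ((fun x => f k • v + x) '' Z) := by
          congr 1; ext k
          rw [Set.image_add_left, measure_preimage_add]
      _ = μ (⋃ k, (fun x => f k • v + x) '' Z) := by
          rw [measure_iUnion (fun j k hjk => hinj _ _ (hfinj j k hjk))]
          intro k
          exact (hZ.image (by fun_prop)).measurableSet
      _ ≤ _ := measure_mono hsub
      _ < ⊤ := hcpt.measure_lt_top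
  by_contra h0
  exact hsum.ne (ENNReal.tsum_const_eq_top_of_ne_zero h0)

/-- The points of the boundary of `U` at which the line in direction `a` misses `U`. -/
def shadow (U : Set (Vec n)) (a : Vec n) : Set (Vec n) :=
  {x | x ∈ frontier U ∧ ∀ t : ℝ, x + t • a ∉ U}

theorem isClosed_shadow (hU : IsOpen U) (a : Vec n) : IsClosed (shadow U a) := by
  have : shadow U a = frontier U ∩ ⋂ t : ℝ, (fun x => x + t • a) ⁻¹' Uᶜ := by
    ext x; simp [shadow]
  rw [this]
  exact isClosed_frontier.inter
    (isClosed_iInter fun t => hU.isClosed_compl.preimage (by fun_prop))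

theorem isCompact_frontier_of_bounded (h : Bornology.IsBounded U) : IsCompact (frontier U) :=
  (Metric.isCompact_of_isClosed_isBounded isClosed_closure h.closure).of_isClosed_subset
    isClosed_frontier frontier_subset_closure

/-- The midpoint of two distinct points of the closure lies in `U` by strict convexity, and it is on
the line that should miss `U`. Strict convexity enters the proof only here. -/
theorem shadow_eq_of_line (hU : IsStrictlyConvexDomain U) {a : Vec n}
    {x x' : Vec n} (hx : x ∈ shadow U a) (hx' : x' ∈ shadow U a) {s : ℝ}
    (h : x' = x + s • a) : x = x' := by
  by_contra hne
  have hint : interior (closure U) = U := by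
    rw [hU.convex.interior_closure_eq_interior_of_nonempty_interior
      (by rw [hU.isOpen.interior_eq]; exact hU.nonempty), hU.isOpen.interior_eq]
  have h1 := hU.strictConvex_closure (frontier_subset_closure hx.1) (frontier_subset_closure hx'.1)
    hne (a := 1 / 2) (b := 1 / 2) (by norm_num) (by norm_num) (by norm_num)
  rw [hint] at h1
  apply hx.2 (1 / 2 * s)
  convert h1 using 1
  rw [h]
  module

/-- If the displacement has a component `t > 0` along `b`, the segment from `x'` to `x - b` crosses
the line through `x` in direction `a`, at a point of `U`. Exchanging the points excludes `t < 0`,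
and `t = 0` is the case of a single line. -/
theorem shadow_eq_of_plane (hU : IsStrictlyConvexDomain U) {a b : Vec n}
    {x x' : Vec n} (hx : x ∈ shadow U a) (hx' : x' ∈ shadow U a) (hxb : x - b ∈ U)
    (hxb' : x' - b ∈ U) {s t : ℝ} (h : x' = x + s • a + t • b) : x = x' := by
  have main : ∀ x x' : Vec n, x ∈ shadow U a → x' ∈ shadow U a → x - b ∈ U → ∀ s t : ℝ,
      x' = x + s • a + t • b → ¬ 0 < t := by
    intro x x' hx hx' hxb s t h ht
    refine hx.2 ((1 + t)⁻¹ * s) (mem_of_between hU.isOpen hU.convex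
      (frontier_subset_closure hx'.1) hxb zero_le_one ht ?_)
    rw [h, smul_add, smul_smul, ← mul_assoc, mul_inv_cancel₀ (by positivity)]
    module
  rcases lt_trichotomy t 0 with ht | ht | ht
  · exact absurd (neg_pos.2 ht) (main x' x hx' hx hxb' (-s) (-t) (by rw [h]; module))
  · exact shadow_eq_of_line hU hx hx' (s := s) (by rw [h, ht]; simp)
  · exact absurd ht (main x x' hx hx' hxb s t h)

/-- Project the shadow locally along `b`. Its image meets each line parallel to the projection of
`a` at most once, so it is null; the inverse of the projection is Lipschitz on the boundary, so the
shadow is null too. -/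
theorem hausdorffMeasure_shadow (hU : IsStrictlyConvexDomain U) {a : Vec n} (ha : a ≠ 0) :
    Measure.hausdorffMeasure ((n : ℝ) - 1) (shadow U a) = 0 := by
  have hcpt : IsCompact (shadow U a) :=
    (isCompact_frontier_of_bounded hU.bounded).of_isClosed_subset (isClosed_shadow hU.isOpen a)
      fun x hx => hx.1
  obtain ⟨z, hz⟩ := hU.nonempty
  refine hcpt.measure_zero_of_nhdsWithin fun x hx => ?_
  set b := x - z with hb
  obtain ⟨r, hr, C, hmem, hC⟩ := exists_chart hU.isOpen hU.convex (x₀ := x) (b := b)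
    (by rw [hb, sub_sub_cancel]; exact hz)
  have hb0 : b ≠ 0 := by
    rw [hb, sub_ne_zero]
    rintro rfl
    exact notMem_of_mem_frontier hU.isOpen hx.1 hz
  -- Otherwise `a` is parallel to `b = x - z`, and the line through `x` in direction `a` reaches `z
  -- ∈ U`.
  have hab : hyperProj b a ≠ 0 := by
    intro h0
    have h1 := hyperProj_decomp b a
    rw [h0, ZeroMemClass.coe_zero, zero_add] at h1
    set c := inner ℝ b a / ‖b‖ ^ 2
    have hc : c ≠ 0 := by
      intro hc
      rw [hc, zero_smul] at h1
      exact ha h1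
    apply hx.2 (-c⁻¹)
    have : x + -c⁻¹ • a = z := by
      rw [h1, smul_smul, neg_mul, inv_mul_cancel₀ hc, hb]; module
    rwa [this]
  set W := shadow U a ∩ Metric.closedBall x (r / 2) with hW
  have hWr : W ⊆ Metric.ball x r := fun y hy =>
    Metric.closedBall_subset_ball (by linarith) hy.2
  refine ⟨W, inter_mem_nhdsWithin _ (Metric.closedBall_mem_nhds x (by positivity)), ?_⟩
  have hWc : IsCompact W := hcpt.inter_right Metric.isClosed_closedBall
  have h1 := hausdorffMeasure_le_of_dist_le (f := hyperProj b) (S := W) (C := C)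
    (fun y hy y' hy' => hC y ⟨hy.1.1, hWr hy⟩ y' ⟨hy'.1.1, hWr hy'⟩) (one_le_of_ne_zero ha)
  have := isAddHaarMeasure_hyperMeasure hb0
  have h2 : hyperMeasure b (hyperProj b '' W) = 0 := by
    refine addHaar_eq_zero_of_lines (hyperMeasure b) (hWc.image (hyperProj b).continuous) (v := hyperProj b a) ?_
    rintro _ ⟨y, hy, rfl⟩ t ⟨y', hy', hyy'⟩
    have h3 : y' - (y + t • a) = (inner ℝ b (y' - (y + t • a)) / ‖b‖ ^ 2) • b := by
      conv_lhs => rw [hyperProj_decomp b (y' - (y + t • a))]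
      rw [map_sub, map_add, map_smul, hyy', sub_self]
      simp
    have h4 := shadow_eq_of_plane hU hy.1 hy'.1 (hmem _ (hWr hy)) (hmem _ (hWr hy'))
      (s := t) (eq_add_of_sub_eq' h3)
    rw [← h4] at hyy'
    have h5 : t • hyperProj b a = 0 := by simpa using hyy'
    exact (smul_eq_zero.1 h5).resolve_right hab
  rw [h2, mul_zero] at h1
  exact le_antisymm h1 zero_le

end ConvexGeometry

/-! ### The trace estimate off the shadow -/

section TraceEstimate

open scoped NNReal ENNReal

variable {n : ℕ} {U : Set (Vec n)}

theorem eLpNorm_two_sq {α F : Type*} [MeasurableSpace α] [NormedAddCommGroup F] (f : α → F)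
    (μ : Measure α) : eLpNorm f 2 μ ^ 2 = ∫⁻ x, ‖f x‖ₑ ^ 2 ∂μ := by
  have h := eLpNorm_nnreal_pow_eq_lintegral (f := f) (μ := μ) (p := 2) two_ne_zero
  simpa only [NNReal.coe_ofNat, ENNReal.rpow_two, ENNReal.coe_ofNat] using h

theorem ofReal_sq_eq_enorm (x : ℝ) : ENNReal.ofReal (x ^ 2) = ‖x‖ₑ ^ 2 := by
  rw [Real.enorm_eq_ofReal_abs, ← ENNReal.ofReal_pow (abs_nonneg x), sq_abs]

/-- Integrate the derivative of `(s - 1) * q s ^ 2`: the weight kills the boundary term at `s = 1`.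
Young's inequality with `|s - 1| ≤ 1` handles the mixed term. -/
theorem sq_le_integral_of_hasDerivAt {q q' : ℝ → ℝ} (hq : ∀ s, HasDerivAt q (q' s) s)
    (hq' : Continuous q') : q 0 ^ 2 ≤ ∫ s in (0 : ℝ)..1, (2 * q s ^ 2 + q' s ^ 2) := by
  have hqc : Continuous q := continuous_iff_continuousAt.2 fun s => (hq s).continuousAt
  have hd : ∀ s, HasDerivAt (fun s => (s - 1) * q s ^ 2)
      (q s ^ 2 + (s - 1) * (2 * q s * q' s)) s := by
    intro s
    have h1 := ((hasDerivAt_id s).sub_const 1).mul ((hq s).pow 2)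
    refine h1.congr_deriv ?_
    simp
  have hc : Continuous fun s => q s ^ 2 + (s - 1) * (2 * q s * q' s) := by fun_prop
  have h2 := intervalIntegral.integral_eq_sub_of_hasDerivAt (a := 0) (b := 1)
    (fun s _ => hd s) (hc.intervalIntegrable _ _)
  have h3 : q 0 ^ 2 = ∫ s in (0 : ℝ)..1, (q s ^ 2 + (s - 1) * (2 * q s * q' s)) := by
    rw [h2]; ring
  rw [h3]
  refine intervalIntegral.integral_mono_on zero_le_one (hc.intervalIntegrable _ _)
    (Continuous.intervalIntegrable (by fun_prop) _ _) fun s hs => ?_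
  have e1 : 0 ≤ 1 - s := by linarith [hs.2]
  have e2 : 1 - s ≤ 1 := by linarith [hs.1]
  nlinarith [sq_nonneg (q s + q' s), sq_nonneg (q s - q' s), sq_nonneg (q s), sq_nonneg (q' s),
    mul_nonneg e1 (sq_nonneg (q s + q' s)), mul_nonneg (sub_nonneg.2 e2)
      (add_nonneg (sq_nonneg (q s)) (sq_nonneg (q' s)))]

theorem hasDerivAt_line {h : Vec n → ℝ} (hh : ContDiff ℝ 1 h) (x b : Vec n) (s : ℝ) :
    HasDerivAt (fun s : ℝ => h (x + s • b)) (fderiv ℝ h (x + s • b) b) s := by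
  have h1 : HasDerivAt (fun s : ℝ => x + s • b) b s := by
    simpa using ((hasDerivAt_id s).smul_const b).const_add x
  exact ((hh.differentiable one_ne_zero).differentiableAt.hasFDerivAt).comp_hasDerivAt s h1

theorem continuous_fderiv_apply {h : Vec n → ℝ} (hh : ContDiff ℝ 1 h) (b : Vec n) :
    Continuous fun x => fderiv ℝ h x b :=
  (hh.continuous_fderiv one_ne_zero).clm_apply continuous_const

theorem measurable_lines {b : Vec n} {F : Vec n → ℝ≥0∞} (hF : Measurable F) :
    Measurable fun y : hyperplane b => ∫⁻ s : ℝ, F ((y : Vec n) + s • b) := by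
  refine Measurable.lintegral_prod_right' (f := fun p : hyperplane b × ℝ =>
    F ((p.1 : Vec n) + p.2 • b)) (hF.comp ?_)
  exact Continuous.measurable (by fun_prop)

/-- The one-dimensional estimate on the segment from `x` to `x - b`. Extending the integral to the
part of the whole line in `U` makes the bound a function of the projection of `x` alone, ready for
Fubini. -/
theorem enorm_sq_le_lines {h : Vec n → ℝ} (hh : ContDiff ℝ 1 h) {x b : Vec n}
    (hx : ∀ s : ℝ, 0 < s → s ≤ 1 → x - s • b ∈ U) :
    ‖h x‖ₑ ^ 2 ≤ ∫⁻ s : ℝ, U.indicator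
      (fun z => ENNReal.ofReal (2 * h z ^ 2 + fderiv ℝ h z b ^ 2))
        ((hyperProj b x : Vec n) + s • b) := by
  set F : Vec n → ℝ := fun z => 2 * h z ^ 2 + fderiv ℝ h z b ^ 2 with hF
  have hFc : Continuous F := by
    have := continuous_fderiv_apply hh b
    have := hh.continuous
    fun_prop
  have hF0 : ∀ z, 0 ≤ F z := fun z => by positivity
  have h1 : h x ^ 2 ≤ ∫ s in (0 : ℝ)..1, F (x + s • -b) := by
    have := sq_le_integral_of_hasDerivAt (hasDerivAt_line hh x (-b))
      ((continuous_fderiv_apply hh (-b)).comp (by fun_prop : Continuous fun s : ℝ => x + s • -b))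
    simpa [hF] using this
  rw [← ofReal_sq_eq_enorm]
  calc ENNReal.ofReal (h x ^ 2) ≤ ENNReal.ofReal (∫ s in (0 : ℝ)..1, F (x + s • -b)) :=
        ENNReal.ofReal_le_ofReal h1
    _ = ∫⁻ s in Set.Ioc (0 : ℝ) 1, ENNReal.ofReal (F (x + s • -b)) := by
        have hc : Continuous fun s : ℝ => F (x + s • -b) := hFc.comp (by fun_prop)
        rw [intervalIntegral.integral_of_le zero_le_one,
          ofReal_integral_eq_lintegral_ofReal
            ((intervalIntegrable_iff_integrableOn_Ioc_of_le zero_le_one).1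
              (hc.intervalIntegrable 0 1)) (Eventually.of_forall fun s => hF0 _)]
    _ ≤ ∫⁻ s : ℝ, U.indicator (fun z => ENNReal.ofReal (F z)) (x + s • -b) := by
        rw [← lintegral_indicator measurableSet_Ioc]
        refine lintegral_mono fun s => ?_
        by_cases hs : s ∈ Set.Ioc (0 : ℝ) 1
        · rw [Set.indicator_of_mem hs, Set.indicator_of_mem]
          rw [smul_neg, ← sub_eq_add_neg]
          exact hx s hs.1 hs.2
        · rw [Set.indicator_of_notMem hs]; exact zero_le
    _ = _ := by
        rw [← lintegral_sub_left_eq_self (fun s : ℝ => U.indicator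
          (fun z => ENNReal.ofReal (F z)) ((hyperProj b x : Vec n) + s • b))
            (inner ℝ b x / ‖b‖ ^ 2)]
        refine lintegral_congr fun s => ?_
        congr 1
        conv_lhs => rw [hyperProj_decomp b x]
        module

theorem exists_trace_estimate_local (hUo : IsOpen U) (hU : Convex ℝ U) {x₀ b : Vec n}
    (hb : b ≠ 0) (hx : x₀ - b ∈ U) :
    ∃ r > 0, ∃ C : ℝ≥0, ∀ h : Vec n → ℝ, ContDiff ℝ 1 h →
      ∫⁻ x in frontier U ∩ Metric.ball x₀ r, ‖h x‖ₑ ^ 2 ∂(Measure.hausdorffMeasure ((n : ℝ) - 1))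
        ≤ C * ∫⁻ x in U, ENNReal.ofReal (2 * h x ^ 2 + fderiv ℝ h x b ^ 2) := by
  obtain ⟨r, hr, C, hmem, hC⟩ := exists_chart hUo hU hx
  obtain ⟨c, hc, hlines⟩ := exists_lintegral_eq_lines hb
  have hn := one_le_of_ne_zero hb
  set W := frontier U ∩ Metric.ball x₀ r with hW
  set H : Measure (Vec n) := Measure.hausdorffMeasure ((n : ℝ) - 1) with hH
  have hWm : MeasurableSet W := isClosed_frontier.measurableSet.inter Metric.isOpen_ball.measurableSet
  set D : ℝ≥0∞ := (C : ℝ≥0∞) ^ ((n : ℝ) - 1) with hD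
  have hDtop : D ≠ ⊤ := ENNReal.rpow_ne_top_of_nonneg hn ENNReal.coe_ne_top
  -- The graph property bounds `ℋ^{n-1}` on the boundary piece by its shadow on the hyperplane, with
  -- the power `n - 1` of the Lipschitz constant.
  have hmeas : Measure.map (hyperProj b) (H.restrict W) ≤ D • hyperMeasure b := by
    refine Measure.le_iff.2 fun S hS => ?_
    have hP : Measurable (hyperProj b) := (hyperProj b).continuous.measurable
    rw [Measure.map_apply hP hS, Measure.restrict_apply (hP hS), Measure.smul_apply, smul_eq_mul]
    refine (hausdorffMeasure_le_of_dist_le (f := hyperProj b) (C := C)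
      (fun y hy y' hy' => hC y hy.2 y' hy'.2) hn).trans ?_
    refine mul_le_mul_right (measure_mono ?_) _
    rintro _ ⟨y, hy, rfl⟩
    exact hy.1
  -- `c⁻¹` cancels the constant of the Fubini formula.
  refine ⟨r, hr, D.toNNReal * c⁻¹, fun h hh => ?_⟩
  set F : Vec n → ℝ≥0∞ := U.indicator
      (fun z => ENNReal.ofReal (2 * h z ^ 2 + fderiv ℝ h z b ^ 2)) with hF
  have hFm : Measurable F := by
    refine Measurable.indicator ?_ hUo.measurableSet
    have := (continuous_fderiv_apply hh b).measurable
    have := hh.continuous.measurable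
    fun_prop
  calc ∫⁻ x in W, ‖h x‖ₑ ^ 2 ∂H
      ≤ ∫⁻ x in W, (∫⁻ s : ℝ, F ((hyperProj b x : Vec n) + s • b)) ∂H := by
        refine setLIntegral_mono' hWm fun x hxW => enorm_sq_le_lines hh fun s hs hs1 => ?_
        refine mem_of_between hUo hU (frontier_subset_closure hxW.1) (hmem x hxW.2)
          (s := 1 - s) (t := s) (by linarith) hs ?_
        module
    _ = ∫⁻ y, (∫⁻ s : ℝ, F ((y : Vec n) + s • b))
          ∂(Measure.map (hyperProj b) (H.restrict W)) := by
        rw [lintegral_map (measurable_lines hFm) (hyperProj b).continuous.measurable]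
    _ ≤ ∫⁻ y, (∫⁻ s : ℝ, F ((y : Vec n) + s • b)) ∂(D • hyperMeasure b) :=
        lintegral_mono' hmeas le_rfl
    _ = D * ∫⁻ y, (∫⁻ s : ℝ, F ((y : Vec n) + s • b)) ∂(hyperMeasure b) := by
        rw [lintegral_smul_measure, smul_eq_mul]
    _ = _ := by
        rw [← lintegral_indicator hUo.measurableSet, hlines F hFm, ENNReal.coe_mul,
          ENNReal.coe_toNNReal hDtop, ENNReal.coe_inv hc, mul_assoc, ← mul_assoc _ (c : ℝ≥0∞),
          ENNReal.inv_mul_cancel (by exact_mod_cast hc) ENNReal.coe_ne_top, one_mul]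

/-- At a point off the shadow some `x + t • a` lies in `U`, so the local estimate applies with `b =
-(t • a)`, for which `D_b` is a multiple of `D_a`. Compactness of `Γ` makes finitely many local
estimates enough. -/
theorem exists_lintegral_trace_estimate (hUo : IsOpen U) (hU : Convex ℝ U) (a : Vec n)
    {Γ : Set (Vec n)} (hΓ : IsCompact Γ) (hsub : Γ ⊆ frontier U \ shadow U a) :
    ∃ C : ℝ≥0, ∀ h : Vec n → ℝ, ContDiff ℝ 1 h →
      ∫⁻ x in Γ, ‖h x‖ₑ ^ 2 ∂(Measure.hausdorffMeasure ((n : ℝ) - 1))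
        ≤ C * ∫⁻ x in U, (‖h x‖ₑ ^ 2 + ‖fderiv ℝ h x a‖ₑ ^ 2) := by
  refine hΓ.induction_on (p := fun S => ∃ C : ℝ≥0, ∀ h : Vec n → ℝ, ContDiff ℝ 1 h →
      ∫⁻ x in S, ‖h x‖ₑ ^ 2 ∂(Measure.hausdorffMeasure ((n : ℝ) - 1))
        ≤ C * ∫⁻ x in U, (‖h x‖ₑ ^ 2 + ‖fderiv ℝ h x a‖ₑ ^ 2)) ⟨0, by simp⟩ ?_ ?_ ?_
  · rintro s t hst ⟨C, hC⟩
    exact ⟨C, fun h hh => (lintegral_mono_set hst).trans (hC h hh)⟩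
  · rintro s t ⟨C, hC⟩ ⟨C', hC'⟩
    refine ⟨C + C', fun h hh => (lintegral_union_le _ _ _).trans ?_⟩
    rw [ENNReal.coe_add, add_mul]
    exact add_le_add (hC h hh) (hC' h hh)
  · intro x hx
    obtain ⟨hxf, hxs⟩ := hsub hx
    obtain ⟨t, ht⟩ : ∃ t : ℝ, x + t • a ∈ U := by
      by_contra! hcon
      exact hxs ⟨hxf, hcon⟩
    have hb : -(t • a) ≠ 0 := by
      intro h0
      rw [neg_eq_zero.1 h0, add_zero] at ht
      exact notMem_of_mem_frontier hUo hxf ht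
    obtain ⟨r, hr, C, hC⟩ := exists_trace_estimate_local hUo hU (x₀ := x) hb (by simpa using ht)
    -- `2 + t ^ 2` dominates both coefficients, `2` of `h ^ 2` and `t ^ 2` of `(D_a h) ^ 2`.
    refine ⟨frontier U ∩ Metric.ball x r, ?_, C * (2 + Real.toNNReal (t ^ 2)), fun h hh => ?_⟩
    · exact Filter.inter_mem (Filter.mem_of_superset self_mem_nhdsWithin fun y hy => (hsub hy).1)
        (mem_nhdsWithin_of_mem_nhds (Metric.ball_mem_nhds x hr))
    · refine (hC h hh).trans ?_
      rw [ENNReal.coe_mul, mul_assoc]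
      refine mul_le_mul_right ?_ _
      rw [← lintegral_const_mul' _ _ ENNReal.coe_ne_top]
      refine lintegral_mono fun z => ?_
      rw [map_neg, map_smul, neg_sq, smul_eq_mul, mul_pow, ← ofReal_sq_eq_enorm,
        ← ofReal_sq_eq_enorm, ← ENNReal.ofReal_add (by positivity) (by positivity)]
      have e : ((2 + Real.toNNReal (t ^ 2) : ℝ≥0) : ℝ≥0∞) = ENNReal.ofReal (2 + t ^ 2) := by
        rw [ENNReal.ofReal_add (by norm_num) (by positivity)]
        simp [ENNReal.ofReal]
      rw [e, ← ENNReal.ofReal_mul (by positivity)]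
      refine ENNReal.ofReal_le_ofReal ?_
      nlinarith [sq_nonneg (h z), sq_nonneg (fderiv ℝ h z a), sq_nonneg (t * h z)]

/-- The trace estimate off the shadow of the direction `a`. -/
theorem exists_trace_estimate (hUo : IsOpen U) (hU : Convex ℝ U) (a : Vec n)
    {Γ : Set (Vec n)} (hΓ : IsCompact Γ) (hsub : Γ ⊆ frontier U \ shadow U a) :
    ∃ C : ℝ≥0, ∀ h : Vec n → ℝ, ContDiff ℝ 1 h →
      eLpNorm h 2 (surfaceMeasure Γ) ≤ C * (eLpNorm h 2 (volume.restrict U) +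
        eLpNorm (fun x => fderiv ℝ h x a) 2 (volume.restrict U)) := by
  obtain ⟨C, hC⟩ := exists_lintegral_trace_estimate hUo hU a hΓ hsub
  refine ⟨NNReal.sqrt C, fun h hh => ?_⟩
  rw [← ENNReal.pow_le_pow_left_iff two_ne_zero, eLpNorm_two_sq, surfaceMeasure]
  refine (hC h hh).trans ?_
  rw [lintegral_add_left (by have := hh.continuous.measurable; fun_prop), ← eLpNorm_two_sq,
    ← eLpNorm_two_sq, mul_pow]
  have : ((NNReal.sqrt C : ℝ≥0) : ℝ≥0∞) ^ 2 = C := by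
    rw [← ENNReal.coe_pow, NNReal.sq_sqrt]
  rw [this]
  refine mul_le_mul_right ?_ _
  rw [add_sq]
  exact add_le_add_left (le_add_right le_rfl) _

end TraceEstimate

/-! ### Passing to the limit in `L²` pairings -/

section L2Convergence

open scoped NNReal ENNReal

variable {α F : Type*} [MeasurableSpace α] {μ : Measure α} [NormedAddCommGroup F]
  [InnerProductSpace ℝ F]

theorem integral_inner_eq_inner_toLp {f g : α → F} (hf : MemLp f 2 μ) (hg : MemLp g 2 μ) :
    ∫ x, inner ℝ (f x) (g x) ∂μ = inner ℝ (hf.toLp f) (hg.toLp g) := by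
  rw [L2.inner_def]
  refine integral_congr_ae ?_
  filter_upwards [hf.coeFn_toLp, hg.coeFn_toLp] with x h1 h2
  rw [h1, h2]

theorem integrable_inner {f g : α → F} (hf : MemLp f 2 μ) (hg : MemLp g 2 μ) :
    Integrable (fun x => inner ℝ (f x) (g x)) μ := by
  refine (L2.integrable_inner (𝕜 := ℝ) (hf.toLp f) (hg.toLp g)).congr ?_
  filter_upwards [hf.coeFn_toLp, hg.coeFn_toLp] with x h1 h2
  rw [h1, h2]

theorem tendsto_toLp {α F : Type*} [MeasurableSpace α] {μ : Measure α} [NormedAddCommGroup F]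
    {ι : Type*} {l : Filter ι} {f : ι → α → F} {f₀ : α → F}
    (hf : ∀ k, MemLp (f k) 2 μ) (hf₀ : MemLp f₀ 2 μ)
    (h : Tendsto (fun k => eLpNorm (fun x => f k x - f₀ x) 2 μ) l (𝓝 0)) :
    Tendsto (fun k => (hf k).toLp (f k)) l (𝓝 (hf₀.toLp f₀)) :=
  (Lp.tendsto_Lp_iff_tendsto_eLpNorm'' f hf f₀ hf₀).2 h

theorem tendsto_integral_inner {ι : Type*} {l : Filter ι} {f : ι → α → F} {f₀ g : α → F}
    (hf : ∀ k, MemLp (f k) 2 μ) (hf₀ : MemLp f₀ 2 μ) (hg : MemLp g 2 μ)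
    (h : Tendsto (fun k => eLpNorm (fun x => f k x - f₀ x) 2 μ) l (𝓝 0)) :
    Tendsto (fun k => ∫ x, inner ℝ (f k x) (g x) ∂μ) l (𝓝 (∫ x, inner ℝ (f₀ x) (g x) ∂μ)) := by
  simp only [integral_inner_eq_inner_toLp (hf _) hg, integral_inner_eq_inner_toLp hf₀ hg]
  exact (tendsto_toLp hf hf₀ h).inner tendsto_const_nhds

theorem tendsto_integral_mul {ι : Type*} {l : Filter ι} {f : ι → α → ℝ} {f₀ g : α → ℝ}
    (hf : ∀ k, MemLp (f k) 2 μ) (hf₀ : MemLp f₀ 2 μ) (hg : MemLp g 2 μ)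
    (h : Tendsto (fun k => eLpNorm (fun x => f k x - f₀ x) 2 μ) l (𝓝 0)) :
    Tendsto (fun k => ∫ x, f k x * g x ∂μ) l (𝓝 (∫ x, f₀ x * g x ∂μ)) := by
  simpa [mul_comm] using tendsto_integral_inner hf hf₀ hg h

theorem integrable_mul_of_memLp_two {f g : α → ℝ} (hf : MemLp f 2 μ) (hg : MemLp g 2 μ) :
    Integrable (fun x => f x * g x) μ := by
  simpa [mul_comm] using integrable_inner hf hg

/-- Continuous functions are square integrable on bounded sets. -/
theorem memLp_of_continuous {n : ℕ} {G : Type*} [NormedAddCommGroup G] {U : Set (Vec n)}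
    (hU : Bornology.IsBounded U) {f : Vec n → G} (hf : Continuous f) [SecondCountableTopology G] :
    MemLp f 2 (volume.restrict U) := by
  obtain ⟨C, hC⟩ := (Metric.isCompact_of_isClosed_isBounded isClosed_closure
    hU.closure).exists_bound_of_continuousOn hf.continuousOn
  have : IsFiniteMeasure (volume.restrict U) :=
    ⟨by rw [Measure.restrict_apply_univ]; exact hU.measure_lt_top⟩
  have h1 : MemLp f 2 (volume.restrict (closure U)) := by
    have : IsFiniteMeasure (volume.restrict (closure U)) :=
      ⟨by rw [Measure.restrict_apply_univ]; exact hU.closure.measure_lt_top⟩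
    refine MemLp.of_bound hf.aestronglyMeasurable C ?_
    exact (ae_restrict_iff' isClosed_closure.measurableSet).2 (Eventually.of_forall hC)
  exact h1.mono_measure (Measure.restrict_mono subset_closure le_rfl)

end L2Convergence

/-! ### Vanishing traces and extension by zero -/

section ZeroTrace

open scoped NNReal ENNReal

variable {n : ℕ} {Ω : Set (Vec n)} {b : Vec n}

/-- The parameters at which the line through `y` in direction `b` meets `Ω`. -/
def lineSet (Ω : Set (Vec n)) (b : Vec n) (y : hyperplane b) : Set ℝ :=
  {s | (y : Vec n) + s • b ∈ Ω}

theorem isOpen_lineSet (hΩ : IsOpen Ω) (y : hyperplane b) : IsOpen (lineSet Ω b y) :=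
  hΩ.preimage (f := fun s : ℝ => (y : Vec n) + s • b) (by fun_prop)

theorem convex_lineSet (hΩ : Convex ℝ Ω) (y : hyperplane b) :
    Convex ℝ (lineSet Ω b y) := by
  intro s hs t ht p q hp hq hpq
  have h := hΩ hs ht hp hq hpq
  have e : p • ((y : Vec n) + s • b) + q • ((y : Vec n) + t • b) =
      (y : Vec n) + (p • s + q • t) • b := by
    have : (y : Vec n) = (p + q) • (y : Vec n) := by rw [hpq, one_smul]
    rw [smul_eq_mul, smul_eq_mul]
    nth_rw 3 [this]
    module
  rw [e] at h
  exact h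

theorem isBounded_lineSet (hb : b ≠ 0) (hΩ : Bornology.IsBounded Ω) (y : hyperplane b) :
    Bornology.IsBounded (lineSet Ω b y) := by
  have h : lineSet Ω b y ⊆ (fun x => inner ℝ b x / ‖b‖ ^ 2) '' closure Ω := by
    intro s hs
    exact ⟨_, subset_closure hs, inner_coe_add hb y s⟩
  refine (IsCompact.isBounded ?_).subset h
  exact (Metric.isCompact_of_isClosed_isBounded isClosed_closure hΩ.closure).image (by fun_prop)

theorem lineSet_nonempty {y : hyperplane b} (hy : y ∈ hyperProj b '' Ω) :
    (lineSet Ω b y).Nonempty := by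
  obtain ⟨x, hx, rfl⟩ := hy
  refine ⟨inner ℝ b x / ‖b‖ ^ 2, ?_⟩
  change _ ∈ Ω
  rwa [← hyperProj_decomp]

theorem lineSet_eq_Ioo (hb : b ≠ 0) (hΩ : IsStrictlyConvexDomain Ω) {y : hyperplane b}
    (hy : y ∈ hyperProj b '' Ω) :
    lineSet Ω b y = Set.Ioo (sInf (lineSet Ω b y)) (sSup (lineSet Ω b y)) := by
  have hbd := isBounded_lineSet hb hΩ.bounded y
  have hopen := isOpen_lineSet hΩ.isOpen y
  refine Set.Subset.antisymm (fun s hs => ?_) ?_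
  · obtain ⟨ε, hε, hball⟩ := Metric.isOpen_iff.1 hopen s hs
    have h1 : s - ε / 2 ∈ lineSet Ω b y := hball (by
      rw [Metric.mem_ball, Real.dist_eq, abs_lt]; constructor <;> linarith)
    have h2 : s + ε / 2 ∈ lineSet Ω b y := hball (by
      rw [Metric.mem_ball, Real.dist_eq, abs_lt]; constructor <;> linarith)
    exact ⟨(csInf_le hbd.bddBelow h1).trans_lt (by linarith),
      lt_of_lt_of_le (by linarith) (le_csSup hbd.bddAbove h2)⟩
  · exact IsConnected.Ioo_csInf_csSup_subset
      ⟨lineSet_nonempty hy, (convex_lineSet hΩ.convex y).isPreconnected⟩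
      hbd.bddBelow hbd.bddAbove

theorem mem_frontier_of_mem_closure_lineSet (hΩ : IsOpen Ω) {y : hyperplane b} {s : ℝ}
    (h1 : s ∈ closure (lineSet Ω b y)) (h2 : s ∉ lineSet Ω b y) :
    (y : Vec n) + s • b ∈ frontier Ω := by
  rw [hΩ.frontier_eq]
  refine ⟨?_, h2⟩
  have hc : Continuous fun s : ℝ => (y : Vec n) + s • b := by fun_prop
  exact hc.closure_preimage_subset Ω h1

open Classical in
/-- The upper end of the line through `y` inside `Ω`. -/
noncomputable def upperEnd (Ω : Set (Vec n)) (b : Vec n) (y : hyperplane b) : ℝ :=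
  if y ∈ hyperProj b '' Ω then sSup (lineSet Ω b y) else 0

open Classical in
/-- The lower end of the line through `y` inside `Ω`. -/
noncomputable def lowerEnd (Ω : Set (Vec n)) (b : Vec n) (y : hyperplane b) : ℝ :=
  if y ∈ hyperProj b '' Ω then sInf (lineSet Ω b y) else 0

theorem isOpen_hyperProj_image {O : Set (Vec n)} (hO : IsOpen O) : IsOpen (hyperProj b '' O) := by
  refine (ContinuousLinearMap.isOpenMap (hyperProj b) fun y => ⟨y, ?_⟩) O hO
  exact Submodule.orthogonalProjectionOnto_mem_subspace_eq_self y

theorem exists_mem_lineSet_iff (hb : b ≠ 0) (y : hyperplane b) (p : ℝ → Prop) :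
    (∃ s ∈ lineSet Ω b y, p s) ↔
      y ∈ hyperProj b '' (Ω ∩ {x | p (inner ℝ b x / ‖b‖ ^ 2)}) := by
  constructor
  · rintro ⟨s, hs, hp⟩
    refine ⟨_, ⟨hs, ?_⟩, hyperProj_coe_add y s⟩
    change p _
    rwa [inner_coe_add hb]
  · rintro ⟨x, ⟨hx, hp⟩, rfl⟩
    refine ⟨_, ?_, hp⟩
    change _ ∈ Ω
    rwa [← hyperProj_decomp]

theorem measurable_upperEnd (hb : b ≠ 0) (hΩ : IsStrictlyConvexDomain Ω) :
    Measurable (upperEnd Ω b) := by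
  refine measurable_of_Ioi fun c => ?_
  -- The line through `y` goes above level `c` inside `Ω` exactly when `y` is in the projection of
  -- an open set. The second term accounts for the default value `0` off the projection of `Ω`.
  have h : upperEnd Ω b ⁻¹' Set.Ioi c = hyperProj b '' (Ω ∩ {x | c < inner ℝ b x / ‖b‖ ^ 2}) ∪
      ((hyperProj b '' Ω)ᶜ ∩ {_y | c < 0}) := by
    ext y
    rw [Set.mem_union, ← exists_mem_lineSet_iff hb y (fun s => c < s)]
    by_cases hy : y ∈ hyperProj b '' Ω
    · rw [Set.mem_preimage, upperEnd, if_pos hy]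
      simp only [Set.mem_Ioi, Set.mem_inter_iff,
        Set.mem_compl_iff, not_true, false_and, or_false, hy]
      exact lt_csSup_iff (isBounded_lineSet hb hΩ.bounded y).bddAbove (lineSet_nonempty hy)
    · have hne : ¬ ∃ s ∈ lineSet Ω b y, c < s := by
        rintro ⟨s, hs, -⟩
        exact hy ⟨_, hs, hyperProj_coe_add y s⟩
      rw [Set.mem_preimage, upperEnd, if_neg hy]
      simp only [Set.mem_Ioi, Set.mem_inter_iff,
        Set.mem_compl_iff, hy, not_false_eq_true, true_and, hne, false_or, Set.mem_ofPred_eq]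
  rw [h]
  refine (isOpen_hyperProj_image (hΩ.isOpen.inter ?_)).measurableSet.union
    ((isOpen_hyperProj_image hΩ.isOpen).measurableSet.compl.inter (MeasurableSet.const _))
  exact isOpen_lt continuous_const (by fun_prop)

theorem measurable_lowerEnd (hb : b ≠ 0) (hΩ : IsStrictlyConvexDomain Ω) :
    Measurable (lowerEnd Ω b) := by
  refine measurable_of_Iio fun c => ?_
  have h : lowerEnd Ω b ⁻¹' Set.Iio c = hyperProj b '' (Ω ∩ {x | inner ℝ b x / ‖b‖ ^ 2 < c}) ∪
      ((hyperProj b '' Ω)ᶜ ∩ {_y | 0 < c}) := by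
    ext y
    rw [Set.mem_union, ← exists_mem_lineSet_iff hb y (fun s => s < c)]
    by_cases hy : y ∈ hyperProj b '' Ω
    · rw [Set.mem_preimage, lowerEnd, if_pos hy]
      simp only [Set.mem_Iio, Set.mem_inter_iff,
        Set.mem_compl_iff, not_true, false_and, or_false, hy]
      exact csInf_lt_iff (isBounded_lineSet hb hΩ.bounded y).bddBelow (lineSet_nonempty hy)
    · have hne : ¬ ∃ s ∈ lineSet Ω b y, s < c := by
        rintro ⟨s, hs, -⟩
        exact hy ⟨_, hs, hyperProj_coe_add y s⟩
      rw [Set.mem_preimage, lowerEnd, if_neg hy]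
      simp only [Set.mem_Iio, Set.mem_inter_iff,
        Set.mem_compl_iff, hy, not_false_eq_true, true_and, hne, false_or, Set.mem_ofPred_eq]
  rw [h]
  refine (isOpen_hyperProj_image (hΩ.isOpen.inter ?_)).measurableSet.union
    ((isOpen_hyperProj_image hΩ.isOpen).measurableSet.compl.inter (MeasurableSet.const _))
  exact isOpen_lt (by fun_prop) continuous_const

theorem upperEnd_mem_frontier (hb : b ≠ 0) (hΩ : IsStrictlyConvexDomain Ω) {y : hyperplane b}
    (hy : y ∈ hyperProj b '' Ω) : (y : Vec n) + upperEnd Ω b y • b ∈ frontier Ω := by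
  rw [upperEnd, if_pos hy]
  refine mem_frontier_of_mem_closure_lineSet hΩ.isOpen
    (csSup_mem_closure (lineSet_nonempty hy) (isBounded_lineSet hb hΩ.bounded y).bddAbove) ?_
  intro h
  have h' := (Set.ext_iff.1 (lineSet_eq_Ioo hb hΩ hy) _).1 h
  exact lt_irrefl _ h'.2

theorem lowerEnd_mem_frontier (hb : b ≠ 0) (hΩ : IsStrictlyConvexDomain Ω) {y : hyperplane b}
    (hy : y ∈ hyperProj b '' Ω) : (y : Vec n) + lowerEnd Ω b y • b ∈ frontier Ω := by
  rw [lowerEnd, if_pos hy]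
  refine mem_frontier_of_mem_closure_lineSet hΩ.isOpen
    (csInf_mem_closure (lineSet_nonempty hy) (isBounded_lineSet hb hΩ.bounded y).bddBelow) ?_
  intro h
  have h' := (Set.ext_iff.1 (lineSet_eq_Ioo hb hΩ hy) _).1 h
  exact lt_irrefl _ h'.1

theorem integral_lineSet (hb : b ≠ 0) (hΩ : IsStrictlyConvexDomain Ω) {y : hyperplane b}
    (hy : y ∈ hyperProj b '' Ω) {m : Vec n → ℝ} (hm : ContDiff ℝ 1 m) :
    ∫ s in lineSet Ω b y, fderiv ℝ m ((y : Vec n) + s • b) b =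
      m ((y : Vec n) + upperEnd Ω b y • b) - m ((y : Vec n) + lowerEnd Ω b y • b) := by
  rw [upperEnd, if_pos hy, lowerEnd, if_pos hy]
  have hle : sInf (lineSet Ω b y) ≤ sSup (lineSet Ω b y) :=
    have hbd := isBounded_lineSet hb hΩ.bounded y
    csInf_le_csSup (lineSet_nonempty hy) hbd.bddBelow hbd.bddAbove
  conv_lhs => rw [lineSet_eq_Ioo hb hΩ hy]
  rw [← integral_Ioc_eq_integral_Ioo, ← intervalIntegral.integral_of_le hle]
  refine intervalIntegral.integral_eq_sub_of_hasDerivAt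
    (f := fun s : ℝ => m ((y : Vec n) + s • b)) (fun s _ => hasDerivAt_line hm _ _ s)
    (Continuous.intervalIntegrable ?_ _ _)
  exact (continuous_fderiv_apply hm b).comp (by fun_prop)

theorem exists_enorm_integral_le_lines (hb : b ≠ 0) :
    ∃ c : ℝ≥0, ∀ F : Vec n → ℝ, Integrable F →
      ‖∫ x, F x‖ₑ ≤ c * ∫⁻ y, ‖∫ s : ℝ, F ((y : Vec n) + s • b)‖ₑ ∂(hyperMeasure b) := by
  obtain ⟨c, hc, h⟩ := exists_volume_eq_smul_map hb
  have := sigmaFinite_hyperMeasure hb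
  refine ⟨c, fun F hF => ?_⟩
  have hF' : Integrable (fun p => F (lineEquiv hb p)) ((hyperMeasure b).prod volume) := by
    rw [h] at hF
    change Integrable F ((c : ℝ≥0∞) • _) at hF
    rw [integrable_smul_measure (by exact_mod_cast hc) ENNReal.coe_ne_top,
      (measurableEmbedding_lineEquiv hb).integrable_map_iff] at hF
    exact hF
  rw [h, integral_smul_nnreal_measure, (measurableEmbedding_lineEquiv hb).integral_map,
    integral_prod _ hF', NNReal.smul_def, smul_eq_mul, enorm_mul]
  refine mul_le_mul' (by simp) (enorm_integral_le_lintegral_enorm _)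

/-- A section of the projection pushes the hyperplane measure forward to something below `ℋ^{n-1}`,
because projecting back is 1-Lipschitz. Cauchy–Schwarz on `K` accounts for the square root of its
measure. -/
theorem lintegral_section_le (hb : b ≠ 0) {K : Set (hyperplane b)} {Γ : Set (Vec n)}
    {g : hyperplane b → Vec n} (hg : Measurable g) (hgK : ∀ y ∈ K, hyperProj b (g y) = y ∧ g y ∈ Γ)
    {m : Vec n → ℝ} (hm : Continuous m) :
    ∫⁻ y in K, ‖m (g y)‖ₑ ∂(hyperMeasure b) ≤
      eLpNorm m 2 (surfaceMeasure Γ) * hyperMeasure b K ^ (1 / 2 : ℝ) := by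
  have hmap : Measure.map g ((hyperMeasure b).restrict K) ≤ surfaceMeasure Γ := by
    refine Measure.le_iff.2 fun S hS => ?_
    rw [Measure.map_apply hg hS, Measure.restrict_apply (hg hS), surfaceMeasure,
      Measure.restrict_apply hS]
    refine le_trans (measure_mono ?_) (hyperMeasure_image_le hb (S ∩ Γ))
    rintro y ⟨hy, hyK⟩
    exact ⟨g y, ⟨hy, (hgK y hyK).2⟩, (hgK y hyK).1⟩
  have h1 : AEStronglyMeasurable (m ∘ g) ((hyperMeasure b).restrict K) :=
    (hm.measurable.comp hg).aestronglyMeasurable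
  calc ∫⁻ y in K, ‖m (g y)‖ₑ ∂(hyperMeasure b)
      = eLpNorm (m ∘ g) 1 ((hyperMeasure b).restrict K) := eLpNorm_one_eq_lintegral_enorm.symm
    _ ≤ eLpNorm (m ∘ g) 2 ((hyperMeasure b).restrict K) *
          ((hyperMeasure b).restrict K) Set.univ ^ (1 / (1 : ℝ≥0∞).toReal - 1 / (2 : ℝ≥0∞).toReal) :=
        eLpNorm_le_eLpNorm_mul_rpow_measure_univ (by norm_num) h1
    _ = eLpNorm m 2 (Measure.map g ((hyperMeasure b).restrict K)) *
          hyperMeasure b K ^ (1 / 2 : ℝ) := by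
        rw [eLpNorm_map_measure hm.aestronglyMeasurable hg.aemeasurable,
          Measure.restrict_apply_univ]
        norm_num
    _ ≤ _ := mul_le_mul_left (eLpNorm_mono_measure m hmap) _

/-- The part over `K` of the integral of a directional derivative is controlled by the boundary
values. -/
theorem exists_integral_fderiv_bound (hb : b ≠ 0) (hΩ : IsStrictlyConvexDomain Ω)
    {K : Set (hyperplane b)} (hK : IsCompact K) (hKΩ : K ⊆ hyperProj b '' Ω) :
    ∃ C : ℝ≥0, ∀ m : Vec n → ℝ, ContDiff ℝ 1 m →
      ‖∫ x in Ω ∩ hyperProj b ⁻¹' K, fderiv ℝ m x b‖ₑ ≤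
        C * eLpNorm m 2 (surfaceMeasure (frontier Ω ∩ hyperProj b ⁻¹' K)) := by
  obtain ⟨c, hc⟩ := exists_enorm_integral_le_lines hb
  have := isAddHaarMeasure_hyperMeasure hb
  set D : ℝ≥0∞ := hyperMeasure b K ^ (1 / 2 : ℝ) with hD
  have hDtop : D ≠ ⊤ := ENNReal.rpow_ne_top_of_nonneg (by norm_num) hK.measure_lt_top.ne
  -- `c` comes from Fubini, `2` from the two ends of each line, `D` from Cauchy–Schwarz over `K`.
  refine ⟨c * (2 * D.toNNReal), fun m hm => ?_⟩
  set Γ := frontier Ω ∩ hyperProj b ⁻¹' K with hΓ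
  have hmeas : MeasurableSet (Ω ∩ hyperProj b ⁻¹' K) := hΩ.isOpen.measurableSet.inter
    ((hyperProj b).continuous.measurable hK.measurableSet)
  have hint : IntegrableOn (fun x => fderiv ℝ m x b) (Ω ∩ hyperProj b ⁻¹' K) := by
    have h1 : IntegrableOn (fun x => fderiv ℝ m x b) (closure Ω) :=
      (continuous_fderiv_apply hm b).continuousOn.integrableOn_compact
        (Metric.isCompact_of_isClosed_isBounded isClosed_closure hΩ.bounded.closure)
    exact h1.mono_set (Set.inter_subset_left.trans subset_closure)
  rw [← integral_indicator hmeas]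
  refine (hc _ ((integrable_indicator_iff hmeas).2 hint)).trans ?_
  rw [ENNReal.coe_mul, mul_assoc]
  refine mul_le_mul_right ?_ _
  -- On a line over `K` the fundamental theorem of calculus leaves only the values at the two
  -- boundary points.
  have hline : ∀ y : hyperplane b,
      ‖∫ s : ℝ, (Ω ∩ hyperProj b ⁻¹' K).indicator (fun x => fderiv ℝ m x b)
        ((y : Vec n) + s • b)‖ₑ ≤ K.indicator (fun y => ‖m ((y : Vec n) + upperEnd Ω b y • b)‖ₑ +
          ‖m ((y : Vec n) + lowerEnd Ω b y • b)‖ₑ) y := by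
    intro y
    by_cases hy : y ∈ K
    · have e : (fun s : ℝ => (Ω ∩ hyperProj b ⁻¹' K).indicator (fun x => fderiv ℝ m x b)
        ((y : Vec n) + s • b)) = (lineSet Ω b y).indicator
          fun s => fderiv ℝ m ((y : Vec n) + s • b) b := by
        ext s
        by_cases hs : s ∈ lineSet Ω b y
        · rw [Set.indicator_of_mem hs, Set.indicator_of_mem]
          refine ⟨hs, ?_⟩
          rw [Set.mem_preimage, hyperProj_coe_add]
          exact hy
        · rw [Set.indicator_of_notMem hs, Set.indicator_of_notMem]
          exact fun h => hs h.1
      rw [e, integral_indicator (isOpen_lineSet hΩ.isOpen y).measurableSet,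
        integral_lineSet hb hΩ (hKΩ hy) hm, Set.indicator_of_mem hy]
      exact enorm_sub_le
    · have e : (fun s : ℝ => (Ω ∩ hyperProj b ⁻¹' K).indicator (fun x => fderiv ℝ m x b)
        ((y : Vec n) + s • b)) = fun _ => 0 := by
        ext s
        rw [Set.indicator_of_notMem]
        rintro ⟨-, h⟩
        rw [Set.mem_preimage, hyperProj_coe_add] at h
        exact hy h
      rw [e]
      simp
  refine (lintegral_mono hline).trans ?_
  rw [lintegral_indicator hK.measurableSet]
  have hup : Measurable fun y : hyperplane b => (y : Vec n) + upperEnd Ω b y • b := by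
    have := measurable_upperEnd hb hΩ
    exact measurable_subtype_coe.add (this.smul_const b)
  have hlow : Measurable fun y : hyperplane b => (y : Vec n) + lowerEnd Ω b y • b := by
    have := measurable_lowerEnd hb hΩ
    exact measurable_subtype_coe.add (this.smul_const b)
  have hupm : Measurable fun y : hyperplane b => ‖m ((y : Vec n) + upperEnd Ω b y • b)‖ₑ :=
    (hm.continuous.measurable.comp hup).enorm
  rw [lintegral_add_left hupm]
  have h1 := lintegral_section_le hb (Γ := Γ) hup (fun y hy => ⟨hyperProj_coe_add y _,
    upperEnd_mem_frontier hb hΩ (hKΩ hy), by rwa [Set.mem_preimage, hyperProj_coe_add]⟩)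
    hm.continuous
  have h2 := lintegral_section_le hb (Γ := Γ) hlow (fun y hy => ⟨hyperProj_coe_add y _,
    lowerEnd_mem_frontier hb hΩ (hKΩ hy), by rwa [Set.mem_preimage, hyperProj_coe_add]⟩)
    hm.continuous
  refine (add_le_add h1 h2).trans (le_of_eq ?_)
  rw [ENNReal.coe_mul, ENNReal.coe_toNNReal hDtop, ENNReal.coe_ofNat, ← hD]
  ring

theorem volume_preimage_hyperProj (hb : b ≠ 0) {Z : Set (hyperplane b)} (hZ : MeasurableSet Z)
    (h : hyperMeasure b Z = 0) : volume (hyperProj b ⁻¹' Z) = 0 := by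
  obtain ⟨c, hc, hlines⟩ := exists_lintegral_eq_lines hb
  have hm : MeasurableSet (hyperProj b ⁻¹' Z) := (hyperProj b).continuous.measurable hZ
  rw [← lintegral_indicator_one hm, hlines _ (measurable_one.indicator hm)]
  have : (fun y : hyperplane b => ∫⁻ s : ℝ, (hyperProj b ⁻¹' Z).indicator
      (1 : Vec n → ℝ≥0∞) ((y : Vec n) + s • b)) = Z.indicator fun _ => ⊤ := by
    ext y
    by_cases hy : y ∈ Z
    · rw [Set.indicator_of_mem hy]
      have e : ∀ s : ℝ, (hyperProj b ⁻¹' Z).indicator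
          (1 : Vec n → ℝ≥0∞) ((y : Vec n) + s • b) = 1 := fun s => by
        rw [Set.indicator_of_mem, Pi.one_apply]
        rwa [Set.mem_preimage, hyperProj_coe_add]
      simp [e]
    · rw [Set.indicator_of_notMem hy]
      have e : ∀ s : ℝ, (hyperProj b ⁻¹' Z).indicator
          (1 : Vec n → ℝ≥0∞) ((y : Vec n) + s • b) = 0 := fun s => by
        rw [Set.indicator_of_notMem]
        rwa [Set.mem_preimage, hyperProj_coe_add]
      simp [e]
  rw [this, lintegral_indicator_const hZ, h, mul_zero, mul_zero]

/-- A limit of `C¹` functions with vanishing traces off a null set has a weak directional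
derivative across the boundary, when extended by zero. -/
theorem integral_eq_zero_of_zero_trace (hb : b ≠ 0) (hΩ : IsStrictlyConvexDomain Ω)
    {h g : Vec n → ℝ} {φ : ℕ → Vec n → ℝ} (hφ : ∀ k, ContDiff ℝ 1 (φ k))
    (hh : MemLp h 2 (volume.restrict Ω)) (hg : MemLp g 2 (volume.restrict Ω))
    (hlim : Tendsto (fun k => eLpNorm (fun x => φ k x - h x) 2 (volume.restrict Ω)) atTop (𝓝 0))
    (hlim' : Tendsto (fun k => eLpNorm (fun x => fderiv ℝ (φ k) x b - g x) 2
      (volume.restrict Ω)) atTop (𝓝 0))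
    {E : Set (Vec n)} (hEΩ : E ⊆ frontier Ω) (hE : IsClosed E)
    (hE0 : Measure.hausdorffMeasure ((n : ℝ) - 1) E = 0)
    (htrace : ∀ Γ : Set (Vec n), IsCompact Γ → Γ ⊆ frontier Ω \ E →
      Tendsto (fun k => eLpNorm (φ k) 2 (surfaceMeasure Γ)) atTop (𝓝 0))
    {ψ : Vec n → ℝ} (hψ : ContDiff ℝ 1 ψ) (hψc : HasCompactSupport ψ) :
    ∫ x in Ω, (h x * fderiv ℝ ψ x b + g x * ψ x) = 0 := by
  have hψL : MemLp ψ 2 (volume.restrict Ω) := memLp_of_continuous hΩ.bounded hψ.continuous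
  have hψL' : MemLp (fun x => fderiv ℝ ψ x b) 2 (volume.restrict Ω) :=
    memLp_of_continuous hΩ.bounded (continuous_fderiv_apply hψ b)
  have hφL : ∀ k, MemLp (φ k) 2 (volume.restrict Ω) := fun k =>
    memLp_of_continuous hΩ.bounded (hφ k).continuous
  have hφL' : ∀ k, MemLp (fun x => fderiv ℝ (φ k) x b) 2 (volume.restrict Ω) := fun k =>
    memLp_of_continuous hΩ.bounded (continuous_fderiv_apply (hφ k) b)
  have hEc : IsCompact E := (isCompact_frontier_of_bounded hΩ.bounded).of_isClosed_subset hE hEΩ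
  have hZ : IsCompact (hyperProj b '' E) := hEc.image (hyperProj b).continuous
  obtain ⟨M, hM⟩ := hψc.exists_bound_of_continuous hψ.continuous
  -- Over a compact `K` avoiding the projection of `E`, the boundary part `Γ` is compact and avoids
  -- `E`, so the traces of `φ k` tend to zero there. The product rule makes the approximate
  -- integrand the derivative of `φ k * ψ`, which these traces control.
  have hcompact : ∀ K : Set (hyperplane b), IsCompact K →
      K ⊆ hyperProj b '' Ω \ hyperProj b '' E →
      ∫ x in Ω ∩ hyperProj b ⁻¹' K, (h x * fderiv ℝ ψ x b + g x * ψ x) = 0 := by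
    intro K hK hKsub
    obtain ⟨C, hC⟩ := exists_integral_fderiv_bound hb hΩ hK fun y hy => (hKsub hy).1
    set S := Ω ∩ hyperProj b ⁻¹' K
    have hS : (volume.restrict S : Measure (Vec n)) ≤ volume.restrict Ω :=
      Measure.restrict_mono Set.inter_subset_left le_rfl
    have lim1 := tendsto_integral_mul (fun k => (hφL k).mono_measure hS) (hh.mono_measure hS)
      (hψL'.mono_measure hS) (tendsto_of_tendsto_of_tendsto_of_le_of_le tendsto_const_nhds hlim
        (fun _ => zero_le) fun k => eLpNorm_mono_measure _ hS)
    have lim2 := tendsto_integral_mul (fun k => (hφL' k).mono_measure hS) (hg.mono_measure hS)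
      (hψL.mono_measure hS) (tendsto_of_tendsto_of_tendsto_of_le_of_le tendsto_const_nhds hlim'
        (fun _ => zero_le) fun k => eLpNorm_mono_measure _ hS)
    have lim := lim1.add lim2
    rw [← integral_add (integrable_mul_of_memLp_two (hh.mono_measure hS) (hψL'.mono_measure hS))
      (integrable_mul_of_memLp_two (hg.mono_measure hS) (hψL.mono_measure hS))] at lim
    refine tendsto_nhds_unique lim ?_
    have heq : ∀ k, (∫ x in S, φ k x * fderiv ℝ ψ x b) + ∫ x in S, fderiv ℝ (φ k) x b * ψ x =
        ∫ x in S, fderiv ℝ (fun x => φ k x * ψ x) x b := by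
      intro k
      rw [← integral_add (integrable_mul_of_memLp_two ((hφL k).mono_measure hS)
        (hψL'.mono_measure hS)) (integrable_mul_of_memLp_two ((hφL' k).mono_measure hS)
        (hψL.mono_measure hS))]
      refine integral_congr_ae (Eventually.of_forall fun x => ?_)
      have hd := fderiv_fun_mul (((hφ k).differentiable one_ne_zero) x)
        ((hψ.differentiable one_ne_zero) x)
      beta_reduce
      rw [hd]
      simp [mul_comm]
    set Γ := frontier Ω ∩ hyperProj b ⁻¹' K with hΓ
    have hΓc : IsCompact Γ := (isCompact_frontier_of_bounded hΩ.bounded).inter_right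
      (hK.isClosed.preimage (hyperProj b).continuous)
    have hΓE : Γ ⊆ frontier Ω \ E := fun x hx => ⟨hx.1, fun hxE => (hKsub hx.2).2 ⟨x, hxE, rfl⟩⟩
    have hbound : ∀ k, ‖∫ x in S, fderiv ℝ (fun x => φ k x * ψ x) x b‖ₑ ≤
        (C * ENNReal.ofReal M) * eLpNorm (φ k) 2 (surfaceMeasure Γ) := by
      intro k
      refine (hC _ ((hφ k).mul hψ)).trans ?_
      rw [mul_assoc]
      refine mul_le_mul_right ?_ _
      refine eLpNorm_le_mul_eLpNorm_of_ae_le_mul (Eventually.of_forall fun x => ?_) 2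
      rw [norm_mul, mul_comm]
      exact mul_le_mul_of_nonneg_right (hM x) (norm_nonneg _)
    have hzero : Tendsto (fun k => (C * ENNReal.ofReal M) * eLpNorm (φ k) 2 (surfaceMeasure Γ))
        atTop (𝓝 0) := by
      have := ENNReal.Tendsto.const_mul (a := C * ENNReal.ofReal M) (htrace Γ hΓc hΓE)
        (Or.inr (ENNReal.mul_ne_top ENNReal.coe_ne_top ENNReal.ofReal_ne_top))
      rwa [mul_zero] at this
    have h0 := tendsto_of_tendsto_of_tendsto_of_le_of_le tendsto_const_nhds hzero
      (fun _ => zero_le) hbound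
    simp only [heq]
    rw [tendsto_zero_iff_norm_tendsto_zero]
    have := (ENNReal.tendsto_toReal ENNReal.zero_ne_top).comp h0
    simpa [Function.comp_def] using this
  have hO : IsOpen (hyperProj b '' Ω \ hyperProj b '' E) :=
    (isOpen_hyperProj_image hΩ.isOpen).sdiff hZ.isClosed
  -- Exhaust the admissible base points by compact sets. The lines over the projection of `E` that
  -- are left out fill a null set, since `ℋ^{n-1}(E) = 0`.
  obtain ⟨F, hFc, hFsub, hFU, hFmono⟩ := hO.exists_iUnion_isClosed
  have hbd : Bornology.IsBounded (hyperProj b '' Ω) :=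
    (hyperProj b).lipschitz.isBounded_image hΩ.bounded
  have hint : IntegrableOn (fun x => h x * fderiv ℝ ψ x b + g x * ψ x) Ω :=
    (integrable_mul_of_memLp_two hh hψL').add (integrable_mul_of_memLp_two hg hψL)
  have hlimF := tendsto_setIntegral_of_monotone (μ := volume)
    (f := fun x => h x * fderiv ℝ ψ x b + g x * ψ x) (s := fun k => Ω ∩ hyperProj b ⁻¹' F k)
    (fun k => hΩ.isOpen.measurableSet.inter
      ((hyperProj b).continuous.measurable (hFc k).measurableSet))
    (fun i j hij => Set.inter_subset_inter_right _ (Set.preimage_mono (hFmono hij)))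
    (hint.mono_set (Set.iUnion_subset fun k => Set.inter_subset_left))
  have hF0 : ∀ k, ∫ x in Ω ∩ hyperProj b ⁻¹' F k, (h x * fderiv ℝ ψ x b + g x * ψ x) = 0 :=
    fun k => hcompact (F k) (Metric.isCompact_of_isClosed_isBounded (hFc k)
      (hbd.subset ((hFsub k).trans Set.sdiff_subset))) (hFsub k)
  simp only [hF0] at hlimF
  rw [tendsto_nhds_unique tendsto_const_nhds hlimF]
  refine setIntegral_congr_set ?_
  rw [← Set.inter_iUnion, ← Set.preimage_iUnion, hFU]
  have hnull : volume (hyperProj b ⁻¹' (hyperProj b '' E)) = 0 :=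
    volume_preimage_hyperProj hb hZ.measurableSet
      (le_antisymm ((hyperMeasure_image_le hb E).trans hE0.le) zero_le)
  have hae : ∀ᵐ x : Vec n, x ∉ hyperProj b ⁻¹' (hyperProj b '' E) := measure_eq_zero_iff_ae_notMem.1 hnull
  filter_upwards [hae] with x hx
  refine propext ⟨fun hxΩ => ⟨hxΩ, ⟨x, hxΩ, rfl⟩, hx⟩, fun hxΩ => hxΩ.1⟩

end ZeroTrace

/-! ### Mollification with contraction -/

section Mollify

open scoped NNReal ENNReal

variable {n : ℕ} {F : Type*} [NormedAddCommGroup F] [NormedSpace ℝ F]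

theorem tendsto_eLpNorm_two_of_lintegral {α ι : Type*} [MeasurableSpace α] {μ : Measure α}
    {G : Type*} [NormedAddCommGroup G] {l : Filter ι} {f : ι → α → G}
    (h : Tendsto (fun k => ∫⁻ x, ‖f k x‖ₑ ^ 2 ∂μ) l (𝓝 0)) :
    Tendsto (fun k => eLpNorm (f k) 2 μ) l (𝓝 0) := by
  have h1 := ((ENNReal.continuous_rpow_const (y := (1 / 2 : ℝ))).tendsto 0).comp h
  rw [ENNReal.zero_rpow_of_pos (by norm_num)] at h1
  refine h1.congr fun k => ?_
  rw [Function.comp_apply, ← eLpNorm_two_sq, ← ENNReal.rpow_two, ← ENNReal.rpow_mul]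
  norm_num

/-- Mollification combined with a contraction towards `x₀`. -/
noncomputable def mollify (B : ContDiffBump (0 : Vec n)) (x₀ : Vec n) (δ : ℝ) (w : Vec n → F) :
    Vec n → F :=
  fun x => convolution (B.normed volume) w (ContinuousLinearMap.lsmul ℝ ℝ) volume
    (x + δ • (x - x₀))

theorem mollify_apply (B : ContDiffBump (0 : Vec n)) (x₀ : Vec n) (δ : ℝ) (w : Vec n → F)
    (x : Vec n) :
    mollify B x₀ δ w x = ∫ t, B.normed volume t • w (x + δ • (x - x₀) - t) := rfl

theorem integrable_mollify (B : ContDiffBump (0 : Vec n)) {w : Vec n → F}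
    (hw : LocallyIntegrable w) (x : Vec n) :
    Integrable fun t => B.normed volume t • w (x - t) :=
  B.hasCompactSupport_normed.convolutionExists_left (ContinuousLinearMap.lsmul ℝ ℝ)
    B.continuous_normed hw x

theorem mollify_clm [CompleteSpace F] {F' : Type*} [NormedAddCommGroup F'] [NormedSpace ℝ F']
    [CompleteSpace F'] (B : ContDiffBump (0 : Vec n)) (x₀ : Vec n) (δ : ℝ) {w : Vec n → F}
    (hw : LocallyIntegrable w) (L : F →L[ℝ] F') (x : Vec n) :
    L (mollify B x₀ δ w x) = mollify B x₀ δ (fun y => L (w y)) x := by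
  rw [mollify_apply, mollify_apply, ← L.integral_comp_comm (integrable_mollify B hw _)]
  simp

theorem mollify_congr (B : ContDiffBump (0 : Vec n)) (x₀ : Vec n) (δ : ℝ) {w w' : Vec n → F}
    (h : w =ᵐ[volume] w') : mollify B x₀ δ w = mollify B x₀ δ w' := by
  ext x
  exact congrFun (convolution_congr _ (ae_eq_refl _) h) _

theorem mollify_sub (B : ContDiffBump (0 : Vec n)) (x₀ : Vec n) (δ : ℝ) {w w' : Vec n → F}
    (hw : LocallyIntegrable w) (hw' : LocallyIntegrable w') (x : Vec n) :
    mollify B x₀ δ (fun y => w y - w' y) x = mollify B x₀ δ w x - mollify B x₀ δ w' x := by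
  rw [mollify_apply, mollify_apply, mollify_apply,
    ← integral_sub (integrable_mollify B hw _) (integrable_mollify B hw' _)]
  simp [smul_sub]

theorem lintegral_normed (B : ContDiffBump (0 : Vec n)) :
    ∫⁻ t, ENNReal.ofReal (B.normed volume t) = 1 := by
  rw [← ofReal_integral_eq_lintegral_ofReal B.integrable_normed
    (Eventually.of_forall B.nonneg_normed), B.integral_normed, ENNReal.ofReal_one]

/-- Jensen's inequality: the bump is a probability density, for which the `L¹` norm is at most the
`L²` norm. -/
theorem enorm_mollify_sq_le (B : ContDiffBump (0 : Vec n)) (x₀ : Vec n) (δ : ℝ) {w : Vec n → F}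
    (hw : StronglyMeasurable w) (x : Vec n) :
    ‖mollify B x₀ δ w x‖ₑ ^ 2 ≤
      ∫⁻ t, ENNReal.ofReal (B.normed volume t) * ‖w (x + δ • (x - x₀) - t)‖ₑ ^ 2 := by
  set ρ : Vec n → ℝ≥0∞ := fun t => ENNReal.ofReal (B.normed volume t) with hρ
  have hρm : Measurable ρ := B.continuous_normed.measurable.ennreal_ofReal
  set ν := (volume : Measure (Vec n)).withDensity ρ with hν
  have : IsProbabilityMeasure ν := ⟨by
    rw [hν, withDensity_apply _ MeasurableSet.univ, Measure.restrict_univ, lintegral_normed]⟩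
  set f : Vec n → F := fun t => w (x + δ • (x - x₀) - t) with hf
  have hfm : StronglyMeasurable f := hw.comp_measurable (by fun_prop)
  have h1 : ‖mollify B x₀ δ w x‖ₑ ≤ eLpNorm f 1 ν := by
    rw [eLpNorm_one_eq_lintegral_enorm, hν, lintegral_withDensity_eq_lintegral_mul _ hρm hfm.enorm,
      mollify_apply]
    refine (enorm_integral_le_lintegral_enorm _).trans (lintegral_mono fun t => ?_)
    rw [enorm_smul, Pi.mul_apply, Real.enorm_of_nonneg (B.nonneg_normed t)]
  have h2 : eLpNorm f 1 ν ≤ eLpNorm f 2 ν :=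
    eLpNorm_le_eLpNorm_of_exponent_le (by norm_num) hfm.aestronglyMeasurable
  refine (pow_le_pow_left' (h1.trans h2) 2).trans (le_of_eq ?_)
  rw [eLpNorm_two_sq, hν, lintegral_withDensity_eq_lintegral_mul _ hρm (hfm.enorm.pow_const 2)]
  rfl

/-- The Jacobian factor `(1 + δ)⁻ⁿ` of the change of variables is at most one. -/
theorem lintegral_comp_dilation_le {f : Vec n → ℝ≥0∞} (hf : Measurable f) (x₀ t : Vec n) {δ : ℝ}
    (hδ : 0 ≤ δ) : ∫⁻ x, f (x + δ • (x - x₀) - t) ≤ ∫⁻ x, f x := by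
  have h1 : ∫⁻ x, f (x + δ • (x - x₀) - t) = ∫⁻ x, (fun y => f (y - (δ • x₀ + t))) ((1 + δ) • x) := by
    refine lintegral_congr fun x => ?_
    congr 1
    module
  rw [h1, ← lintegral_map (f := fun y => f (y - (δ • x₀ + t))) (by fun_prop) (by fun_prop),
    Measure.map_addHaar_smul _ (by positivity : (1 + δ) ≠ 0), lintegral_smul_measure,
    lintegral_sub_right_eq_self (fun y => f y)]
  refine mul_le_of_le_one_left zero_le ?_
  rw [← ENNReal.ofReal_one]
  refine ENNReal.ofReal_le_ofReal ?_
  rw [abs_inv, abs_of_nonneg (by positivity)]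
  exact inv_le_one_of_one_le₀ (one_le_pow₀ (by linarith))

theorem eLpNorm_mollify_le (B : ContDiffBump (0 : Vec n)) (x₀ : Vec n) {δ : ℝ} (hδ : 0 ≤ δ)
    {w : Vec n → F} (hw : AEStronglyMeasurable w) :
    eLpNorm (mollify B x₀ δ w) 2 volume ≤ eLpNorm w 2 volume := by
  rw [mollify_congr B x₀ δ hw.ae_eq_mk, eLpNorm_congr_ae hw.ae_eq_mk]
  have hm := hw.stronglyMeasurable_mk
  set w' := hw.mk w
  rw [← ENNReal.pow_le_pow_left_iff two_ne_zero, eLpNorm_two_sq, eLpNorm_two_sq]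
  have hρm : Measurable fun t => ENNReal.ofReal (B.normed volume t) :=
    B.continuous_normed.measurable.ennreal_ofReal
  calc ∫⁻ x, ‖mollify B x₀ δ w' x‖ₑ ^ 2
      ≤ ∫⁻ x, ∫⁻ t, ENNReal.ofReal (B.normed volume t) * ‖w' (x + δ • (x - x₀) - t)‖ₑ ^ 2 :=
        lintegral_mono fun x => enorm_mollify_sq_le B x₀ δ hm x
    _ = ∫⁻ t, ∫⁻ x, ENNReal.ofReal (B.normed volume t) * ‖w' (x + δ • (x - x₀) - t)‖ₑ ^ 2 := by
        refine lintegral_lintegral_swap (Measurable.aemeasurable ?_)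
        refine (hρm.comp measurable_snd).mul (Measurable.pow_const ?_ 2)
        exact (hm.comp_measurable (by fun_prop : Measurable fun p : Vec n × Vec n =>
          p.1 + δ • (p.1 - x₀) - p.2)).enorm
    _ = ∫⁻ t, ENNReal.ofReal (B.normed volume t) * ∫⁻ x, ‖w' (x + δ • (x - x₀) - t)‖ₑ ^ 2 := by
        refine lintegral_congr fun t => ?_
        rw [lintegral_const_mul' _ _ ENNReal.ofReal_ne_top]
    _ ≤ ∫⁻ t, ENNReal.ofReal (B.normed volume t) * ∫⁻ x, ‖w' x‖ₑ ^ 2 := by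
        refine lintegral_mono fun t => mul_le_mul_right ?_ _
        exact lintegral_comp_dilation_le (hm.enorm.pow_const 2) x₀ t hδ
    _ = _ := by rw [lintegral_mul_const _ hρm, lintegral_normed, one_mul]

theorem norm_mollify_le (B : ContDiffBump (0 : Vec n)) (x₀ : Vec n) (δ : ℝ) {w : Vec n → F}
    {M : ℝ} (hM : ∀ x, ‖w x‖ ≤ M) (x : Vec n) : ‖mollify B x₀ δ w x‖ ≤ M := by
  rw [mollify_apply]
  have h : ‖∫ t, B.normed volume t • w (x + δ • (x - x₀) - t)‖ ≤ ∫ t, B.normed volume t * M := by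
    refine norm_integral_le_of_norm_le (B.integrable_normed.mul_const M)
      (Eventually.of_forall fun t => ?_)
    rw [norm_smul, Real.norm_of_nonneg (B.nonneg_normed t)]
    exact mul_le_mul_of_nonneg_left (hM _) (B.nonneg_normed t)
  rwa [integral_mul_const, B.integral_normed, one_mul] at h

theorem contDiff_mollify [CompleteSpace F] (B : ContDiffBump (0 : Vec n)) (x₀ : Vec n) (δ : ℝ)
    {w : Vec n → F} (hw : LocallyIntegrable w) : ContDiff ℝ ∞ (mollify B x₀ δ w) :=
  (B.hasCompactSupport_normed.contDiff_convolution_left (n := ⊤) (ContinuousLinearMap.lsmul ℝ ℝ)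
    B.contDiff_normed hw).comp (by fun_prop)

theorem tendsto_mollify_of_continuous {Ω : Set (Vec n)} (hΩ : Bornology.IsBounded Ω)
    [CompleteSpace F] {B : ℕ → ContDiffBump (0 : Vec n)}
    (hB : Tendsto (fun k => (B k).rOut) atTop (𝓝 0))
    (x₀ : Vec n) {δ : ℕ → ℝ} (hδ : Tendsto δ atTop (𝓝 0)) {g : Vec n → F} (hg : Continuous g)
    (hgc : HasCompactSupport g) :
    Tendsto (fun k => eLpNorm (fun x => mollify (B k) x₀ (δ k) g x - g x) 2 (volume.restrict Ω))
      atTop (𝓝 0) := by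
  obtain ⟨M, hM⟩ := hgc.exists_bound_of_continuous hg
  have hfin : IsFiniteMeasure (volume.restrict Ω) :=
    ⟨by rw [Measure.restrict_apply_univ]; exact hΩ.measure_lt_top⟩
  have hcont : ∀ k, Continuous (mollify (B k) x₀ (δ k) g) := fun k =>
    (contDiff_mollify (B k) x₀ (δ k) hg.locallyIntegrable).continuous
  refine tendsto_eLpNorm_two_of_lintegral ?_
  have h := tendsto_lintegral_of_dominated_convergence' (μ := volume.restrict Ω)
    (F := fun k x => ‖mollify (B k) x₀ (δ k) g x - g x‖ₑ ^ 2) (f := fun _ => 0)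
    (fun _ => ENNReal.ofReal (M + M) ^ 2)
    (fun k => (((hcont k).sub hg).enorm.measurable.pow_const 2).aemeasurable) ?_ ?_ ?_
  · simpa using h
  · intro k
    refine Eventually.of_forall fun x => pow_le_pow_left' ?_ 2
    rw [← ofReal_norm]
    exact ENNReal.ofReal_le_ofReal
      ((norm_sub_le _ _).trans (add_le_add (norm_mollify_le _ _ _ hM x) (hM x)))
  · rw [lintegral_const]
    exact ENNReal.mul_ne_top (by simp) (measure_ne_top _ _)
  · refine Eventually.of_forall fun x => ?_
    have hk : Tendsto (fun k => x + δ k • (x - x₀)) atTop (𝓝 x) := by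
      have := (hδ.smul_const (x - x₀)).const_add x
      simpa using this
    have h1 := ContDiffBump.convolution_tendsto_right (μ := volume) (g := fun _ => g) (z₀ := g x) hB
      (Eventually.of_forall fun _ => hg.aestronglyMeasurable)
      (by exact (hg.tendsto x).comp tendsto_snd) hk
    have h2 : Tendsto (fun k => mollify (B k) x₀ (δ k) g x - g x) atTop (𝓝 0) := by
      rw [← sub_self (g x)]
      exact h1.sub_const (g x)
    have h3 := ENNReal.Tendsto.pow (n := 2) h2.enorm
    simpa using h3

/-- Density of compactly supported continuous maps, where convergence is by domination, together
with the uniform bound `eLpNorm_mollify_le`: three errors of size `ε / 3`. -/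
theorem tendsto_mollify {Ω : Set (Vec n)} (hΩ : Bornology.IsBounded Ω)
    [CompleteSpace F] {B : ℕ → ContDiffBump (0 : Vec n)}
    (hB : Tendsto (fun k => (B k).rOut) atTop (𝓝 0))
    (x₀ : Vec n) {δ : ℕ → ℝ} (hδ : Tendsto δ atTop (𝓝 0)) (hδ0 : ∀ k, 0 ≤ δ k) {w : Vec n → F}
    (hw : MemLp w 2 volume) :
    Tendsto (fun k => eLpNorm (fun x => mollify (B k) x₀ (δ k) w x - w x) 2 (volume.restrict Ω))
      atTop (𝓝 0) := by
  rw [ENNReal.tendsto_nhds_zero]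
  intro ε hε
  have hε3 : ε / 3 ≠ 0 := (ENNReal.div_pos hε.ne' (by norm_num)).ne'
  obtain ⟨g, hgc, hgε, hg, hgL⟩ := hw.exists_hasCompactSupport_eLpNorm_sub_le (by norm_num) hε3
  have hloc : LocallyIntegrable w := hw.locallyIntegrable (by norm_num)
  have hlocg : LocallyIntegrable g := hg.locallyIntegrable
  filter_upwards [(ENNReal.tendsto_nhds_zero.1 (tendsto_mollify_of_continuous hΩ hB x₀ hδ hg hgc))
    (ε / 3) hε3.bot_lt] with k hk
  have h1 : eLpNorm (mollify (B k) x₀ (δ k) fun y => w y - g y) 2 (volume.restrict Ω) ≤ ε / 3 :=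
    (eLpNorm_mono_measure _ Measure.restrict_le_self).trans
      ((eLpNorm_mollify_le (B k) x₀ (hδ0 k) (hw.sub hgL).aestronglyMeasurable).trans hgε)
  have h2 : eLpNorm (fun y => w y - g y) 2 (volume.restrict Ω) ≤ ε / 3 :=
    (eLpNorm_mono_measure _ Measure.restrict_le_self).trans hgε
  have hsm : AEStronglyMeasurable (mollify (B k) x₀ (δ k) fun y => w y - g y)
      (volume.restrict Ω) :=
    (contDiff_mollify (B k) x₀ (δ k) (hloc.sub hlocg)).continuous.aestronglyMeasurable
  have hsm2 : AEStronglyMeasurable (fun x => mollify (B k) x₀ (δ k) g x - g x)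
      (volume.restrict Ω) :=
    ((contDiff_mollify (B k) x₀ (δ k) hlocg).continuous.sub hg).aestronglyMeasurable
  have hsm3 : AEStronglyMeasurable (fun y => w y - g y) (volume.restrict Ω) :=
    (hw.sub hgL).aestronglyMeasurable.restrict
  have e : (fun x => mollify (B k) x₀ (δ k) w x - w x) =
      ((mollify (B k) x₀ (δ k) fun y => w y - g y) + fun x => mollify (B k) x₀ (δ k) g x - g x) -
        fun y => w y - g y := by
    ext x : 1
    simp only [Pi.add_apply, Pi.sub_apply]
    rw [mollify_sub _ _ _ hloc hlocg]
    abel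
  rw [e]
  refine (eLpNorm_sub_le (hsm.add hsm2) hsm3 (by norm_num)).trans ?_
  refine (add_le_add (eLpNorm_add_le hsm hsm2 (by norm_num)) le_rfl).trans ?_
  refine (add_le_add (add_le_add h1 hk) h2).trans (le_of_eq ?_)
  exact ENNReal.add_thirds ε

/-- If `w` vanishes off a bounded convex open set, its mollification is compactly supported in it. -/
theorem mollify_support {Ω : Set (Vec n)} (hΩ : IsOpen Ω) (hconv : Convex ℝ Ω)
    (hbd : Bornology.IsBounded Ω) {x₀ : Vec n} {r : ℝ} (hr : 0 < r)
    (hball : Metric.ball x₀ r ⊆ Ω) {δ : ℝ} (hδ : 0 < δ) {B : ContDiffBump (0 : Vec n)}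
    (hB : B.rOut ≤ δ * (r / 2)) {w : Vec n → F} (hw : ∀ x ∉ Ω, w x = 0) :
    HasCompactSupport (mollify B x₀ δ w) ∧ tsupport (mollify B x₀ δ w) ⊆ Ω := by
  -- If the integrand is nonzero at `t`, put `z = x + δ • (x - x₀) - t ∈ Ω` and `y = x₀ + δ⁻¹ • t`.
  -- Then `(1 + δ) • x = z + δ • y`, and `y` is within `r / 2` of `x₀`, so `x` lies strictly inside
  -- `Ω` even when `z` reaches its boundary.
  set K : Set (Vec n) := (fun p : Vec n × Vec n => (1 + δ)⁻¹ • (p.1 + δ • p.2)) ''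
    (closure Ω ×ˢ Metric.closedBall x₀ (r / 2)) with hKdef
  have hK : IsCompact K := ((Metric.isCompact_of_isClosed_isBounded isClosed_closure
    hbd.closure).prod (isCompact_closedBall x₀ (r / 2))).image (by fun_prop)
  have hKΩ : K ⊆ Ω := by
    rintro _ ⟨⟨z, y⟩, ⟨hz, hy⟩, rfl⟩
    refine mem_of_between hΩ hconv hz (hball (Metric.closedBall_subset_ball (by linarith) hy))
      zero_le_one hδ ?_
    rw [smul_smul, mul_inv_cancel₀ (by positivity), one_smul, one_smul]
  have hsupp : Function.support (mollify B x₀ δ w) ⊆ K := by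
    intro x hx
    by_contra hxK
    refine hx ?_
    rw [mollify_apply]
    refine integral_eq_zero_of_ae (Eventually.of_forall fun t => ?_)
    rw [Pi.zero_apply, smul_eq_zero]
    by_cases ht : B.normed volume t = 0
    · exact Or.inl ht
    · refine Or.inr (hw _ fun hmem => hxK ?_)
      have ht' : t ∈ Metric.ball (0 : Vec n) B.rOut := by
        rw [← B.support_normed_eq (μ := volume)]
        exact ht
      rw [mem_ball_zero_iff] at ht'
      refine ⟨(x + δ • (x - x₀) - t, x₀ + δ⁻¹ • t), ⟨subset_closure hmem, ?_⟩, ?_⟩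
      · rw [mem_closedBall_iff_norm, add_sub_cancel_left, norm_smul, norm_inv,
          Real.norm_of_nonneg hδ.le, inv_mul_le_iff₀ hδ]
        exact ht'.le.trans hB
      · have : x + δ • (x - x₀) - t + δ • (x₀ + δ⁻¹ • t) = (1 + δ) • x := by
          rw [smul_add, smul_smul, mul_inv_cancel₀ hδ.ne']
          module
        change (1 + δ)⁻¹ • (x + δ • (x - x₀) - t + δ • (x₀ + δ⁻¹ • t)) = x
        rw [this, smul_smul, inv_mul_cancel₀ (by positivity), one_smul]
  have hts : tsupport (mollify B x₀ δ w) ⊆ K := closure_minimal hsupp hK.isClosed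
  exact ⟨hK.of_isClosed_subset (isClosed_tsupport _) hts, hts.trans hKΩ⟩

/-- Mollification turns weak directional derivatives into classical ones. -/
theorem fderiv_mollify {a : Vec n} {h g : Vec n → ℝ} (hh : LocallyIntegrable h)
    (hg : LocallyIntegrable g)
    (hweak : ∀ ψ : Vec n → ℝ, ContDiff ℝ 1 ψ → HasCompactSupport ψ →
      ∫ x, (h x * fderiv ℝ ψ x a + g x * ψ x) = 0)
    (B : ContDiffBump (0 : Vec n)) (x₀ : Vec n) (δ : ℝ) (x : Vec n) :
    fderiv ℝ (mollify B x₀ δ h) x a = (1 + δ) * mollify B x₀ δ g x := by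
  set ρ := B.normed volume with hρ
  have hρ1 : ContDiff ℝ 1 ρ := B.contDiff_normed
  have hS : HasFDerivAt (fun x : Vec n => x + δ • (x - x₀))
      ((1 + δ) • ContinuousLinearMap.id ℝ (Vec n)) x := by
    have := (hasFDerivAt_id (𝕜 := ℝ) x).add (((hasFDerivAt_id (𝕜 := ℝ) x).sub_const x₀).const_smul δ)
    refine this.congr_fderiv ?_
    ext y
    simp [add_mul]
  set X := x + δ • (x - x₀) with hX
  have hconv := B.hasCompactSupport_normed.hasFDerivAt_convolution_left (μ := volume)
    (ContinuousLinearMap.lsmul ℝ ℝ) hρ1 hh X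
  have hcomp : fderiv ℝ (mollify B x₀ δ h) x = _ := (hconv.comp x hS).fderiv
  rw [hcomp, ContinuousLinearMap.comp_apply, smul_apply,
    ContinuousLinearMap.id_apply, map_smul, smul_eq_mul]
  congr 1
  have hcs : HasCompactSupport (fderiv ℝ ρ) := B.hasCompactSupport_normed.fderiv ℝ
  have hex := hcs.convolutionExists_left
    (ContinuousLinearMap.precompL (Vec n) (ContinuousLinearMap.lsmul ℝ ℝ))
    (hρ1.continuous_fderiv one_ne_zero) hh X
  -- The reflected bump is the test function. Its support may cross `∂Ω`, which is why the weak
  -- identity is required on all of space.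
  set ψ : Vec n → ℝ := fun y => ρ (X - y) with hψ
  have hψ1 : ContDiff ℝ 1 ψ := hρ1.comp (by fun_prop)
  have hψc : HasCompactSupport ψ :=
    B.hasCompactSupport_normed.comp_homeomorph (Homeomorph.subLeft X)
  have hψd : ∀ y, fderiv ℝ ψ y a = -fderiv ℝ ρ (X - y) a := by
    intro y
    have h1 : HasFDerivAt (fun y : Vec n => X - y) (-ContinuousLinearMap.id ℝ (Vec n)) y :=
      (hasFDerivAt_id (𝕜 := ℝ) y).const_sub X
    have h2 := (((hρ1.differentiable one_ne_zero) (X - y)).hasFDerivAt.comp y h1).fderiv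
    have h3 : fderiv ℝ ψ y = (fderiv ℝ ρ (X - y)).comp (-ContinuousLinearMap.id ℝ (Vec n)) := h2
    rw [h3]
    simp
  have hint1 : Integrable fun y => h y * fderiv ℝ ψ y a := by
    have := hh.integrable_smul_left_of_hasCompactSupport (continuous_fderiv_apply hψ1 a)
      (hψc.fderiv_apply (𝕜 := ℝ) a)
    simpa [mul_comm] using this
  have hint2 : Integrable fun y => g y * ψ y := by
    have := hg.integrable_smul_left_of_hasCompactSupport hψ1.continuous hψc
    simpa [mul_comm] using this
  have hw := hweak ψ hψ1 hψc
  rw [integral_add hint1 hint2] at hw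
  have lhs : convolution (fderiv ℝ ρ) h
      (ContinuousLinearMap.precompL (Vec n) (ContinuousLinearMap.lsmul ℝ ℝ)) volume X a =
      -∫ y, h y * fderiv ℝ ψ y a := by
    rw [convolution_def, ContinuousLinearMap.integral_apply hex, ← integral_neg,
      ← integral_sub_left_eq_self _ volume X]
    refine integral_congr_ae (Eventually.of_forall fun y => ?_)
    beta_reduce
    rw [hψd, sub_sub_cancel]
    simp [ContinuousLinearMap.precompL_apply, mul_comm]
  have rhs : mollify B x₀ δ g x = ∫ y, g y * ψ y := by
    rw [mollify_apply, ← hX, ← integral_sub_left_eq_self _ volume X]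
    refine integral_congr_ae (Eventually.of_forall fun y => ?_)
    beta_reduce
    rw [sub_sub_cancel, smul_eq_mul, mul_comm]
  rw [lhs, rhs]
  linarith

end Mollify

/-! ### Energy limits, Poincaré inequality and partial traces -/

section Energy

open scoped NNReal ENNReal

variable {N n : ℕ} {A : Fin N → Fin n → Fin N → Fin n → ℝ} {Ω : Set (Vec n)}

/-- The projected gradient `ΠDφ`. -/
noncomputable def projGrad (A : Fin N → Fin n → Fin N → Fin n → ℝ) (φ : Vec n → Vec N)
    (x : Vec n) : Mat N n :=
  (rangeSpace A).starProjection (gradMat φ x)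

/-- `(u, G)` is an `L²` limit of pairs `(φ, ΠDφ)` with test maps `φ`. -/
structure IsEnergyLimit (A : Fin N → Fin n → Fin N → Fin n → ℝ) (Ω : Set (Vec n))
    (φ : ℕ → Vec n → Vec N) (u : Vec n → Vec N) (G : Vec n → Mat N n) : Prop where
  memLp : MemLp u 2 (volume.restrict Ω)
  memLp_grad : MemLp G 2 (volume.restrict Ω)
  test : ∀ k, IsTestMap Ω (sigmaSpace A) (φ k)
  tendsto : Tendsto (fun k => eLpNorm (fun x => φ k x - u x) 2 (volume.restrict Ω)) atTop (𝓝 0)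
  tendsto_grad : Tendsto (fun k => eLpNorm (fun x => projGrad A (φ k) x - G x) 2
    (volume.restrict Ω)) atTop (𝓝 0)

theorem continuous_gradMat {φ : Vec n → Vec N} (hφ : ContDiff ℝ 1 φ) :
    Continuous (gradMat φ) := by
  refine (PiLp.continuous_toLp 2 _).comp (continuous_pi fun p => ?_)
  exact continuous_fderiv_apply (contDiff_euclidean.1 hφ p.1) _

theorem continuous_projGrad {φ : Vec n → Vec N} (hφ : ContDiff ℝ 1 φ) :
    Continuous (projGrad A φ) :=
  (rangeSpace A).starProjection.continuous.comp (continuous_gradMat hφ)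

theorem IsTestMap.contDiff_one {S : Submodule ℝ (Vec N)} {φ : Vec n → Vec N}
    (hφ : IsTestMap Ω S φ) : ContDiff ℝ 1 φ :=
  hφ.smooth.of_le (by exact_mod_cast le_top)

theorem inner_tensor_projGrad {φ : Vec n → Vec N} (hφ : ContDiff ℝ 1 φ) {η : Vec N} {a : Vec n}
    (h : tensor η a ∈ rangeSpace A) (x : Vec n) :
    inner ℝ (tensor η a) (projGrad A φ x) = fderiv ℝ (fun y => inner ℝ η (φ y)) x a := by
  rw [projGrad, inner_starProjection_of_mem _ h,
    inner_tensor_gradMat (hφ.differentiable one_ne_zero x)]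

theorem contDiff_inner_left {φ : Vec n → Vec N} {k : ℕ∞ω} (hφ : ContDiff ℝ k φ) (η : Vec N) :
    ContDiff ℝ k fun y => (inner ℝ η (φ y) : ℝ) :=
  contDiff_const.inner ℝ hφ

theorem eLpNorm_inner_le {α F : Type*} [MeasurableSpace α] [NormedAddCommGroup F]
    [InnerProductSpace ℝ F] (v : F) (f : α → F) (μ : Measure α) :
    eLpNorm (fun x => (inner ℝ v (f x) : ℝ)) 2 μ ≤ ENNReal.ofReal ‖v‖ * eLpNorm f 2 μ :=
  eLpNorm_le_mul_eLpNorm_of_ae_le_mul (Eventually.of_forall fun x => norm_inner_le_norm v (f x)) 2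

theorem eLpNorm_fderiv_inner_le {φ : Vec n → Vec N} (hφ : ContDiff ℝ 1 φ) {η : Vec N} {a : Vec n}
    (h : tensor η a ∈ rangeSpace A) (μ : Measure (Vec n)) :
    eLpNorm (fun x => fderiv ℝ (fun y => (inner ℝ η (φ y) : ℝ)) x a) 2 μ ≤
      ENNReal.ofReal ‖tensor η a‖ * eLpNorm (projGrad A φ) 2 μ := by
  simp only [← inner_tensor_projGrad hφ h]
  exact eLpNorm_inner_le _ _ _

theorem tendsto_zero_of_le_mul {f g : ℕ → ℝ≥0∞} {C : ℝ≥0∞} (hC : C ≠ ⊤)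
    (hg : Tendsto g atTop (𝓝 0)) (h : ∀ k, f k ≤ C * g k) : Tendsto f atTop (𝓝 0) := by
  have h1 := ENNReal.Tendsto.const_mul (a := C) hg (Or.inr hC)
  rw [mul_zero] at h1
  exact tendsto_of_tendsto_of_tendsto_of_le_of_le tendsto_const_nhds h1 (fun _ => zero_le) h

/-- The scalar identity behind the zero extension of a map with vanishing partial trace. -/
theorem integral_eq_zero_of_partialTrace (hΩ : IsStrictlyConvexDomain Ω) {v : Vec n → Vec N}
    {G : Vec n → Mat N n} {E : Set (Vec n)} {φ : ℕ → Vec n → Vec N}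
    (hv : MemLp v 2 (volume.restrict Ω)) (hv0 : ∀ᵐ x ∂(surfaceMeasure (frontier Ω)), v x = 0)
    (hG : MemLp G 2 (volume.restrict Ω)) (hEΩ : E ⊆ frontier Ω) (hE : IsClosed E)
    (hE0 : surfaceMeasure (frontier Ω) E = 0) (hφ : ∀ k, ContDiff ℝ 1 (φ k))
    (hlim : Tendsto (fun k => eLpNorm (fun x => (sigmaSpace A).starProjection (φ k x) - v x) 2
      (volume.restrict Ω)) atTop (𝓝 0))
    (hlim' : Tendsto (fun k => eLpNorm (fun x =>
      (rangeSpace A).starProjection (gradMat (φ k) x) - G x) 2 (volume.restrict Ω)) atTop (𝓝 0))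
    (htrace : ∀ Γ : Set (Vec n), IsCompact Γ → Γ ⊆ frontier Ω \ E →
      Tendsto (fun k => eLpNorm (fun x => (sigmaSpace A).starProjection (φ k x) - v x) 2
        (surfaceMeasure Γ)) atTop (𝓝 0))
    {η : Vec N} {a : Vec n} (ha : a ≠ 0) (hηa : tensor η a ∈ rangeSpace A)
    {ψ : Vec n → ℝ} (hψ : ContDiff ℝ 1 ψ) (hψc : HasCompactSupport ψ) :
    ∫ x in Ω, (inner ℝ η (v x) * fderiv ℝ ψ x a + inner ℝ (tensor η a) (G x) * ψ x) = 0 := by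
  have hη : η ∈ sigmaSpace A := mem_sigmaSpace ha hηa
  -- As `η` is in Σ, pairing with it does not see the projection, so the scalar functions `η·φ k`
  -- are `C¹` with the required limits.
  have hin : ∀ k x, (inner ℝ η (φ k x) : ℝ) =
      inner ℝ η ((sigmaSpace A).starProjection (φ k x)) := fun k x =>
    (inner_starProjection_of_mem _ hη _).symm
  refine integral_eq_zero_of_zero_trace (φ := fun k x => inner ℝ η (φ k x)) ha hΩ
    (fun k => contDiff_inner_left (hφ k) η) (hv.const_inner η) (hG.const_inner (tensor η a))
    (tendsto_zero_of_le_mul (C := ENNReal.ofReal ‖η‖) ENNReal.ofReal_ne_top hlim fun k => ?_)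
    (tendsto_zero_of_le_mul (C := ENNReal.ofReal ‖tensor η a‖) ENNReal.ofReal_ne_top hlim'
      fun k => ?_) hEΩ hE ?_
    (fun Γ hΓ hsub => tendsto_zero_of_le_mul (C := ENNReal.ofReal ‖η‖) ENNReal.ofReal_ne_top
      (htrace Γ hΓ hsub) fun k => ?_) hψ hψc
  · refine le_trans (le_of_eq ?_) (eLpNorm_inner_le _ _ _)
    congr 1
    ext x
    rw [inner_sub_right, ← hin k x]
  · refine le_trans (le_of_eq ?_) (eLpNorm_inner_le _ _ _)
    congr 1
    ext x
    rw [inner_sub_right, inner_starProjection_of_mem _ hηa,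
      inner_tensor_gradMat ((hφ k).differentiable one_ne_zero x)]
  · rw [surfaceMeasure, Measure.restrict_apply hE.measurableSet,
      Set.inter_eq_self_of_subset_left hEΩ] at hE0
    exact hE0
  · have h0 : ∀ᵐ x ∂(surfaceMeasure Γ), v x = 0 :=
      (Measure.absolutelyContinuous_of_le (Measure.restrict_mono
        (fun x hx => (hsub hx).1) le_rfl)).ae_le hv0
    refine le_trans (le_of_eq ?_) (eLpNorm_inner_le _ _ _)
    refine eLpNorm_congr_ae ?_
    filter_upwards [h0] with x hx
    rw [hx, sub_zero, ← hin k x]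

/-- Contraction moves the support off `∂Ω` and mollification smooths. Both commute with linear maps,
so the values stay in Σ, and each derivative `D_a(η·φ)` is the matching component of a mollified
`H`. -/
theorem exists_isEnergyLimit_of_weak (hspan : SpannedByRankOne (rangeSpace A))
    (hΩ : IsStrictlyConvexDomain Ω) {w : Vec n → Vec N} {H : Vec n → Mat N n}
    (hw : MemLp w 2 volume) (hH : MemLp H 2 volume) (hwΩ : ∀ x ∉ Ω, w x = 0)
    (hwS : ∀ x, w x ∈ sigmaSpace A) (hHP : ∀ x, H x ∈ rangeSpace A)
    (hweak : ∀ (η : Vec N) (a : Vec n), a ≠ 0 → tensor η a ∈ rangeSpace A →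
      ∀ ψ : Vec n → ℝ, ContDiff ℝ 1 ψ → HasCompactSupport ψ →
        ∫ x, (inner ℝ η (w x) * fderiv ℝ ψ x a + inner ℝ (tensor η a) (H x) * ψ x) = 0) :
    ∃ φ, IsEnergyLimit A Ω φ w H := by
  obtain ⟨x₀, hx₀⟩ := hΩ.nonempty
  obtain ⟨r, hr, hball⟩ := Metric.isOpen_iff.1 hΩ.isOpen x₀ hx₀
  set δ : ℕ → ℝ := fun k => 1 / ((k : ℝ) + 1) with hδdef
  have hδ : Tendsto δ atTop (𝓝 0) := tendsto_one_div_add_atTop_nhds_zero_nat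
  have hδ0 : ∀ k, 0 < δ k := fun k => by positivity
  -- The outer radius `δ k * (r / 2)` is the largest that `mollify_support` allows.
  set B : ℕ → ContDiffBump (0 : Vec n) := fun k =>
    ⟨δ k * (r / 4), δ k * (r / 2), mul_pos (hδ0 k) (by positivity),
      mul_lt_mul_of_pos_left (by linarith) (hδ0 k)⟩ with hBdef
  have hB : Tendsto (fun k => (B k).rOut) atTop (𝓝 0) := by
    have := hδ.mul_const (r / 2)
    rwa [zero_mul] at this
  have hwl : LocallyIntegrable w := hw.locallyIntegrable (by norm_num)
  have hHl : LocallyIntegrable H := hH.locallyIntegrable (by norm_num)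
  have hinl : ∀ {F : Type} [NormedAddCommGroup F] [InnerProductSpace ℝ F] {f : Vec n → F} (c : F),
      MemLp f 2 volume → LocallyIntegrable fun y => (inner ℝ c (f y) : ℝ) :=
    fun c hf => (hf.const_inner c).locallyIntegrable (by norm_num)
  set φ : ℕ → Vec n → Vec N := fun k => mollify (B k) x₀ (δ k) w with hφdef
  have hsm : ∀ k, ContDiff ℝ ∞ (φ k) := fun k => contDiff_mollify (B k) x₀ (δ k) hwl
  have hsm1 : ∀ k, ContDiff ℝ 1 (φ k) := fun k => (hsm k).of_le (by exact_mod_cast le_top)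
  -- Both sides lie in Π, so testing against its rank-one elements suffices; the factor `1 + δ k` is
  -- the chain rule for the contraction.
  have hgrad : ∀ k x, projGrad A (φ k) x = (1 + δ k) • mollify (B k) x₀ (δ k) H x := by
    intro k x
    refine eq_of_inner_tensor_eq hspan (Submodule.starProjection_apply_mem _ _)
      (Submodule.smul_mem _ _ ?_) fun η a ha hηa => ?_
    · rw [← Submodule.starProjection_eq_self_iff, mollify_clm _ _ _ hHl]
      congr 1
      ext y : 1
      exact Submodule.starProjection_eq_self_iff.2 (hHP y)
    · rw [inner_tensor_projGrad (hsm1 k) hηa, inner_smul_right]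
      have e1 : (fun y => (inner ℝ η (φ k y) : ℝ)) =
          mollify (B k) x₀ (δ k) fun y => (inner ℝ η (w y) : ℝ) := by
        ext y
        exact mollify_clm (B k) x₀ (δ k) hwl (innerSL ℝ η) y
      have e2 : (inner ℝ (tensor η a) (mollify (B k) x₀ (δ k) H x) : ℝ) =
          mollify (B k) x₀ (δ k) (fun y => (inner ℝ (tensor η a) (H y) : ℝ)) x :=
        mollify_clm (B k) x₀ (δ k) hHl (innerSL ℝ (tensor η a)) x
      rw [e1, e2]
      exact fderiv_mollify (hinl η hw) (hinl (tensor η a) hH) (hweak η a ha hηa) (B k) x₀ (δ k) x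
  refine ⟨φ, hw.restrict Ω, hH.restrict Ω, fun k => ⟨hsm k, ?_, ?_, fun x => ?_⟩,
    tendsto_mollify hΩ.bounded hB x₀ hδ (fun k => (hδ0 k).le) hw, ?_⟩
  · exact (mollify_support hΩ.isOpen hΩ.convex hΩ.bounded hr hball (hδ0 k) le_rfl hwΩ).1
  · exact (mollify_support hΩ.isOpen hΩ.convex hΩ.bounded hr hball (hδ0 k) le_rfl hwΩ).2
  · rw [← Submodule.starProjection_eq_self_iff, hφdef]
    beta_reduce
    rw [mollify_clm _ _ _ hwl]
    congr 1
    ext y : 1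
    exact Submodule.starProjection_eq_self_iff.2 (hwS y)
  · have lim1 := tendsto_mollify hΩ.bounded hB x₀ hδ (fun k => (hδ0 k).le) hH
    have lim2 : Tendsto (fun k => ENNReal.ofReal (δ k) * eLpNorm H 2 volume) atTop (𝓝 0) := by
      have h1 : Tendsto (fun k => ENNReal.ofReal (δ k)) atTop (𝓝 0) := by
        simpa using ENNReal.tendsto_ofReal hδ
      have := ENNReal.Tendsto.mul_const h1 (b := eLpNorm H 2 volume) (Or.inr hH.eLpNorm_ne_top)
      rwa [zero_mul] at this
    have lim3 := lim1.add lim2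
    rw [add_zero] at lim3
    refine tendsto_of_tendsto_of_tendsto_of_le_of_le tendsto_const_nhds lim3 (fun _ => zero_le)
      fun k => ?_
    have hc : Continuous (mollify (B k) x₀ (δ k) H) :=
      (contDiff_mollify (B k) x₀ (δ k) hHl).continuous
    have e : (fun x => projGrad A (φ k) x - H x) =
        (fun x => mollify (B k) x₀ (δ k) H x - H x) +
          fun x => δ k • mollify (B k) x₀ (δ k) H x := by
      ext x : 1
      rw [hgrad, Pi.add_apply]
      module
    beta_reduce
    rw [e]
    refine (eLpNorm_add_le (hc.aestronglyMeasurable.sub hH.aestronglyMeasurable.restrict)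
      (hc.const_smul (δ k)).aestronglyMeasurable (by norm_num)).trans (add_le_add le_rfl ?_)
    refine (eLpNorm_mono_measure _ Measure.restrict_le_self).trans ?_
    refine (eLpNorm_le_mul_eLpNorm_of_ae_le_mul (c := δ k) (g := mollify (B k) x₀ (δ k) H)
      (Eventually.of_forall fun x => ?_) 2).trans
      (mul_le_mul_right (eLpNorm_mollify_le (B k) x₀ (hδ0 k).le hH.aestronglyMeasurable) _)
    rw [Pi.smul_apply, norm_smul, Real.norm_of_nonneg (hδ0 k).le]

/-- A map with vanishing partial trace is a limit of test maps. -/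
theorem exists_isEnergyLimit_of_partialTrace (hspan : SpannedByRankOne (rangeSpace A))
    (hΩ : IsStrictlyConvexDomain Ω) {v : Vec n → Vec N} (hv : HasPartialTrace A Ω v v)
    (hv0 : ∀ᵐ x ∂(surfaceMeasure (frontier Ω)), v x = 0) :
    ∃ φ G, IsEnergyLimit A Ω φ v G := by
  obtain ⟨⟨hvL, hvS⟩, -, G, E, φ, hG, hEΩ, hE, hE0, hφ, hlim, hlim', htrace⟩ := hv
  -- `v` has values in Σ only almost everywhere and `G` need not take values in Π. Projecting
  -- repairs this without changing the pairings with `η ∈ Σ` and `η ⊗ a ∈ Π`.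
  set w : Vec n → Vec N := Ω.indicator fun x => (sigmaSpace A).starProjection (v x) with hw
  set H : Vec n → Mat N n := Ω.indicator fun x => (rangeSpace A).starProjection (G x) with hH
  have hΩm := hΩ.isOpen.measurableSet
  have hwL : MemLp w 2 volume := (memLp_indicator_iff_restrict hΩm).2
    ((sigmaSpace A).starProjection.comp_memLp' hvL)
  have hHL : MemLp H 2 volume := (memLp_indicator_iff_restrict hΩm).2
    ((rangeSpace A).starProjection.comp_memLp' hG)
  have hwv : w =ᵐ[volume.restrict Ω] v := by
    filter_upwards [hvS, ae_restrict_mem hΩm] with x hx hxΩ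
    rw [hw, Set.indicator_of_mem hxΩ, Submodule.starProjection_eq_self_iff.2 hx]
  obtain ⟨φ', hφ'⟩ := exists_isEnergyLimit_of_weak hspan hΩ hwL hHL
    (fun x hx => Set.indicator_of_notMem hx _) (fun x => by
      by_cases hx : x ∈ Ω
      · rw [hw, Set.indicator_of_mem hx]; exact Submodule.starProjection_apply_mem _ _
      · rw [hw, Set.indicator_of_notMem hx]; exact Submodule.zero_mem _) (fun x => by
      by_cases hx : x ∈ Ω
      · rw [hH, Set.indicator_of_mem hx]; exact Submodule.starProjection_apply_mem _ _
      · rw [hH, Set.indicator_of_notMem hx]; exact Submodule.zero_mem _)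
    (fun η a ha hηa ψ hψ hψc => by
      rw [← integral_eq_zero_of_partialTrace hΩ hvL hv0 hG hEΩ hE hE0 hφ hlim hlim' htrace ha hηa
        hψ hψc, ← integral_indicator hΩm]
      refine integral_congr_ae (Eventually.of_forall fun x => ?_)
      by_cases hx : x ∈ Ω
      · simp only [hw, hH, Set.indicator_of_mem hx]
        rw [inner_starProjection_of_mem _ hηa, inner_starProjection_of_mem _ (mem_sigmaSpace ha hηa)]
      · simp [hw, hH, Set.indicator_of_notMem hx])
  refine ⟨φ', H, hvL, hφ'.memLp_grad, hφ'.test, hφ'.tendsto.congr fun k => ?_, hφ'.tendsto_grad⟩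
  refine eLpNorm_congr_ae ?_
  filter_upwards [hwv] with x hx
  rw [hx]

/-- Integrate `ψ ^ 2 * D_a ℓ` by parts for the linear function `ℓ` with `D_a ℓ = 1`, which is
bounded on `Ω`, and absorb half of `ψ ^ 2` on the left. -/
theorem exists_scalar_poincare (hΩ : Bornology.IsBounded Ω) {a : Vec n} (ha : a ≠ 0) :
    ∃ C : ℝ≥0, ∀ ψ : Vec n → ℝ, ContDiff ℝ 1 ψ → HasCompactSupport ψ → tsupport ψ ⊆ Ω →
      eLpNorm ψ 2 (volume.restrict Ω) ≤
        C * eLpNorm (fun x => fderiv ℝ ψ x a) 2 (volume.restrict Ω) := by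
  set ℓ : Vec n →L[ℝ] ℝ := (‖a‖ ^ 2)⁻¹ • innerSL ℝ a with hℓ
  have hℓa : ℓ a = 1 := by
    rw [hℓ, smul_apply, innerSL_apply_apply, real_inner_self_eq_norm_sq, smul_eq_mul,
      inv_mul_cancel₀ (pow_ne_zero 2 (norm_ne_zero_iff.2 ha))]
  obtain ⟨R, hR⟩ := (Metric.isCompact_of_isClosed_isBounded isClosed_closure
    hΩ.closure).exists_bound_of_continuousOn ℓ.continuous.continuousOn
  refine ⟨Real.toNNReal (2 * |R|), fun ψ hψ hψc hψΩ => ?_⟩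
  have hDc := continuous_fderiv_apply hψ a
  have hDs : HasCompactSupport fun x => fderiv ℝ ψ x a := hψc.fderiv_apply (𝕜 := ℝ) a
  have hsq : ContDiff ℝ 1 fun x => ψ x ^ 2 := hψ.pow 2
  have hD2 : ∀ x, fderiv ℝ (fun x => ψ x ^ 2) x a = 2 * ψ x * fderiv ℝ ψ x a := by
    intro x
    have := ((hψ.differentiable one_ne_zero x).hasFDerivAt.pow 2).fderiv
    rw [this]
    simp
  have hi : ∀ {f : Vec n → ℝ}, Continuous f → (∀ x, ψ x = 0 → f x = 0) → Integrable f := by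
    intro f hf h0
    exact hf.integrable_of_hasCompactSupport (hψc.mono fun x hx => fun h => hx (h0 x h))
  have hparts := integral_mul_fderiv_eq_neg_fderiv_mul_of_integrable (μ := volume)
    (f := fun x => ψ x ^ 2) (g := fun x => ℓ x) (v := a)
    (hi (by simp only [hD2]; have := hψ.continuous; fun_prop) (fun x hx => by simp [hD2, hx]))
    (hi (by simp only [ContinuousLinearMap.fderiv]; have := hψ.continuous; fun_prop)
      (fun x hx => by simp [hx]))
    (hi (by have := hψ.continuous; fun_prop) (fun x hx => by simp [hx]))
    (fun x _ => hsq.differentiable one_ne_zero x) (fun x _ => ℓ.differentiableAt)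
  simp only [ContinuousLinearMap.fderiv, hℓa, mul_one, hD2] at hparts
  have hmain : ∫ x, ψ x ^ 2 ≤ ∫ x, (2 * |R|) ^ 2 * (fderiv ℝ ψ x a) ^ 2 := by
    have hI1 : Integrable fun x => ψ x ^ 2 :=
      hi (by have := hψ.continuous; fun_prop) (fun x hx => by simp [hx])
    have hI2 : Integrable fun x => (fderiv ℝ ψ x a) ^ 2 :=
      (hDc.pow 2).integrable_of_hasCompactSupport (hDs.mono fun x hx h => hx (by
        have h' : fderiv ℝ ψ x a = 0 := h
        simp [h']))
    have h1 : ∫ x, ψ x ^ 2 ≤ ∫ x, (ψ x ^ 2 / 2 + 2 * |R| ^ 2 * (fderiv ℝ ψ x a) ^ 2) := by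
      rw [hparts, ← integral_neg]
      refine integral_mono (Integrable.neg (hi (by have := hψ.continuous; fun_prop)
        (fun x hx => by simp [hx]))) ((hI1.div_const 2).add (hI2.const_mul _)) fun x => ?_
      by_cases hx : ψ x = 0
      · simp only [hx]
        simp only [mul_zero, zero_mul, neg_zero]
        positivity
      · have hxR : |ℓ x| ≤ |R| :=
          (hR x (subset_closure (hψΩ (subset_tsupport _ hx)))).trans (le_abs_self R)
        have h2 : ℓ x ^ 2 ≤ |R| ^ 2 := by
          rw [← sq_abs (ℓ x)]
          exact pow_le_pow_left₀ (abs_nonneg _) hxR 2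
        have h3 := mul_le_mul_of_nonneg_right h2 (sq_nonneg (fderiv ℝ ψ x a))
        beta_reduce
        -- This square is Young's inequality with weight `1 / 2` on `ψ ^ 2`, whence the constant `2
        -- * |R|`.
        nlinarith [sq_nonneg (ψ x + 2 * (ℓ x * fderiv ℝ ψ x a))]
    rw [integral_add (hI1.div_const 2) (hI2.const_mul _), integral_div, integral_const_mul] at h1
    rw [integral_const_mul]
    nlinarith
  have hnorm : ∀ f : Vec n → ℝ, Continuous f → HasCompactSupport f →
      eLpNorm f 2 volume ^ 2 = ENNReal.ofReal (∫ x, f x ^ 2) := by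
    intro f hf hfc
    rw [eLpNorm_two_sq, ofReal_integral_eq_lintegral_ofReal]
    · simp only [ofReal_sq_eq_enorm]
    · exact (hf.pow 2).integrable_of_hasCompactSupport (hfc.mono fun x hx h => hx (by
        have h' : f x = 0 := h
        simp [h']))
    · exact Eventually.of_forall fun x => sq_nonneg _
  rw [eLpNorm_restrict_eq_of_support_subset ((subset_tsupport _).trans hψΩ),
    eLpNorm_restrict_eq_of_support_subset (((subset_tsupport _).trans
      (tsupport_fderiv_apply_subset ℝ a)).trans hψΩ),
    ← ENNReal.pow_le_pow_left_iff two_ne_zero, mul_pow, hnorm ψ hψ.continuous hψc,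
    hnorm _ hDc hDs]
  rw [integral_const_mul] at hmain
  refine (ENNReal.ofReal_le_ofReal hmain).trans (le_of_eq ?_)
  rw [ENNReal.ofReal_mul (by positivity), ENNReal.ofReal_pow (by positivity)]
  rfl

/-- The `L²` norm of a `Σ`-valued map is controlled by the components along a frame. -/
theorem eLpNorm_le_frame {T : Finset (Vec N × Vec n)} {C : ℝ}
    (hT : ∀ ξ ∈ sigmaSpace A, ‖ξ‖ ≤ C * ∑ p ∈ T, ‖(inner ℝ p.1 ξ : ℝ)‖) {φ : Vec n → Vec N}
    (hφ : Continuous φ) (hφS : ∀ x, φ x ∈ sigmaSpace A) (μ : Measure (Vec n)) :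
    eLpNorm φ 2 μ ≤ ENNReal.ofReal C * ∑ p ∈ T, eLpNorm (fun x => (inner ℝ p.1 (φ x) : ℝ)) 2 μ := by
  have hc : ∀ p : Vec N × Vec n, Continuous fun x => ‖(inner ℝ p.1 (φ x) : ℝ)‖ := fun p =>
    (continuous_const.inner hφ).norm
  have h1 : eLpNorm φ 2 μ ≤ ENNReal.ofReal C *
      eLpNorm (∑ p ∈ T, fun x => ‖(inner ℝ p.1 (φ x) : ℝ)‖) 2 μ := by
    refine eLpNorm_le_mul_eLpNorm_of_ae_le_mul (Eventually.of_forall fun x => ?_) 2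
    rw [Finset.sum_apply, Real.norm_of_nonneg (Finset.sum_nonneg fun _ _ => norm_nonneg _)]
    exact hT _ (hφS x)
  refine h1.trans (mul_le_mul_right ?_ _)
  refine (eLpNorm_sum_le (fun p _ => (hc p).aestronglyMeasurable) (by norm_num)).trans ?_
  refine Finset.sum_le_sum fun p _ => le_of_eq ?_
  exact eLpNorm_norm _

/-- Each frame component `η·φ` obeys the scalar inequality in its own direction `a`, and `D_a(η·φ)`
is a component of `ΠDφ`; the frame then recovers the norm on Σ. -/
theorem exists_poincare (A : Fin N → Fin n → Fin N → Fin n → ℝ) (hΩ : Bornology.IsBounded Ω) :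
    ∃ C : ℝ≥0, ∀ φ : Vec n → Vec N, IsTestMap Ω (sigmaSpace A) φ →
      eLpNorm φ 2 (volume.restrict Ω) ≤ C * eLpNorm (projGrad A φ) 2 (volume.restrict Ω) := by
  obtain ⟨T, C, hC, hT, hframe⟩ := exists_frame A
  choose D hD using fun p : T => exists_scalar_poincare hΩ (hT p p.2).1
  refine ⟨Real.toNNReal C * ∑ p : T, D p * Real.toNNReal ‖tensor p.1.1 p.1.2‖, fun φ hφ => ?_⟩
  refine (eLpNorm_le_frame hframe hφ.smooth.continuous hφ.mem _).trans ?_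
  rw [ENNReal.coe_mul, mul_assoc]
  refine mul_le_mul_right ?_ _
  rw [ENNReal.ofNNReal_finsetSum, Finset.sum_mul, ← Finset.sum_coe_sort T]
  refine Finset.sum_le_sum fun p _ => ?_
  have hsupp : Function.support (fun x => (inner ℝ p.1.1 (φ x) : ℝ)) ⊆ Function.support φ := by
    intro x hx h
    exact hx (by simp [show φ x = 0 from h])
  refine (hD p _ (contDiff_inner_left hφ.contDiff_one _) (hφ.compact.mono hsupp)
    ((closure_mono hsupp).trans hφ.support)).trans ?_
  rw [ENNReal.coe_mul, mul_assoc]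
  exact mul_le_mul_right (eLpNorm_fderiv_inner_le hφ.contDiff_one (hT p p.2).2 _) _

/-- The partial trace estimate for `Σ`-valued maps. -/
theorem exists_partial_trace_estimate (A : Fin N → Fin n → Fin N → Fin n → ℝ)
    (hΩ : IsStrictlyConvexDomain Ω) :
    ∃ E : Set (Vec n), E ⊆ frontier Ω ∧ IsClosed E ∧ surfaceMeasure (frontier Ω) E = 0 ∧
      ∀ Γ : Set (Vec n), IsCompact Γ → Γ ⊆ frontier Ω \ E → ∃ C : ℝ≥0,
        ∀ φ : Vec n → Vec N, ContDiff ℝ 1 φ → (∀ x, φ x ∈ sigmaSpace A) →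
          eLpNorm φ 2 (surfaceMeasure Γ) ≤ C * (eLpNorm φ 2 (volume.restrict Ω) +
            eLpNorm (projGrad A φ) 2 (volume.restrict Ω)) := by
  obtain ⟨T, C, hC, hT, hframe⟩ := exists_frame A
  -- The exceptional set is the finite union of the shadows of the frame directions, chosen before
  -- the map and before `Γ`.
  refine ⟨⋃ p ∈ T, shadow Ω p.2, ?_, ?_, ?_, ?_⟩
  · exact Set.iUnion₂_subset fun p _ x hx => hx.1
  · exact T.finite_toSet.isClosed_biUnion fun p _ => isClosed_shadow hΩ.isOpen p.2
  · refine le_antisymm ((Measure.restrict_apply_le _ _).trans ?_) zero_le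
    rw [nonpos_iff_eq_zero]
    exact (measure_biUnion_null_iff T.countable_toSet).2 fun p hp => hausdorffMeasure_shadow hΩ (hT p hp).1
  · intro Γ hΓ hsub
    have hsub' : ∀ p : T, Γ ⊆ frontier Ω \ shadow Ω p.1.2 := fun p x hx =>
      ⟨(hsub hx).1, fun h => (hsub hx).2 (Set.mem_biUnion p.2 h)⟩
    choose D hD using fun p : T =>
      exists_trace_estimate hΩ.isOpen hΩ.convex p.1.2 hΓ (hsub' p)
    refine ⟨Real.toNNReal C * ∑ p : T, D p * (Real.toNNReal ‖p.1.1‖ +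
      Real.toNNReal ‖tensor p.1.1 p.1.2‖), fun φ hφ hφS => ?_⟩
    refine (eLpNorm_le_frame hframe hφ.continuous hφS _).trans ?_
    rw [ENNReal.coe_mul, mul_assoc]
    refine mul_le_mul_right ?_ _
    rw [ENNReal.ofNNReal_finsetSum, Finset.sum_mul, ← Finset.sum_coe_sort T]
    refine Finset.sum_le_sum fun p _ => ?_
    refine (hD p _ (contDiff_inner_left hφ _)).trans ?_
    rw [ENNReal.coe_mul, mul_assoc]
    refine mul_le_mul_right ?_ _
    refine (add_le_add (eLpNorm_inner_le _ _ _) (eLpNorm_fderiv_inner_le hφ (hT p p.2).2 _)).trans ?_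
    rw [ENNReal.coe_add, add_mul]
    exact add_le_add (mul_le_mul_right le_self_add _) (mul_le_mul_right le_add_self _)

end Energy

/-! ### Lax–Milgram on a closure -/

section LaxMilgram

/-- Lax--Milgram on the closure of a subspace on which the form controls both components. -/
theorem exists_mem_closure_of_coercive {X Y : Type*} [NormedAddCommGroup X]
    [InnerProductSpace ℝ X] [CompleteSpace X] [NormedAddCommGroup Y] [InnerProductSpace ℝ Y]
    [CompleteSpace Y] (S : Submodule ℝ (WithLp 2 (X × Y))) (T : Y →L[ℝ] Y) {C c : ℝ} (hc : 0 < c)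
    (hC : ∀ z ∈ S, ‖z.fst‖ ≤ C * ‖z.snd‖)
    (hT : ∀ z ∈ S, c * ‖z.snd‖ ^ 2 ≤ inner ℝ (T z.snd) z.snd) (f : X) :
    ∃ z ∈ closure (S : Set (WithLp 2 (X × Y))), ∀ w ∈ S,
      inner ℝ (T z.snd) w.snd = inner ℝ f w.fst := by
  set W := S.topologicalClosure with hW
  have hWc : IsClosed (W : Set (WithLp 2 (X × Y))) := S.isClosed_topologicalClosure
  have : CompleteSpace W := hWc.completeSpace_coe
  set p₂ : W →L[ℝ] Y := (WithLp.sndL 2 ℝ X Y).comp W.subtypeL with hp₂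
  set p₁ : W →L[ℝ] X := (WithLp.fstL 2 ℝ X Y).comp W.subtypeL with hp₁
  set I : Y →L[ℝ] Y →L[ℝ] ℝ := (isBoundedBilinearMap_inner (𝕜 := ℝ) (E := Y)).toContinuousLinearMap
  set B : W →L[ℝ] W →L[ℝ] ℝ := I.bilinearComp (T.comp p₂) p₂ with hB
  have hBapp : ∀ z w : W, B z w = inner ℝ (T z.1.snd) w.1.snd := fun z w => rfl
  -- The bound on the first component gives `‖z‖ ^ 2 ≤ (C ^ 2 + 1) * ‖z.snd‖ ^ 2`.
  set κ : ℝ := c / (C ^ 2 + 1) with hκ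
  have hκ0 : 0 < κ := by positivity
  have hS : ∀ z ∈ S, κ * ‖z‖ * ‖z‖ ≤ inner ℝ (T z.snd) z.snd := by
    intro z hz
    refine le_trans ?_ (hT z hz)
    have h1 : ‖z‖ ^ 2 = ‖z.fst‖ ^ 2 + ‖z.snd‖ ^ 2 := WithLp.prod_norm_sq_eq_of_L2 z
    have h2 : ‖z.fst‖ ^ 2 ≤ C ^ 2 * ‖z.snd‖ ^ 2 := by
      rw [← mul_pow]
      exact pow_le_pow_left₀ (norm_nonneg _) (hC z hz) 2
    calc κ * ‖z‖ * ‖z‖ = κ * ‖z‖ ^ 2 := by ring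
      _ ≤ κ * ((C ^ 2 + 1) * ‖z.snd‖ ^ 2) := by
          refine mul_le_mul_of_nonneg_left ?_ hκ0.le
          rw [h1]; linarith
      _ = c * ‖z.snd‖ ^ 2 := by rw [hκ]; field_simp
  have hcoer : IsCoercive B := by
    refine ⟨κ, hκ0, fun z => ?_⟩
    -- Coercivity is a closed condition, so it passes from `S` to its closure.
    have hclosed : IsClosed {z : WithLp 2 (X × Y) | κ * ‖z‖ * ‖z‖ ≤ inner ℝ (T z.snd) z.snd} := by
      refine isClosed_le (by fun_prop) ?_
      have h2 : Continuous fun z : WithLp 2 (X × Y) => z.snd := (WithLp.sndL 2 ℝ X Y).continuous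
      exact (T.continuous.comp h2).inner h2
    exact closure_minimal hS hclosed z.2
  set F : W →L[ℝ] ℝ := (innerSL ℝ f).comp p₁ with hF
  set v : W := hcoer.continuousLinearEquivOfBilin.symm ((InnerProductSpace.toDual ℝ W).symm F)
    with hv
  refine ⟨v, v.2, fun w hw => ?_⟩
  have hw' : w ∈ W := S.le_topologicalClosure hw
  have h1 := hcoer.continuousLinearEquivOfBilin_apply v ⟨w, hw'⟩
  rw [hv, ContinuousLinearEquiv.apply_symm_apply, InnerProductSpace.toDual_symm_apply, ← hv,
    hBapp] at h1
  exact h1.symm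

end LaxMilgram

/-! ### Existence of weak solutions -/

section WeakSolution

open scoped NNReal ENNReal

variable {N n : ℕ} {A : Fin N → Fin n → Fin N → Fin n → ℝ} {Ω : Set (Vec n)}

theorem IsTestMap.memLp {S : Submodule ℝ (Vec N)} {φ : Vec n → Vec N} (hφ : IsTestMap Ω S φ) :
    MemLp φ 2 (volume.restrict Ω) :=
  (hφ.smooth.continuous.memLp_of_hasCompactSupport hφ.compact).restrict Ω

theorem projGrad_eq_zero_of_notMem_tsupport {φ : Vec n → Vec N} {x : Vec n}
    (hx : x ∉ tsupport φ) : projGrad A φ x = 0 := by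
  have hev : φ =ᶠ[𝓝 x] fun _ => 0 := notMem_tsupport_iff_eventuallyEq.1 hx
  have h0 : gradMat φ x = 0 := by
    ext p
    have hev' : (fun y => φ y p.1) =ᶠ[𝓝 x] fun _ => (0 : ℝ) := by
      filter_upwards [hev] with y hy
      rw [hy]; rfl
    change fderiv ℝ (fun y => φ y p.1) x _ = 0
    rw [hev'.fderiv_eq]
    simp
  rw [projGrad, h0, map_zero]

theorem hasCompactSupport_projGrad {φ : Vec n → Vec N} (hφ : HasCompactSupport φ) :
    HasCompactSupport (projGrad A φ) :=
  hφ.mono' fun _ hx => by_contra fun hxs => hx (projGrad_eq_zero_of_notMem_tsupport hxs)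

theorem IsTestMap.memLp_projGrad {S : Submodule ℝ (Vec N)} {φ : Vec n → Vec N}
    (hφ : IsTestMap Ω S φ) : MemLp (projGrad A φ) 2 (volume.restrict Ω) :=
  ((continuous_projGrad hφ.contDiff_one).memLp_of_hasCompactSupport
    (hasCompactSupport_projGrad hφ.compact)).restrict Ω

theorem IsTestMap.add {S : Submodule ℝ (Vec N)} {φ ψ : Vec n → Vec N} (hφ : IsTestMap Ω S φ)
    (hψ : IsTestMap Ω S ψ) : IsTestMap Ω S (φ + ψ) :=
  ⟨hφ.smooth.add hψ.smooth, hφ.compact.add hψ.compact,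
    (tsupport_add φ ψ).trans (Set.union_subset hφ.support hψ.support),
    fun x => S.add_mem (hφ.mem x) (hψ.mem x)⟩

theorem IsTestMap.smul {S : Submodule ℝ (Vec N)} {φ : Vec n → Vec N} (hφ : IsTestMap Ω S φ)
    (c : ℝ) : IsTestMap Ω S (c • φ) := by
  have hsub : Function.support (c • φ) ⊆ Function.support φ := Function.support_const_smul_subset c φ
  exact ⟨hφ.smooth.const_smul c, hφ.compact.mono hsub, (closure_mono hsub).trans hφ.support,
    fun x => S.smul_mem c (hφ.mem x)⟩

theorem isTestMap_zero (S : Submodule ℝ (Vec N)) : IsTestMap Ω S (0 : Vec n → Vec N) :=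
  ⟨contDiff_const, HasCompactSupport.zero, by simp [tsupport], fun _ => S.zero_mem⟩

theorem gradMat_add {φ ψ : Vec n → Vec N} (hφ : ContDiff ℝ 1 φ) (hψ : ContDiff ℝ 1 ψ)
    (x : Vec n) : gradMat (φ + ψ) x = gradMat φ x + gradMat ψ x := by
  ext p
  have h1 := (contDiff_euclidean.1 hφ p.1).differentiable one_ne_zero x
  have h2 := (contDiff_euclidean.1 hψ p.1).differentiable one_ne_zero x
  change fderiv ℝ (fun y => φ y p.1 + ψ y p.1) x _ = _
  rw [fderiv_fun_add h1 h2]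
  rfl

theorem gradMat_smul {φ : Vec n → Vec N} (hφ : ContDiff ℝ 1 φ) (c : ℝ) (x : Vec n) :
    gradMat (c • φ) x = c • gradMat φ x := by
  ext p
  have h1 := (contDiff_euclidean.1 hφ p.1).differentiable one_ne_zero x
  change fderiv ℝ (fun y => c • φ y p.1) x _ = _
  rw [fderiv_fun_const_smul h1]
  rfl

theorem projGrad_add {φ ψ : Vec n → Vec N} (hφ : ContDiff ℝ 1 φ) (hψ : ContDiff ℝ 1 ψ) :
    projGrad A (φ + ψ) = projGrad A φ + projGrad A ψ := by
  ext x : 1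
  rw [projGrad, gradMat_add hφ hψ, map_add]
  rfl

theorem projGrad_smul {φ : Vec n → Vec N} (hφ : ContDiff ℝ 1 φ) (c : ℝ) :
    projGrad A (c • φ) = c • projGrad A φ := by
  ext x : 1
  rw [projGrad, gradMat_smul hφ, map_smul]
  rfl

/-- The pair `(φ, ΠDφ)` as an element of the energy space. -/
noncomputable def testPair (A : Fin N → Fin n → Fin N → Fin n → ℝ) {φ : Vec n → Vec N}
    (hφ : IsTestMap Ω (sigmaSpace A) φ) :
    WithLp 2 (Lp (Vec N) 2 (volume.restrict Ω) × Lp (Mat N n) 2 (volume.restrict Ω)) :=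
  WithLp.toLp 2 (hφ.memLp.toLp φ, hφ.memLp_projGrad.toLp (projGrad A φ))

/-- The space of pairs `(φ, ΠDφ)`. -/
noncomputable def testSpace (A : Fin N → Fin n → Fin N → Fin n → ℝ) (Ω : Set (Vec n)) :
    Submodule ℝ
      (WithLp 2 (Lp (Vec N) 2 (volume.restrict Ω) × Lp (Mat N n) 2 (volume.restrict Ω))) where
  carrier := {z | ∃ (φ : Vec n → Vec N) (hφ : IsTestMap Ω (sigmaSpace A) φ), z = testPair A hφ}
  add_mem' := by
    rintro _ _ ⟨φ, hφ, rfl⟩ ⟨ψ, hψ, rfl⟩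
    refine ⟨φ + ψ, hφ.add hψ, ?_⟩
    rw [testPair, testPair, testPair, ← WithLp.toLp_add, Prod.mk_add_mk, ← MemLp.toLp_add,
      ← MemLp.toLp_add]
    simp only [projGrad_add hφ.contDiff_one hψ.contDiff_one]
  zero_mem' := by
    refine ⟨0, isTestMap_zero _, ?_⟩
    have h0 : projGrad A (0 : Vec n → Vec N) = 0 := by
      have := projGrad_smul (A := A) (isTestMap_zero (Ω := Ω) (sigmaSpace A) :
        IsTestMap Ω _ (0 : Vec n → Vec N)).contDiff_one 0
      simpa using this
    rw [testPair]
    simp only [h0, MemLp.toLp_zero]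
    rfl
  smul_mem' := by
    rintro c _ ⟨φ, hφ, rfl⟩
    refine ⟨c • φ, hφ.smul c, ?_⟩
    rw [testPair, testPair, ← WithLp.toLp_smul, Prod.smul_mk, ← MemLp.toLp_const_smul,
      ← MemLp.toLp_const_smul]
    simp only [projGrad_smul hφ.contDiff_one]

/-- The action of the tensor `A` on matrices as a continuous linear map. -/
noncomputable def tensorCLM (A : Fin N → Fin n → Fin N → Fin n → ℝ) : Mat N n →L[ℝ] Mat N n :=
  LinearMap.toContinuousLinearMap (tensorMap A)

@[simp] theorem tensorCLM_apply (Q : Mat N n) : tensorCLM A Q = tensorMap A Q := rfl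

theorem inner_compLpL_toLp {μ : Measure (Vec n)} {G H : Vec n → Mat N n} (hG : MemLp G 2 μ)
    (hH : MemLp H 2 μ) :
    inner ℝ ((tensorCLM A).compLpL 2 μ (hG.toLp G)) (hH.toLp H) =
      ∫ x, inner ℝ (tensorMap A (G x)) (H x) ∂μ := by
  rw [L2.inner_def]
  refine integral_congr_ae ?_
  filter_upwards [(tensorCLM A).coeFn_compLpL (hG.toLp G), hG.coeFn_toLp, hH.coeFn_toLp]
    with x h1 h2 h3
  rw [h1, h2, h3, tensorCLM_apply]

theorem projGrad_mem (φ : Vec n → Vec N) (x : Vec n) : projGrad A φ x ∈ rangeSpace A :=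
  Submodule.starProjection_apply_mem _ _

theorem coercive_integral {c : ℝ}
    (h : ∀ Q ∈ rangeSpace A, c * ‖Q‖ ^ 2 ≤ inner ℝ (tensorMap A Q) Q) {φ : Vec n → Vec N}
    (hφ : MemLp (projGrad A φ) 2 (volume.restrict Ω)) :
    c * ‖hφ.toLp (projGrad A φ)‖ ^ 2 ≤
      ∫ x in Ω, inner ℝ (tensorMap A (projGrad A φ x)) (projGrad A φ x) := by
  rw [← real_inner_self_eq_norm_sq, ← integral_inner_eq_inner_toLp, ← integral_const_mul]
  refine integral_mono ((integrable_inner hφ hφ).const_mul c)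
    (integrable_inner ((tensorCLM A).comp_memLp' hφ) hφ) fun x => ?_
  beta_reduce
  rw [real_inner_self_eq_norm_sq]
  exact h _ (projGrad_mem φ x)

theorem norm_toLp_le_of_eLpNorm_le {α E F : Type*} [MeasurableSpace α] {μ : Measure α}
    [NormedAddCommGroup E] [NormedAddCommGroup F] {f : α → E} {g : α → F} (hf : MemLp f 2 μ)
    (hg : MemLp g 2 μ) {C : ℝ≥0} (h : eLpNorm f 2 μ ≤ C * eLpNorm g 2 μ) :
    ‖hf.toLp f‖ ≤ C * ‖hg.toLp g‖ := by
  rw [Lp.norm_toLp, Lp.norm_toLp]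
  have := ENNReal.toReal_mono (ENNReal.mul_ne_top ENNReal.coe_ne_top hg.eLpNorm_ne_top) h
  rwa [ENNReal.toReal_mul, ENNReal.coe_toReal] at this

/-- Existence of weak solutions. -/
theorem exists_weak_solution (hA : IsSymmConvexForm A) (hΩ : Bornology.IsBounded Ω)
    {f : Vec n → Vec N} (hf : MemLp f 2 (volume.restrict Ω)) :
    ∃ φ u G, IsEnergyLimit A Ω φ u G ∧ ∀ ψ : Vec n → Vec N, IsTestMap Ω (sigmaSpace A) ψ →
      ∫ x in Ω, inner ℝ (tensorMap A (G x)) (projGrad A ψ x) = -∫ x in Ω, inner ℝ (f x) (ψ x) := by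
  obtain ⟨C, hC⟩ := exists_poincare A hΩ
  obtain ⟨c, hc, hcoer⟩ := exists_coercive hA
  -- The datum is `-f` because integrating the second-order equation by parts once changes the sign.
  obtain ⟨z, hz, hzw⟩ := exists_mem_closure_of_coercive (testSpace A Ω)
    ((tensorCLM A).compLpL 2 (volume.restrict Ω)) hc (C := C)
    (by
      rintro _ ⟨φ, hφ, rfl⟩
      exact norm_toLp_le_of_eLpNorm_le hφ.memLp hφ.memLp_projGrad (hC φ hφ))
    (by
      rintro _ ⟨φ, hφ, rfl⟩
      refine (coercive_integral hcoer hφ.memLp_projGrad).trans (le_of_eq ?_)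
      exact (inner_compLpL_toLp (A := A) hφ.memLp_projGrad hφ.memLp_projGrad).symm) (-hf.toLp f)
  obtain ⟨s, hs, hlim⟩ := mem_closure_iff_seq_limit.1 hz
  choose φ hφ hsφ using hs
  have lim1 := ((WithLp.fstL 2 ℝ _ _).continuous.tendsto z).comp hlim
  have lim2 := ((WithLp.sndL 2 ℝ _ _).continuous.tendsto z).comp hlim
  have hu : MemLp (z.fst : Vec n → Vec N) 2 (volume.restrict Ω) := Lp.memLp z.fst
  have hG : MemLp (z.snd : Vec n → Mat N n) 2 (volume.restrict Ω) := Lp.memLp z.snd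
  refine ⟨φ, z.fst, z.snd, ⟨hu, hG, hφ, ?_, ?_⟩, fun ψ hψ => ?_⟩
  · refine (Lp.tendsto_Lp_iff_tendsto_eLpNorm'' φ (fun k => (hφ k).memLp) _ hu).1 ?_
    rw [Lp.toLp_coeFn]
    refine lim1.congr fun k => ?_
    rw [Function.comp_apply, hsφ]
    rfl
  · refine (Lp.tendsto_Lp_iff_tendsto_eLpNorm'' (fun k => projGrad A (φ k))
      (fun k => (hφ k).memLp_projGrad) _ hG).1 ?_
    rw [Lp.toLp_coeFn]
    refine lim2.congr fun k => ?_
    rw [Function.comp_apply, hsφ]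
    rfl
  · have h1 := hzw (testPair A hψ) ⟨ψ, hψ, rfl⟩
    have h2 := inner_compLpL_toLp (A := A) hG (hψ.memLp_projGrad (A := A))
    rw [Lp.toLp_coeFn] at h2
    rw [← h2, integral_inner_eq_inner_toLp hf hψ.memLp, ← inner_neg_left]
    exact h1

end WeakSolution

/-! ### Weak and distributional equation; vanishing of homogeneous solutions -/

section WeakEquation

open scoped NNReal ENNReal

variable {N n : ℕ} {A : Fin N → Fin n → Fin N → Fin n → ℝ} {Ω : Set (Vec n)}

theorem contDiff_partialD {g : Vec n → ℝ} (hg : ContDiff ℝ ∞ g) (i : Fin n) :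
    ContDiff ℝ ∞ (partialD i g) :=
  (hg.fderiv_right (m := ∞) (by simp)).clm_apply contDiff_const

theorem partialD_comm {g : Vec n → ℝ} (hg : ContDiff ℝ ∞ g) (i j : Fin n) (x : Vec n) :
    partialD i (partialD j g) x = partialD j (partialD i g) x := by
  have hd : DifferentiableAt ℝ (fderiv ℝ g) x :=
    ((hg.fderiv_right (m := ∞) (by simp)).differentiable (by simp)) x
  have h : ∀ i j : Fin n, partialD i (partialD j g) x =
      fderiv ℝ (fderiv ℝ g) x (EuclideanSpace.single i 1) (EuclideanSpace.single j 1) := by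
    intro i j
    change fderiv ℝ (fun y => fderiv ℝ g y (EuclideanSpace.single j 1)) x _ = _
    rw [fderiv_clm_apply hd (differentiableAt_const _)]
    simp
  rw [h, h]
  have hs : IsSymmSndFDerivAt ℝ g x :=
    hg.contDiffAt.isSymmSndFDerivAt (by
      rw [minSmoothness_of_isRCLikeNormedField]
      exact WithTop.coe_le_coe.2 (le_top : (2 : ℕ∞) ≤ ⊤))
  exact hs _ _

theorem integral_mul_partialD {f g : Vec n → ℝ} (hf : ContDiff ℝ 1 f) (hg : ContDiff ℝ 1 g)
    (hfc : HasCompactSupport f) (j : Fin n) :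
    ∫ x, f x * partialD j g x = -∫ x, partialD j f x * g x := by
  have hfd := continuous_fderiv_apply hf (EuclideanSpace.single j 1)
  have hgd := continuous_fderiv_apply hg (EuclideanSpace.single j 1)
  have hfdc := hfc.fderiv_apply (𝕜 := ℝ) (EuclideanSpace.single j 1)
  refine integral_mul_fderiv_eq_neg_fderiv_mul_of_integrable ?_ ?_ ?_
    (fun x _ => hf.differentiable one_ne_zero x) (fun x _ => hg.differentiable one_ne_zero x)
  · exact (hfd.mul hg.continuous).integrable_of_hasCompactSupport hfdc.mul_right
  · exact (hf.continuous.mul hgd).integrable_of_hasCompactSupport hfc.mul_right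
  · exact (hf.continuous.mul hg.continuous).integrable_of_hasCompactSupport hfc.mul_right

/-- The second order expression `∑ A_{αiβj} D²_{ij} ψ_α`. -/
noncomputable def secondOrder (A : Fin N → Fin n → Fin N → Fin n → ℝ) (ψ : Vec n → Vec N)
    (x : Vec n) : Vec N :=
  WithLp.toLp 2 fun β => ∑ α, ∑ i, ∑ j, A α i β j * partialD i (partialD j fun y => ψ y α) x

theorem inner_secondOrder (u : Vec N) (ψ : Vec n → Vec N) (x : Vec n) :
    inner ℝ u (secondOrder A ψ x) =
      ∑ α, ∑ β, ∑ i, ∑ j, A α i β j * u β * partialD i (partialD j fun y => ψ y α) x := by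
  rw [inner_vec, Finset.sum_comm]
  refine Finset.sum_congr rfl fun β _ => ?_
  simp only [secondOrder, Finset.mul_sum]
  refine Finset.sum_congr rfl fun α _ => Finset.sum_congr rfl fun i _ =>
    Finset.sum_congr rfl fun j _ => by ring

theorem continuous_secondOrder {ψ : Vec n → Vec N} (hψ : ContDiff ℝ ∞ ψ) :
    Continuous (secondOrder A ψ) := by
  refine (PiLp.continuous_toLp 2 _).comp (continuous_pi fun β => ?_)
  refine continuous_finsetSum _ fun α _ => continuous_finsetSum _ fun i _ =>
    continuous_finsetSum _ fun j _ => continuous_const.mul ?_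
  exact (contDiff_partialD (contDiff_partialD (contDiff_euclidean.1 hψ α) j) i).continuous

theorem inner_tensorMap_projGrad (hA : IsSymmConvexForm A) (φ ψ : Vec n → Vec N) (x : Vec n) :
    inner ℝ (tensorMap A (projGrad A φ x)) (projGrad A ψ x) =
      inner ℝ (tensorMap A (gradMat φ x)) (gradMat ψ x) := by
  rw [projGrad, projGrad, tensorMap_starProjection,
    inner_starProjection_of_mem _ (tensorMap_mem_rangeSpace hA _)]

/-- One derivative is moved from `ψ` to `φ`. The full gradients may then be replaced by their
projections, because the tensor factors through Π and takes values in Π. -/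
theorem integral_secondOrder_test (hA : IsSymmConvexForm A) {S : Submodule ℝ (Vec N)}
    {φ ψ : Vec n → Vec N} (hφ : IsTestMap Ω S φ) (hψ : ContDiff ℝ ∞ ψ) :
    ∫ x, inner ℝ (φ x) (secondOrder A ψ x) =
      -∫ x, inner ℝ (tensorMap A (projGrad A φ x)) (projGrad A ψ x) := by
  have hφc : ∀ β, ContDiff ℝ 1 fun y => φ y β := contDiff_euclidean.1 hφ.contDiff_one
  have hφs : ∀ β, HasCompactSupport fun y => φ y β := fun β =>
    hφ.compact.mono fun x hx h => hx (by
      have h' : φ x = 0 := h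
      simp [h'])
  have hψc : ∀ α, ContDiff ℝ ∞ fun y => ψ y α := contDiff_euclidean.1 hψ
  simp only [inner_tensorMap_projGrad hA, inner_secondOrder, inner_tensorMap]
  have hI1 : ∀ α β i j, Integrable fun x =>
      A α i β j * φ x β * partialD i (partialD j fun y => ψ y α) x := by
    intro α β i j
    have hc := (contDiff_partialD (contDiff_partialD (hψc α) j) i).continuous
    have := (((hφc β).continuous.mul hc).integrable_of_hasCompactSupport (μ := volume)
      (hφs β).mul_right).const_mul (A α i β j)
    exact this.congr (Eventually.of_forall fun x => (mul_assoc _ _ _).symm)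
  have hI2 : ∀ α i β j, Integrable fun x =>
      A α i β j * gradMat φ x (β, j) * gradMat ψ x (α, i) := by
    intro α i β j
    have hc := (contDiff_partialD (hψc α) i).continuous
    have hd := continuous_fderiv_apply (hφc β) (EuclideanSpace.single j 1)
    have := ((hd.mul hc).integrable_of_hasCompactSupport (μ := volume)
      ((hφs β).fderiv_apply (𝕜 := ℝ) _).mul_right).const_mul (A α i β j)
    exact this.congr (Eventually.of_forall fun x => (mul_assoc _ _ _).symm)
  rw [integral_finsetSum _ fun α _ => integrable_finsetSum _ fun β _ =>
      integrable_finsetSum _ fun i _ => integrable_finsetSum _ fun j _ => hI1 α β i j,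
    integral_finsetSum _ fun α _ => integrable_finsetSum _ fun i _ =>
      integrable_finsetSum _ fun β _ => integrable_finsetSum _ fun j _ => hI2 α i β j,
    ← Finset.sum_neg_distrib]
  refine Finset.sum_congr rfl fun α _ => ?_
  rw [integral_finsetSum _ fun β _ =>
      integrable_finsetSum _ fun i _ => integrable_finsetSum _ fun j _ => hI1 α β i j,
    integral_finsetSum _ fun i _ =>
      integrable_finsetSum _ fun β _ => integrable_finsetSum _ fun j _ => hI2 α i β j,
    ← Finset.sum_neg_distrib]
  have hL : ∀ β, ∫ x, ∑ i, ∑ j, A α i β j * φ x β * partialD i (partialD j fun y => ψ y α) x =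
      ∑ i, ∑ j, ∫ x, A α i β j * φ x β * partialD i (partialD j fun y => ψ y α) x := fun β => by
    rw [integral_finsetSum _ fun i _ => integrable_finsetSum _ fun j _ => hI1 α β i j]
    exact Finset.sum_congr rfl fun i _ => integral_finsetSum _ fun j _ => hI1 α β i j
  have hR : ∀ i, ∫ x, ∑ β, ∑ j, A α i β j * gradMat φ x (β, j) * gradMat ψ x (α, i) =
      ∑ β, ∑ j, ∫ x, A α i β j * gradMat φ x (β, j) * gradMat ψ x (α, i) := fun i => by
    rw [integral_finsetSum _ fun β _ => integrable_finsetSum _ fun j _ => hI2 α i β j]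
    exact Finset.sum_congr rfl fun β _ => integral_finsetSum _ fun j _ => hI2 α i β j
  simp only [hL, hR]
  rw [Finset.sum_comm]
  refine Finset.sum_congr rfl fun i _ => ?_
  rw [← Finset.sum_neg_distrib]
  refine Finset.sum_congr rfl fun β _ => ?_
  rw [← Finset.sum_neg_distrib]
  refine Finset.sum_congr rfl fun j _ => ?_
  -- The coefficient pairs index `j` with `β`, so it is `D_j` that must fall on `φ_β`; the second
  -- derivatives are exchanged to bring it outside.
  simp only [mul_assoc, partialD_comm (hψc α) i j]
  rw [integral_const_mul, integral_const_mul, ← mul_neg]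
  congr 1
  exact integral_mul_partialD (hφc β)
    ((contDiff_partialD (hψc α) i).of_le (by exact_mod_cast le_top)) (hφs β) j

theorem IsTestMap.eq_zero_of_notMem {S : Submodule ℝ (Vec N)} {φ : Vec n → Vec N}
    (hφ : IsTestMap Ω S φ) {x : Vec n} (hx : x ∉ Ω) : φ x = 0 :=
  image_eq_zero_of_notMem_tsupport fun h => hx (hφ.support h)

theorem projGrad_eq_zero_of_notMem {S : Submodule ℝ (Vec N)} {φ : Vec n → Vec N}
    (hφ : IsTestMap Ω S φ) {x : Vec n} (hx : x ∉ Ω) : projGrad A φ x = 0 :=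
  projGrad_eq_zero_of_notMem_tsupport fun h => hx (hφ.support h)

/-- The distributional and the weak forms of the equation agree on energy limits. -/
theorem IsEnergyLimit.integral_secondOrder (hA : IsSymmConvexForm A)
    (hΩ : Bornology.IsBounded Ω) {φ : ℕ → Vec n → Vec N} {u : Vec n → Vec N}
    {G : Vec n → Mat N n} (h : IsEnergyLimit A Ω φ u G) {S : Submodule ℝ (Vec N)}
    {ψ : Vec n → Vec N} (hψ : IsTestMap Ω S ψ) :
    ∫ x in Ω, inner ℝ (u x) (secondOrder A ψ x) =
      -∫ x in Ω, inner ℝ (tensorMap A (G x)) (projGrad A ψ x) := by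
  have lim1 := tendsto_integral_inner (fun k => (h.test k).memLp) h.memLp
    (memLp_of_continuous hΩ (continuous_secondOrder (A := A) hψ.smooth)) h.tendsto
  have lim2 := (tendsto_integral_inner (fun k => (h.test k).memLp_projGrad) h.memLp_grad
    ((tensorCLM A).comp_memLp' (hψ.memLp_projGrad (A := A))) h.tendsto_grad).neg
  simp only [Function.comp_apply, tensorCLM_apply, ← inner_tensorMap_comm hA] at lim2
  refine tendsto_nhds_unique lim1 (lim2.congr fun k => ?_)
  have := integral_secondOrder_test hA (h.test k) hψ.smooth
  rw [setIntegral_eq_integral_of_forall_compl_eq_zero fun x hx => by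
      rw [projGrad_eq_zero_of_notMem (h.test k) hx, map_zero, inner_zero_left],
    setIntegral_eq_integral_of_forall_compl_eq_zero fun x hx => by
      rw [(h.test k).eq_zero_of_notMem hx, inner_zero_left]]
  exact this.symm

theorem IsTestMap.sub {S : Submodule ℝ (Vec N)} {φ ψ : Vec n → Vec N} (hφ : IsTestMap Ω S φ)
    (hψ : IsTestMap Ω S ψ) : IsTestMap Ω S (φ - ψ) := by
  have := hφ.add (hψ.smul (-1))
  rwa [neg_one_smul, ← sub_eq_add_neg] at this

theorem projGrad_sub {φ ψ : Vec n → Vec N} (hφ : ContDiff ℝ 1 φ) (hψ : ContDiff ℝ 1 ψ) :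
    projGrad A (φ - ψ) = projGrad A φ - projGrad A ψ := by
  have hψ' : ContDiff ℝ 1 ((-1 : ℝ) • ψ) := hψ.const_smul (-1 : ℝ)
  have := projGrad_add (A := A) hφ hψ'
  rw [projGrad_smul hψ] at this
  rwa [neg_one_smul, ← sub_eq_add_neg, neg_one_smul, ← sub_eq_add_neg] at this

theorem tendsto_eLpNorm_sub_sub {α F : Type*} [MeasurableSpace α] {μ : Measure α}
    [NormedAddCommGroup F] {f f' : ℕ → α → F} {g g' : α → F} (hf : ∀ k, MemLp (f k) 2 μ)
    (hf' : ∀ k, MemLp (f' k) 2 μ) (hg : MemLp g 2 μ) (hg' : MemLp g' 2 μ)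
    (h : Tendsto (fun k => eLpNorm (fun x => f k x - g x) 2 μ) atTop (𝓝 0))
    (h' : Tendsto (fun k => eLpNorm (fun x => f' k x - g' x) 2 μ) atTop (𝓝 0)) :
    Tendsto (fun k => eLpNorm (fun x => (f k - f' k) x - (g - g') x) 2 μ) atTop (𝓝 0) := by
  have h1 := h.add h'
  rw [add_zero] at h1
  refine tendsto_of_tendsto_of_tendsto_of_le_of_le tendsto_const_nhds h1 (fun _ => zero_le)
    fun k => ?_
  have e : (fun x => (f k - f' k) x - (g - g') x) =
      (fun x => f k x - g x) - fun x => f' k x - g' x := by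
    ext x : 1
    simp only [Pi.sub_apply]
    abel
  beta_reduce
  rw [e]
  exact eLpNorm_sub_le ((hf k).sub hg).aestronglyMeasurable
    ((hf' k).sub hg').aestronglyMeasurable (by norm_num)

theorem IsEnergyLimit.sub {φ φ' : ℕ → Vec n → Vec N} {u u' : Vec n → Vec N}
    {G G' : Vec n → Mat N n} (h : IsEnergyLimit A Ω φ u G) (h' : IsEnergyLimit A Ω φ' u' G') :
    IsEnergyLimit A Ω (fun k => φ k - φ' k) (u - u') (G - G') where
  memLp := h.memLp.sub h'.memLp
  memLp_grad := h.memLp_grad.sub h'.memLp_grad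
  test k := (h.test k).sub (h'.test k)
  tendsto := tendsto_eLpNorm_sub_sub (fun k => (h.test k).memLp) (fun k => (h'.test k).memLp)
    h.memLp h'.memLp h.tendsto h'.tendsto
  tendsto_grad := by
    simp only [projGrad_sub (h.test _).contDiff_one (h'.test _).contDiff_one]
    exact tendsto_eLpNorm_sub_sub (fun k => (h.test k).memLp_projGrad)
      (fun k => (h'.test k).memLp_projGrad) h.memLp_grad h'.memLp_grad h.tendsto_grad
        h'.tendsto_grad

/-- An energy limit solving the homogeneous equation vanishes. -/
theorem IsEnergyLimit.ae_eq_zero (hA : IsSymmConvexForm A) (hΩ : Bornology.IsBounded Ω)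
    {φ : ℕ → Vec n → Vec N} {u : Vec n → Vec N} {G : Vec n → Mat N n}
    (h : IsEnergyLimit A Ω φ u G)
    (heq : ∀ ψ : Vec n → Vec N, IsTestMap Ω (sigmaSpace A) ψ →
      ∫ x in Ω, inner ℝ (tensorMap A (G x)) (projGrad A ψ x) = 0) :
    u =ᵐ[volume.restrict Ω] 0 := by
  obtain ⟨C, hC⟩ := exists_poincare A hΩ
  obtain ⟨c, hc, hcoer⟩ := exists_coercive hA
  have hg : ∀ k, MemLp (projGrad A (φ k)) 2 (volume.restrict Ω) :=
    fun k => (h.test k).memLp_projGrad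
  set T := (tensorCLM A).compLpL 2 (volume.restrict Ω) with hT
  have lim := tendsto_toLp hg h.memLp_grad h.tendsto_grad
  have lim1 : Tendsto (fun k => inner ℝ (T ((hg k).toLp _)) ((hg k).toLp _)) atTop
      (𝓝 (inner ℝ (T (h.memLp_grad.toLp G)) (h.memLp_grad.toLp G))) :=
    ((T.continuous.tendsto _).comp lim).inner lim
  have lim2 : Tendsto (fun k => inner ℝ (T (h.memLp_grad.toLp G)) ((hg k).toLp _)) atTop
      (𝓝 (inner ℝ (T (h.memLp_grad.toLp G)) (h.memLp_grad.toLp G))) :=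
    tendsto_const_nhds.inner lim
  -- The limit `G` is tested with the approximating maps themselves. Hence the energy of the limit
  -- is zero, the energies of the `φ k` tend to zero, and coercivity followed by Poincaré sends `φ
  -- k` to zero.
  have hzero : ∀ k, inner ℝ (T (h.memLp_grad.toLp G)) ((hg k).toLp (projGrad A (φ k))) = 0 :=
    fun k => (inner_compLpL_toLp h.memLp_grad (hg k)).trans (heq _ (h.test k))
  rw [tendsto_nhds_unique (lim2.congr hzero) tendsto_const_nhds] at lim1
  have lim3 : Tendsto (fun k => ‖(hg k).toLp (projGrad A (φ k))‖ ^ 2) atTop (𝓝 0) := by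
    have h1 := lim1.const_mul c⁻¹
    rw [mul_zero] at h1
    refine squeeze_zero (fun k => by positivity) (fun k => ?_) h1
    rw [hT, inner_compLpL_toLp, le_inv_mul_iff₀ hc]
    exact coercive_integral hcoer (hg k)
  have lim4 : Tendsto (fun k => ‖(hg k).toLp (projGrad A (φ k))‖) atTop (𝓝 0) := by
    have := lim3.sqrt
    simpa using this
  have lim5 : Tendsto (fun k => ‖(h.test k).memLp.toLp (φ k)‖) atTop (𝓝 0) := by
    have h1 := lim4.const_mul (C : ℝ)
    rw [mul_zero] at h1
    exact squeeze_zero (fun k => norm_nonneg _)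
      (fun k => norm_toLp_le_of_eLpNorm_le _ (hg k) (hC _ (h.test k))) h1
  have lim6 := (tendsto_toLp (fun k => (h.test k).memLp) h.memLp h.tendsto).norm
  have h0 := norm_eq_zero.1 (tendsto_nhds_unique lim6 lim5)
  exact (MemLp.toLp_eq_toLp_iff h.memLp MemLp.zero).1 (by rw [h0]; rfl)

/-- The derivative is the component `⟨η ⊗ a, G⟩`: integration by parts holds for the test maps and
survives the `L²` limit. -/
theorem IsEnergyLimit.exists_weakDirDeriv (hΩ : Bornology.IsBounded Ω)
    {φ : ℕ → Vec n → Vec N} {u : Vec n → Vec N} {G : Vec n → Mat N n}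
    (h : IsEnergyLimit A Ω φ u G) {η : Vec N} {a : Vec n} (hηa : tensor η a ∈ rangeSpace A) :
    ∃ g : Vec n → ℝ, MemLp g 2 (volume.restrict Ω) ∧
      IsWeakDirDeriv Ω a (fun x => inner ℝ η (u x)) g := by
  have : IsFiniteMeasure (volume.restrict Ω) :=
    ⟨by rw [Measure.restrict_apply_univ]; exact hΩ.measure_lt_top⟩
  have hloc : ∀ {w : Vec n → ℝ}, MemLp w 2 (volume.restrict Ω) → LocallyIntegrableOn w Ω :=
    fun hw => IntegrableOn.locallyIntegrableOn (hw.integrable (by norm_num))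
  have hu := h.memLp.const_inner (𝕜 := ℝ) η
  have hG := h.memLp_grad.const_inner (𝕜 := ℝ) (tensor η a)
  refine ⟨fun x => inner ℝ (tensor η a) (G x), hG, hloc hu, hloc hG, fun ψ hψ hψc hψΩ => ?_⟩
  have hψ1 : ContDiff ℝ 1 ψ := hψ.of_le (by exact_mod_cast le_top)
  have lim1 := tendsto_integral_mul (g := fun x => fderiv ℝ ψ x a)
    (fun k => (h.test k).memLp.const_inner (𝕜 := ℝ) η) hu
    (memLp_of_continuous hΩ (continuous_fderiv_apply hψ1 a))
    (tendsto_zero_of_le_mul (C := ENNReal.ofReal ‖η‖) ENNReal.ofReal_ne_top h.tendsto fun k => by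
      simp only [← inner_sub_right]
      exact eLpNorm_inner_le _ _ _)
  have lim2 := (tendsto_integral_mul (g := ψ)
    (fun k => ((h.test k).memLp_projGrad (A := A)).const_inner (𝕜 := ℝ) (tensor η a)) hG
    (memLp_of_continuous hΩ hψ.continuous)
    (tendsto_zero_of_le_mul (C := ENNReal.ofReal ‖tensor η a‖) ENNReal.ofReal_ne_top
      h.tendsto_grad fun k => by
        simp only [← inner_sub_right]
        exact eLpNorm_inner_le _ _ _)).neg
  refine tendsto_nhds_unique lim1 (lim2.congr fun k => ?_)
  have hf := contDiff_inner_left (h.test k).contDiff_one η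
  have hfc : HasCompactSupport fun y => (inner ℝ η (φ k y) : ℝ) :=
    (h.test k).compact.mono fun x hx h0 => hx (by
      have h' : φ k x = 0 := h0
      simp [h'])
  rw [setIntegral_eq_integral_of_forall_compl_eq_zero fun x hx => by
      rw [projGrad_eq_zero_of_notMem (h.test k) hx, inner_zero_right, zero_mul],
    setIntegral_eq_integral_of_forall_compl_eq_zero fun x hx => by
      rw [(h.test k).eq_zero_of_notMem hx, inner_zero_right, zero_mul]]
  simp only [inner_tensor_projGrad (h.test k).contDiff_one hηa]
  symm
  exact integral_mul_fderiv_eq_neg_fderiv_mul_of_integrable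
    (((continuous_fderiv_apply hf a).mul hψ.continuous).integrable_of_hasCompactSupport
      hψc.mul_left)
    ((hf.continuous.mul (continuous_fderiv_apply hψ1 a)).integrable_of_hasCompactSupport
      hfc.mul_right)
    ((hf.continuous.mul hψ.continuous).integrable_of_hasCompactSupport hfc.mul_right)
    (fun x _ => hf.differentiable one_ne_zero x) (fun x _ => hψ1.differentiable one_ne_zero x)

end WeakEquation

/-! ### One representative for all traces -/

section PreciseRepresentative

open scoped NNReal ENNReal

variable {N n : ℕ} {A : Fin N → Fin n → Fin N → Fin n → ℝ} {Ω : Set (Vec n)}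

/-- The limit is taken wherever it exists and set to zero elsewhere, without reference to a measure,
so the same map serves for `Ω` and for every boundary. The value zero keeps it in closed sets
containing `0`. -/
theorem exists_pointwise_limit {α F : Type*} [MeasurableSpace α] [NormedAddCommGroup F]
    [CompleteSpace F] [SecondCountableTopology F] [MeasurableSpace F] [BorelSpace F]
    {φ : ℕ → α → F} (hφ : ∀ k, Measurable (φ k)) :
    ∃ v : α → F, Measurable v ∧ (∀ x, (∃ l, Tendsto (fun k => φ k x) atTop (𝓝 l)) →
      Tendsto (fun k => φ k x) atTop (𝓝 (v x))) ∧
      ∀ K : Set F, IsClosed K → 0 ∈ K → ∀ x, (∀ k, φ k x ∈ K) → v x ∈ K := by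
  set S : Set α := {x | ∃ l, Tendsto (fun k => φ k x) atTop (𝓝 l)} with hS
  have hSm : MeasurableSet S := measurableSet_exists_tendsto hφ
  have hex : ∀ x, ∃ l, Tendsto (fun k => S.indicator (φ k) x) atTop (𝓝 l) := by
    intro x
    by_cases hx : x ∈ S
    · simp only [Set.indicator_of_mem hx]
      exact hx
    · simp only [Set.indicator_of_notMem hx]
      exact ⟨0, tendsto_const_nhds⟩
  choose v hv using hex
  refine ⟨v, measurable_of_tendsto_metrizable (fun k => (hφ k).indicator hSm)
    (tendsto_pi_nhds.2 hv), fun x hx => ?_, fun K hK h0 x hx => ?_⟩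
  · have hxS : x ∈ S := hx
    simpa only [Set.indicator_of_mem hxS] using hv x
  · refine hK.mem_of_tendsto (hv x) (Eventually.of_forall fun k => ?_)
    by_cases hxS : x ∈ S
    · rw [Set.indicator_of_mem hxS]; exact hx k
    · rw [Set.indicator_of_notMem hxS]; exact h0

/-- An energy limit has a Borel representative which is the limit of its approximations in every
measure controlled by the energy. -/
theorem IsEnergyLimit.exists_representative {φ : ℕ → Vec n → Vec N} {u : Vec n → Vec N}
    {G : Vec n → Mat N n} (h : IsEnergyLimit A Ω φ u G) :
    ∃ (ψ : ℕ → Vec n → Vec N) (v : Vec n → Vec N), IsEnergyLimit A Ω ψ v G ∧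
      v =ᵐ[volume.restrict Ω] u ∧ Measurable v ∧
      (∀ x ∉ Ω, v x = 0) ∧ (∀ x, v x ∈ sigmaSpace A) ∧
      ∀ (μ : Measure (Vec n)) (C : ℝ≥0), (∀ w : Vec n → Vec N, IsTestMap Ω (sigmaSpace A) w →
        eLpNorm w 2 μ ≤ C * (eLpNorm w 2 (volume.restrict Ω) +
          eLpNorm (projGrad A w) 2 (volume.restrict Ω))) →
        Tendsto (fun k => eLpNorm (fun x => ψ k x - v x) 2 μ) atTop (𝓝 0) := by
  -- A summable rate makes the subsequence converge almost everywhere in any measure dominated by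
  -- the energy.
  set ε : ℕ → ℝ≥0∞ := fun j => 2⁻¹ ^ j with hε
  have hε0 : ∀ j, 0 < ε j := fun j => ENNReal.pow_pos (by simp) j
  have hεtop : ∀ j, ε j ≠ ⊤ := fun j => ENNReal.pow_ne_top (by simp)
  have hεlim : Tendsto ε atTop (𝓝 0) :=
    ENNReal.tendsto_pow_atTop_nhds_zero_of_lt_one (by simp)
  have hεanti : ∀ {i j}, i ≤ j → ε j ≤ ε i := fun hij =>
    pow_le_pow_right_of_le_one' (by simp) hij
  have hex : ∀ j, ∃ k, eLpNorm (fun x => φ k x - u x) 2 (volume.restrict Ω) ≤ ε j ∧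
      eLpNorm (fun x => projGrad A (φ k) x - G x) 2 (volume.restrict Ω) ≤ ε j := fun j =>
    ((ENNReal.tendsto_nhds_zero.1 h.tendsto (ε j) (hε0 j)).and
      (ENNReal.tendsto_nhds_zero.1 h.tendsto_grad (ε j) (hε0 j))).exists
  choose κ hκ hκ' using hex
  set ψ : ℕ → Vec n → Vec N := fun j => φ (κ j) with hψ
  have htest : ∀ j, IsTestMap Ω (sigmaSpace A) (ψ j) := fun j => h.test (κ j)
  obtain ⟨v, hvm, hvlim, hvK⟩ := exists_pointwise_limit
    (fun j => (htest j).smooth.continuous.measurable)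
  have hpair : ∀ {F : Type} [NormedAddCommGroup F] {f : ℕ → Vec n → F} {g : Vec n → F},
      (∀ k, MemLp (f k) 2 (volume.restrict Ω)) → MemLp g 2 (volume.restrict Ω) →
      (∀ j, eLpNorm (fun x => f j x - g x) 2 (volume.restrict Ω) ≤ ε j) →
      ∀ M k m, M ≤ k → M ≤ m → eLpNorm (f k - f m) 2 (volume.restrict Ω) ≤ ε M + ε M := by
    intro F _ f g hf hg hfg M k m hk hm
    have e : f k - f m = (fun x => f k x - g x) - fun x => f m x - g x := by
      ext x : 1
      simp only [Pi.sub_apply]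
      abel
    rw [e]
    exact (eLpNorm_sub_le ((hf k).sub hg).aestronglyMeasurable
      ((hf m).sub hg).aestronglyMeasurable (by norm_num)).trans
      (add_le_add ((hfg k).trans (hεanti hk)) ((hfg m).trans (hεanti hm)))
  have hlim : ∀ (μ : Measure (Vec n)) (C : ℝ≥0), (∀ w : Vec n → Vec N,
      IsTestMap Ω (sigmaSpace A) w → eLpNorm w 2 μ ≤ C * (eLpNorm w 2 (volume.restrict Ω) +
          eLpNorm (projGrad A w) 2 (volume.restrict Ω))) →
      Tendsto (fun k => eLpNorm (fun x => ψ k x - v x) 2 μ) atTop (𝓝 0) := by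
    intro μ C hC
    -- Each of `ψ k - ψ m` and its projected gradient contributes `2 * ε M`, hence `4`; the extra
    -- `1` makes the Cauchy bound strict.
    set D : ℝ≥0∞ := C * 4 + 1 with hD
    have hDtop : D ≠ ⊤ := ENNReal.add_ne_top.2
      ⟨ENNReal.mul_ne_top ENNReal.coe_ne_top (by norm_num), ENNReal.one_ne_top⟩
    have hsum : ∑' j, D * ε j ≠ ⊤ := by
      rw [ENNReal.tsum_mul_left]
      refine ENNReal.mul_ne_top hDtop ?_
      rw [hε, ENNReal.tsum_geometric_two]
      norm_num
    have hcau : ∀ M k m : ℕ, M ≤ k → M ≤ m → eLpNorm (ψ k - ψ m) 2 μ < D * ε M := by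
      intro M k m hk hm
      have h1 := hpair (fun k => (htest k).memLp) h.memLp hκ M k m hk hm
      have h2 := hpair (fun k => (htest k).memLp_projGrad (A := A)) h.memLp_grad hκ' M k m hk hm
      rw [← projGrad_sub (htest k).contDiff_one (htest m).contDiff_one] at h2
      have h3 : eLpNorm (ψ k - ψ m) 2 μ ≤ C * 4 * ε M := by
        refine (hC _ ((htest k).sub (htest m))).trans ?_
        refine (mul_le_mul_right (add_le_add h1 h2) _).trans (le_of_eq ?_)
        ring
      refine h3.trans_lt ?_
      rw [hD, add_mul, one_mul]
      exact ENNReal.lt_add_right (ENNReal.mul_ne_top (ENNReal.mul_ne_top ENNReal.coe_ne_top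
        (by norm_num)) (hεtop M)) (hε0 M).ne'
    have hsm : ∀ k, AEStronglyMeasurable (ψ k) μ := fun k =>
      (htest k).smooth.continuous.aestronglyMeasurable
    have hae := Lp.ae_tendsto_of_cauchy_eLpNorm hsm (by norm_num) hsum hcau
    exact Lp.cauchy_tendsto_of_tendsto hsm v hsum hcau (hae.mono fun x hx => hvlim x hx)
  have hΩlim := hlim (volume.restrict Ω) 1 fun w _ => by
    rw [ENNReal.coe_one, one_mul]; exact le_self_add
  have hψu : Tendsto (fun k => eLpNorm (fun x => ψ k x - u x) 2 (volume.restrict Ω)) atTop (𝓝 0) :=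
    tendsto_of_tendsto_of_tendsto_of_le_of_le tendsto_const_nhds hεlim (fun _ => zero_le) hκ
  have hvu : v =ᵐ[volume.restrict Ω] u := by
    have h0 : eLpNorm (fun x => v x - u x) 2 (volume.restrict Ω) = 0 := by
      have hadd := hΩlim.add hψu
      rw [add_zero] at hadd
      refine le_antisymm (ge_of_tendsto' hadd fun k => ?_) zero_le
      have e : (fun x => v x - u x) = (fun x => ψ k x - u x) - fun x => ψ k x - v x := by
        ext x : 1
        simp only [Pi.sub_apply]
        abel
      rw [e, add_comm]
      exact eLpNorm_sub_le ((htest k).memLp.sub h.memLp).aestronglyMeasurable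
        ((htest k).smooth.continuous.measurable.sub hvm).aestronglyMeasurable (by norm_num)
    have hm : AEStronglyMeasurable (fun x => v x - u x) (volume.restrict Ω) :=
      hvm.aestronglyMeasurable.sub h.memLp.aestronglyMeasurable
    filter_upwards [(eLpNorm_eq_zero_iff hm (by norm_num)).1 h0] with x hx
    exact sub_eq_zero.1 hx
  refine ⟨ψ, v, ⟨h.memLp.ae_eq hvu.symm, h.memLp_grad, htest, hΩlim,
    tendsto_of_tendsto_of_tendsto_of_le_of_le tendsto_const_nhds hεlim (fun _ => zero_le) hκ'⟩,
    hvu, hvm, fun x hx => ?_, fun x => ?_, hlim⟩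
  · exact hvK {0} isClosed_singleton rfl x fun k => (htest k).eq_zero_of_notMem hx
  · exact hvK (sigmaSpace A) (sigmaSpace A).closed_of_finiteDimensional (Submodule.zero_mem _) x
      fun k => (htest k).mem x

/-- The trace estimate on `U` bounds the surface measure of `Γ` by the energy on `U`, hence by that
on `Ω`, so the measure-independent limit applies. -/
theorem IsEnergyLimit.hasPartialTrace {φ : ℕ → Vec n → Vec N} {u : Vec n → Vec N}
    {G : Vec n → Mat N n} (h : IsEnergyLimit A Ω φ u G) (hu : Measurable u)
    (huS : ∀ x, u x ∈ sigmaSpace A)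
    (hlim : ∀ (μ : Measure (Vec n)) (C : ℝ≥0), (∀ w : Vec n → Vec N,
      IsTestMap Ω (sigmaSpace A) w → eLpNorm w 2 μ ≤ C * (eLpNorm w 2 (volume.restrict Ω) +
          eLpNorm (projGrad A w) 2 (volume.restrict Ω))) →
      Tendsto (fun k => eLpNorm (fun x => φ k x - u x) 2 μ) atTop (𝓝 0))
    {U : Set (Vec n)} (hU : IsStrictlyConvexDomain U) (hUΩ : U ⊆ Ω) :
    HasPartialTrace A U u u := by
  have hle : (volume.restrict U : Measure (Vec n)) ≤ volume.restrict Ω :=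
    Measure.restrict_mono hUΩ le_rfl
  have hproj : ∀ k x, (sigmaSpace A).starProjection (φ k x) = φ k x := fun k x =>
    Submodule.starProjection_eq_self_iff.2 ((h.test k).mem x)
  obtain ⟨E, hEU, hE, hE0, htrace⟩ := exists_partial_trace_estimate A hU
  refine ⟨⟨h.memLp.mono_measure hle, Eventually.of_forall huS⟩, hu.aemeasurable, G, E, φ,
    h.memLp_grad.mono_measure hle, hEU, hE, hE0, fun k => (h.test k).contDiff_one, ?_, ?_, ?_⟩
  · simp only [hproj]
    exact tendsto_of_tendsto_of_tendsto_of_le_of_le tendsto_const_nhds h.tendsto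
      (fun _ => zero_le) fun k => eLpNorm_mono_measure _ hle
  · exact tendsto_of_tendsto_of_tendsto_of_le_of_le tendsto_const_nhds h.tendsto_grad
      (fun _ => zero_le) fun k => eLpNorm_mono_measure _ hle
  · intro Γ hΓ hsub
    obtain ⟨C, hC⟩ := htrace Γ hΓ hsub
    simp only [hproj]
    refine hlim _ C fun w hw => (hC w hw.contDiff_one hw.mem).trans (mul_le_mul_right ?_ _)
    exact add_le_add (eLpNorm_mono_measure _ hle) (eLpNorm_mono_measure _ hle)

theorem isDistribSolution_iff {f u : Vec n → Vec N} :
    IsDistribSolution A Ω f u ↔ LocallyIntegrableOn u Ω ∧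
      ∀ ψ : Vec n → Vec N, IsTestMap Ω (sigmaSpace A) ψ →
        ∫ x in Ω, inner ℝ (u x) (secondOrder A ψ x) = ∫ x in Ω, inner ℝ (f x) (ψ x) := by
  simp only [IsDistribSolution, inner_secondOrder]
  simp only [inner_vec]

theorem integrable_inner_tensorMap {μ : Measure (Vec n)} {G H : Vec n → Mat N n}
    (hG : MemLp G 2 μ) (hH : MemLp H 2 μ) :
    Integrable (fun x => inner ℝ (tensorMap A (G x)) (H x)) μ :=
  integrable_inner ((tensorCLM A).comp_memLp' hG) hH

end PreciseRepresentative

end DegenerateSystem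

/-! ### The main theorem -/

theorem theorem1 (n N : ℕ) (hn : 1 ≤ n) (hN : 1 ≤ N)
    (Ω : Set (DegenerateSystem.Vec n)) (hΩ : DegenerateSystem.IsStrictlyConvexDomain Ω)
    (A : Fin N → Fin n → Fin N → Fin n → ℝ) (hA : DegenerateSystem.IsSymmConvexForm A)
    (hspan : DegenerateSystem.SpannedByRankOne (DegenerateSystem.rangeSpace A))
    (f : DegenerateSystem.Vec n → DegenerateSystem.Vec N)
    (hf : DegenerateSystem.MemL2 Ω (DegenerateSystem.sigmaSpace A) f) :
    ∃ u : DegenerateSystem.Vec n → DegenerateSystem.Vec N,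
      DegenerateSystem.IsDirichletSolution A Ω f u ∧
      (∀ v : DegenerateSystem.Vec n → DegenerateSystem.Vec N,
        DegenerateSystem.IsDirichletSolution A Ω f v → v =ᵐ[volume.restrict Ω] u) ∧
      (∀ U : Set (DegenerateSystem.Vec n), DegenerateSystem.IsStrictlyConvexDomain U → U ⊆ Ω →
        AEMeasurable u (DegenerateSystem.surfaceMeasure (frontier U)) ∧
          DegenerateSystem.HasPartialTrace A U u u) ∧
      (∀ (η : DegenerateSystem.Vec N) (a : DegenerateSystem.Vec n),
        DegenerateSystem.tensor η a ∈ DegenerateSystem.rangeSpace A →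
          ∃ g : DegenerateSystem.Vec n → ℝ, MemLp g 2 (volume.restrict Ω) ∧
            DegenerateSystem.IsWeakDirDeriv Ω a (fun x => inner ℝ η (u x)) g) := by
  open DegenerateSystem in
  obtain ⟨φ₀, u₀, G, h₀, heq⟩ := exists_weak_solution hA hΩ.bounded hf.1
  obtain ⟨φ, u, h, -, hum, hu0, huS, hlim⟩ := h₀.exists_representative
  have htrace : ∀ U : Set (Vec n), IsStrictlyConvexDomain U → U ⊆ Ω → HasPartialTrace A U u u :=
    fun U hU hUΩ => h.hasPartialTrace hum huS hlim hU hUΩ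
  have : IsFiniteMeasure (volume.restrict Ω) :=
    ⟨by rw [Measure.restrict_apply_univ]; exact hΩ.bounded.measure_lt_top⟩
  refine ⟨u, ⟨⟨h.memLp, Eventually.of_forall huS⟩, isDistribSolution_iff.2
    ⟨IntegrableOn.locallyIntegrableOn (h.memLp.integrable (by norm_num)), fun ψ hψ => ?_⟩,
    htrace Ω hΩ subset_rfl, ?_⟩, fun v hv => ?_,
    fun U hU hUΩ => ⟨hum.aemeasurable, htrace U hU hUΩ⟩,
    fun η a hηa => h.exists_weakDirDeriv hΩ.bounded hηa⟩
  · rw [h.integral_secondOrder hA hΩ.bounded hψ, heq ψ hψ, neg_neg]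
  -- The representative vanishes everywhere off `Ω`, so the boundary condition holds at every point.
  · refine (ae_restrict_iff' isClosed_frontier.measurableSet).2 (Eventually.of_forall ?_)
    exact fun x hx => hu0 x (notMem_of_mem_frontier hΩ.isOpen hx)
  -- Any competitor is an energy limit as well, so its distributional equation becomes the weak one
  -- and the difference of the two solutions has zero right-hand side.
  · obtain ⟨φ', G', h'⟩ := exists_isEnergyLimit_of_partialTrace hspan hΩ hv.trace hv.boundary
    have hz := (h'.sub h).ae_eq_zero hA hΩ.bounded fun ψ hψ => by
      have h1 := h'.integral_secondOrder hA hΩ.bounded hψ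
      rw [(isDistribSolution_iff.1 hv.equation).2 ψ hψ] at h1
      have hψL := hψ.memLp_projGrad (A := A)
      have h2 := heq ψ hψ
      simp only [Pi.sub_apply, map_sub, inner_sub_left]
      rw [integral_sub (integrable_inner_tensorMap h'.memLp_grad hψL)
        (integrable_inner_tensorMap h.memLp_grad hψL)]
      linarith
    filter_upwards [hz] with x hx
    exact sub_eq_zero.1 hx
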